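/- **Theorem 3.** A classical problem is a set $L \subseteq \{0,1\}^*$, and a parameterized problem is a set $R \subseteq \{0,1\}^* \times \mathbb{N}$; the size of an instance $(y,p)$ is $|(y,p)| := |y| + p + c$ for a positive constant $c$ (accounting for the parentheses). A *linear OR composition* from $L$ to $R$ is an algorithm that takes $t \ge 1$ strings $x_1,\dots,x_t \in \{0,1\}^*$ and computes, in time polynomial in the total length of its input, a pair $(y,p) \in \{0,1\}^* \times \mathbb{N}$ such that (i) $|(y,p)| \le t \cdot \mathrm{poly}(\log t) \cdot \mathrm{poly}(\max_i |x_i|)$, (ii) $p \le \mathrm{poly}(\max_i |x_i| + \log t)$, and (iii) $(y,p) \in R$ if and only if $x_i \in L$ for some $i \in \{1,\dots,t\}$. A *polynomial-size Turing kernel with $O(n^{1-\varepsilon})$ queries* for $R$ is an algorithm with access to an oracle for $R$ that, on every input $(x,p) \in \{0,1\}^* \times \mathbb{N}$, correctly decides in time polynomial in $|(x,p)|$ whether $(x,p) \in R$, such that every oracle query "$(y,p') \in R$?" that it makes satisfies $|y| + p' \le f(p)$ for a fixed polynomial $f$, and the number of its queries is $O(n^{1-\varepsilon})$, where $n = |(x,p)|$.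 Let $R$ be a parameterized problem, and suppose that there is a linear OR composition from some NP-hard problem $L$ (NP-hard under polynomial-time many-one reductions) to $R$. Then, unless $\mathrm{NP} \subseteq \mathrm{coNP}/\mathrm{poly}$, for no real $\varepsilon > 0$ does $R$ have a polynomial-size Turing kernel with $O(n^{1-\varepsilon})$ queries. -/

import Mathlib

open Turing

namespace ParamComplexity

/-! ### Strings, instances and their encodings

A classical problem is a set of binary strings (`Set (List Bool)`), a parameterized problem is a
set of pairs of a binary string and a natural number (`Set (List Bool × ℕ)`). -/

/-- Self-delimiting code of a string: each bit `b` becomes `1b`, and the end is marked by `0`. -/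
def selfDelim (x : List Bool) : List Bool :=
  x.flatMap (fun b => [true, b]) ++ [false]

/-- The pair `⟨x, w⟩` of two binary strings, as one binary string. -/
def pair (x w : List Bool) : List Bool :=
  selfDelim x ++ w

/-- A finite sequence of binary strings, as one binary string. -/
def encodeTuple (xs : List (List Bool)) : List Bool :=
  xs.flatMap selfDelim

/-- An instance `(y, p)` of a parameterized problem, as one binary string
(the parameter is written in unary, in accordance with the size `|y| + p + O(1)`). -/
def encodeInstance (z : List Bool × ℕ) : List Bool :=
  pair z.1 (List.replicate z.2 true)

/-- The size `|(y, p)| = |y| + p + c` of an instance of a parameterized problem; the constant `c`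
accounts for the two parentheses. -/
def instSize (z : List Bool × ℕ) : ℕ :=
  z.1.length + z.2 + 2

/-! ### Polynomial time, NP, coNP and polynomial advice -/

/-- `f : {0,1}* → {0,1}*` is computable by a deterministic Turing machine in polynomial time. -/
def PolyTimeFun (f : List Bool → List Bool) : Prop :=
  Nonempty (TM2ComputableInPolyTime (id : List Bool → List Bool) (id : List Bool → List Bool) f)

/-- The class P. -/
def classP : Set (Set (List Bool)) :=
  {B | ∃ f : List Bool → Bool,
    Nonempty (TM2ComputableInPolyTime (id : List Bool → List Bool) Computability.encodeBool f) ∧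
      ∀ x, x ∈ B ↔ f x = true}

/-- The class NP: problems with polynomial-time verifiable certificates of polynomial length. -/
def classNP : Set (Set (List Bool)) :=
  {A | ∃ B ∈ classP, ∃ q : Polynomial ℕ,
    ∀ x, x ∈ A ↔ ∃ w : List Bool, w.length ≤ q.eval x.length ∧ pair x w ∈ B}

/-- The class coNP. -/
def classCoNP : Set (Set (List Bool)) :=
  {A | Aᶜ ∈ classNP}

/-- The class `C/poly`: problems decided by a problem in `C` with the help of an advice string of
polynomial length that depends only on the length of the input. -/
def withPolyAdvice (C : Set (Set (List Bool))) : Set (Set (List Bool)) :=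
  {A | ∃ B ∈ C, ∃ (a : ℕ → List Bool) (q : Polynomial ℕ),
    (∀ n, (a n).length ≤ q.eval n) ∧ ∀ x, x ∈ A ↔ pair x (a x.length) ∈ B}

/-- The class coNP/poly. -/
def classCoNPPoly : Set (Set (List Bool)) :=
  withPolyAdvice classCoNP

/-- Polynomial-time many-one (Karp) reducibility. -/
def KarpReducible (A L : Set (List Bool)) : Prop :=
  ∃ f : List Bool → List Bool, PolyTimeFun f ∧ ∀ x, x ∈ A ↔ f x ∈ L

/-- `L` is NP-hard. -/
def NPHard (L : Set (List Bool)) : Prop :=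
  ∀ A ∈ classNP, KarpReducible A L

/-! ### Linear OR compositions -/

/-- The maximum length of a string in a list of strings. -/
def maxLength (xs : List (List Bool)) : ℕ :=
  (xs.map List.length).foldr max 0

/-- There is a linear OR composition from the classical problem `L` to the parameterized
problem `R`: a polynomial-time algorithm that maps each sequence `x₁, …, x_t` (`t ≥ 1`) of strings
to an instance `(y, p)` with `|(y, p)| ≤ t · poly(log t) · poly(max |xᵢ|)` and
`p ≤ poly(max |xᵢ| + log t)`, such that `(y, p) ∈ R` iff some `xᵢ` is in `L`. -/
def HasLinearORComposition (L : Set (List Bool)) (R : Set (List Bool × ℕ)) : Prop :=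
  ∃ f : {xs : List (List Bool) // xs ≠ []} → List Bool × ℕ,
    Nonempty (TM2ComputableInPolyTime
      (fun xs : {xs : List (List Bool) // xs ≠ []} => encodeTuple xs.1) encodeInstance f) ∧
    (∃ q₁ q₂ : Polynomial ℕ, ∀ xs, instSize (f xs) ≤
      xs.1.length * q₁.eval (Nat.log 2 xs.1.length) * q₂.eval (maxLength xs.1)) ∧
    (∃ q : Polynomial ℕ, ∀ xs,
      (f xs).2 ≤ q.eval (maxLength xs.1 + Nat.log 2 xs.1.length)) ∧
    ∀ xs, f xs ∈ R ↔ ∃ x ∈ xs.1, x ∈ L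

/-! ### Oracle machines and Turing kernels -/

/-- A deterministic Turing machine with an oracle for a parameterized problem: a machine (in the
multi-stack model) with a query stack and three distinguished labels. When the machine reaches the
label `ask`, the instance written on the query stack is given to the oracle, the query stack is
emptied, and the computation goes on at the label `yes` or `no`, according to the answer. -/
structure OracleTM where
  /-- the underlying machine -/
  tm : FinTM2
  /-- inputs are binary strings -/
  inputAlphabet : tm.Γ tm.k₀ ≃ Bool
  /-- outputs are binary strings -/
  outputAlphabet : tm.Γ tm.k₁ ≃ Bool
  /-- the query stack -/
  kq : tm.K
  /-- queries are binary strings -/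
  queryAlphabet : tm.Γ kq ≃ Bool
  /-- the label at which the oracle is called -/
  ask : tm.Λ
  /-- the label at which the computation continues after a positive answer -/
  yes : tm.Λ
  /-- the label at which the computation continues after a negative answer -/
  no : tm.Λ

open Classical in
/-- The configuration after the oracle for `R` has answered the query `z` that was asked in a
configuration with internal state `v` and stacks `S`. -/
noncomputable def OracleTM.answer (M : OracleTM) (R : Set (List Bool × ℕ)) (z : List Bool × ℕ)
    (v : M.tm.σ) (S : ∀ k, List (M.tm.Γ k)) : M.tm.Cfg :=
  { l := some (if z ∈ R then M.yes else M.no)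
    var := v
    stk := Function.update S M.kq [] }

/-- `M.Runs R c qs n c'`: with an oracle for `R`, the machine `M` gets from the configuration `c`
to the configuration `c'` in exactly `n` steps, and `qs` is the sequence of instances that it
queries on the way. -/
inductive OracleTM.Runs (M : OracleTM) (R : Set (List Bool × ℕ)) :
    M.tm.Cfg → List (List Bool × ℕ) → ℕ → M.tm.Cfg → Prop
  | refl (c : M.tm.Cfg) : OracleTM.Runs M R c [] 0 c
  | step {c c' c'' : M.tm.Cfg} {qs : List (List Bool × ℕ)} {n : ℕ}
      (hl : c.l ≠ some M.ask) (hstep : M.tm.step c = some c')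
      (hrun : OracleTM.Runs M R c' qs n c'') : OracleTM.Runs M R c qs (n + 1) c''
  | query {v : M.tm.σ} {S : ∀ k, List (M.tm.Γ k)} {z : List Bool × ℕ} {c'' : M.tm.Cfg}
      {qs : List (List Bool × ℕ)} {n : ℕ}
      (hz : (S M.kq).map M.queryAlphabet = encodeInstance z)
      (hrun : OracleTM.Runs M R (M.answer R z v S) qs n c'') :
      OracleTM.Runs M R { l := some M.ask, var := v, stk := S } (z :: qs) (n + 1) c''

/-- On input `z`, the machine `M` with an oracle for `R` halts after exactly `n` steps with
output `b`, having made exactly the queries `qs`. -/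
def OracleTM.Outputs (M : OracleTM) (R : Set (List Bool × ℕ)) (z : List Bool × ℕ) (b : Bool)
    (qs : List (List Bool × ℕ)) (n : ℕ) : Prop :=
  M.Runs R (initList M.tm ((encodeInstance z).map M.inputAlphabet.symm)) qs n
    (haltList M.tm ([b].map M.outputAlphabet.symm))

/-- `R` has a polynomial-size Turing kernel with `O(n ^ e)` queries, where `n = |(x, p)|`: an oracle
machine that decides `R` in polynomial time with an oracle for `R`, and that on input `(x, p)` makes
`O(|(x, p)| ^ e)` queries `(y, p')`, all of them with `|y| + p' ≤ f(p)` for a polynomial `f`. -/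
def HasPolyTuringKernel (R : Set (List Bool × ℕ)) (e : ℝ) : Prop :=
  ∃ (M : OracleTM) (T f : Polynomial ℕ) (C : ℝ), ∀ z : List Bool × ℕ,
    ∃ (b : Bool) (qs : List (List Bool × ℕ)) (n : ℕ),
      M.Outputs R z b qs n ∧
      (b = true ↔ z ∈ R) ∧
      n ≤ T.eval (instSize z) ∧
      (∀ z' ∈ qs, z'.1.length + z'.2 ≤ f.eval z.2) ∧
      (qs.length : ℝ) ≤ C * (instSize z : ℝ) ^ e

end ParamComplexity

open ParamComplexity

/-! Let `A` be in NP and let `g` reduce `A` to `L`. Fix a length `n` and let `S` be the set of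
strings of length `n` outside `A`. Each tuple of `t = (n + 2) ^ k` strings over `S` is mapped
entrywise by `g` and composed to one instance `z`, which is not in `R`. The size of `z` is `t` times
a polynomial in `n`, and its parameter is polynomial in `n`. So the kernel asks at most `C * (t *
poly n) ^ (1 - ε)` queries on `z`, each of polynomial size. For `k` large enough all of them
together are described by at most `t` bits (`exists_tuple_length`).

Hence the list of queries takes at most `2 ^ t` values on these tuples. By pigeonhole some list is
shared by a fraction `2 ^ (-t)` of all tuples over `S`. All entries of those tuples lie in the set
`C` of strings that they cover, so `|S| ^ t ≤ 2 ^ t * |C| ^ t`, that is, `C` contains half of `S`.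
Repeating this on `S \ C` covers `S` with `2 * n + 1` lists (`exists_list_cover`). These lists with
the true oracle answers form a table of polynomial length, which serves as advice (`exists_table`).

A string `x` is certified to lie outside `A` by guessing a tuple that contains `x`, computing `z`,
and running the kernel with answers looked up in the table until it rejects. Every entry of the
table is correct, so a completed simulation is the true run and `z ∉ R`; then no entry of the tuple
is in `A`, whatever tuple was guessed (`exists_tuple_of_exec_verifier`). Conversely the covering
provides a tuple all of whose queries are in the table (`exec_verifier`). So the complement of `A`
is in NP with polynomial advice, and `A` is in coNP/poly (`mem_classCoNPPoly_of_kernel`).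

The verifier has to be an actual machine. It is written as a regular program whose atomic actions
work on stacks and on the configurations of three hosted machines. Such a program is compiled to a
machine that consumes one certificate bit per unit of cost, so bounded executions define an NP
problem (`StackMachine.setOf_exec_mem_classNP`, `Host.setOf_exec_mem_classNP`). -/

/-! ### Counted reachability -/

/-- `ReachesIn r n a b`: there is an `r`-path of length exactly `n` from `a` to `b`. -/
inductive ReachesIn {α : Type*} (r : α → α → Prop) : ℕ → α → α → Prop
  | refl (a : α) : ReachesIn r 0 a a
  | head {n : ℕ} {a b c : α} (h : r a b) (t : ReachesIn r n b c) : ReachesIn r (n + 1) a c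

namespace ReachesIn

variable {α : Type*} {r : α → α → Prop}

theorem trans {m n : ℕ} {a b c : α} (h : ReachesIn r m a b) (h' : ReachesIn r n b c) :
    ReachesIn r (m + n) a c := by
  induction h with
  | refl a => simpa using h'
  | head h _ ih => rw [Nat.add_right_comm]; exact .head h (ih h')

/-- A deterministic relation has at most one reachable terminal element. -/
theorem eq_of_terminal (hdet : ∀ a b c, r a b → r a c → b = c) {m n : ℕ} {a b c : α}
    (h : ReachesIn r m a b) (h' : ReachesIn r n a c) (hb : ∀ x, ¬ r b x) (hc : ∀ x, ¬ r c x) :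
    b = c := by
  induction h generalizing n with
  | refl a =>
    cases h' with
    | refl => rfl
    | head h _ => exact absurd h (hb _)
  | head h _ ih =>
    cases h' with
    | refl => exact absurd h (hc _)
    | head h2 t2 => exact ih (hdet _ _ _ h h2 ▸ t2) hb

theorem iterate_bind_iff {f : α → Option α} {n : ℕ} {a b : α} :
    (flip bind f)^[n] (some a) = some b ↔ ReachesIn (fun x y => f x = some y) n a b := by
  have hnone : ∀ n, (flip bind f)^[n] none = none := by
    intro n
    induction n with
    | zero => rfl
    | succ n ih => rw [Function.iterate_succ_apply]; exact ih
  induction n generalizing a with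
  | zero =>
    constructor
    · intro h
      obtain rfl : a = b := Option.some.inj h
      exact .refl _
    · intro h
      cases h; rfl
  | succ n ih =>
    rw [Function.iterate_succ_apply]
    have hfa : flip bind f (some a) = f a := rfl
    rw [hfa]
    constructor
    · intro h
      cases hf : f a with
      | none => rw [hf, hnone] at h; cases h
      | some a' =>
        rw [hf] at h
        exact .head hf (ih.1 h)
    · intro h
      cases h with
      | head h t =>
        have h' : f a = some _ := h
        rw [h']
        exact ih.2 t

end ReachesIn

/-! ### Statements of stack machines -/

namespace StackMachine

open TM2

variable {K : Type} {Γ : K → Type} {Λ Λ' σ : Type}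

/-- The maximal number of symbols that a statement pushes. -/
def pushCount : Stmt Γ Λ σ → ℕ
  | .push _ _ q => pushCount q + 1
  | .peek _ _ q => pushCount q
  | .pop _ _ q => pushCount q
  | .load _ q => pushCount q
  | .branch _ q₁ q₂ => max (pushCount q₁) (pushCount q₂)
  | .goto _ => 0
  | .halt => 0

/-- Renaming of the jump targets of a statement. -/
def mapLabel (φ : Λ → Λ') : Stmt Γ Λ σ → Stmt Γ Λ' σ
  | .push k f q => .push k f (mapLabel φ q)
  | .peek k f q => .peek k f (mapLabel φ q)
  | .pop k f q => .pop k f (mapLabel φ q)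
  | .load f q => .load f (mapLabel φ q)
  | .branch f q₁ q₂ => .branch f (mapLabel φ q₁) (mapLabel φ q₂)
  | .goto f => .goto (fun v => φ (f v))
  | .halt => .halt

/-- The alphabets of a machine with an additional stack of bits. -/
abbrev optΓ (Γ : K → Type) : Option K → Type
  | none => Bool
  | some k => Γ k

/-- Stacks of a machine with an additional stack of bits. -/
def optStk (y : List Bool) (S : ∀ k, List (Γ k)) : ∀ k, List (optΓ Γ k)
  | none => y
  | some k => S k

@[simp] theorem optStk_none (y : List Bool) (S : ∀ k, List (Γ k)) : optStk y S none = y := rfl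

@[simp] theorem optStk_some (y : List Bool) (S : ∀ k, List (Γ k)) (k : K) :
    optStk y S (some k) = S k := rfl

variable [DecidableEq K]

theorem length_stepAux_le (s : Stmt Γ Λ σ) (v : σ) (S : ∀ k, List (Γ k)) (k : K) :
    ((stepAux s v S).stk k).length ≤ (S k).length + pushCount s := by
  induction s generalizing v S with
  | push k' f q ih =>
    simp only [stepAux, pushCount]
    refine (ih _ _).trans ?_
    by_cases h : k = k'
    · subst h; simp [Nat.add_assoc, Nat.add_comm]
    · rw [Function.update_of_ne h]; omega
  | peek k' f q ih => exact ih _ _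
  | pop k' f q ih =>
    simp only [stepAux, pushCount]
    refine (ih _ _).trans ?_
    by_cases h : k = k'
    · subst h; simp
    · simp [Function.update_of_ne h]
  | load f q ih => exact ih _ _
  | branch f q₁ q₂ ih₁ ih₂ =>
    simp only [stepAux, pushCount]
    cases f v
    · exact (ih₂ _ _).trans (by simp)
    · exact (ih₁ _ _).trans (by simp)
  | goto f => simp [stepAux]
  | halt => simp [stepAux]

theorem stepAux_mapLabel (φ : Λ → Λ') (s : Stmt Γ Λ σ) (v : σ) (S : ∀ k, List (Γ k)) :
    stepAux (mapLabel φ s) v S =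
      ⟨(stepAux s v S).l.map φ, (stepAux s v S).var, (stepAux s v S).stk⟩ := by
  induction s generalizing v S with
  | branch f q₁ q₂ ih₁ ih₂ =>
    simp only [stepAux, mapLabel]
    cases f v
    · exact ih₂ _ _
    · exact ih₁ _ _
  | push k f q ih => exact ih _ _
  | peek k f q ih => exact ih _ _
  | pop k f q ih => exact ih _ _
  | load f q ih => exact ih _ _
  | goto f => rfl
  | halt => rfl

/-- A machine with finitely many labels lets every stack grow by a bounded amount per step. -/
theorem exists_growth [Finite Λ] (M : Λ → Stmt Γ Λ σ) :
    ∃ d, ∀ n c c', ReachesIn (fun x y => step M x = some y) n c c' →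
      ∀ k, (c'.stk k).length ≤ (c.stk k).length + n * d := by
  cases nonempty_fintype Λ
  refine ⟨Finset.univ.sup fun l => pushCount (M l), fun n c c' h k => ?_⟩
  induction h with
  | refl a => simp
  | @head n a b c h t ih =>
    refine ih.trans ?_
    rcases a with ⟨_ | l, v, S⟩
    · simp at h
    · simp only [step, Option.some.injEq] at h
      subst h
      have h1 := length_stepAux_le (M l) v S k
      have h2 : pushCount (M l) ≤ Finset.univ.sup fun l => pushCount (M l) :=
        Finset.le_sup (f := fun l => pushCount (M l)) (Finset.mem_univ l)
      simp only [Nat.add_mul, one_mul] at *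
      omega

/-! ### Machines driven by their input -/

/-- A machine driven by a bit string: in each step it reads one bit and carries out the statement
that is given by its label and by this bit. The jump target `none` means acceptance, halting means
rejection. The machine accepts if it does so at some point before the bits run out. -/
def accepts (D : Λ → Bool → Stmt Γ (Option Λ) σ) : List Bool → Λ → σ → (∀ k, List (Γ k)) → Bool
  | [], _, _, _ => false
  | b :: y, l, v, S =>
    match stepAux (D l b) v S with
    | ⟨none, _, _⟩ => false
    | ⟨some none, _, _⟩ => true
    | ⟨some (some l'), v', S'⟩ => accepts D y l' v' S'

theorem update_optStk_some (y : List Bool) (S : ∀ k, List (Γ k)) (k : K) (x : List (Γ k)) :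
    Function.update (optStk y S) (some k) x = optStk y (Function.update S k x) := by
  funext k'
  rcases k' with _ | k'
  · exact Function.update_of_ne (by simp) _ _
  · by_cases h : k' = k
    · subst h
      exact (Function.update_self _ _ _).trans (Function.update_self k' x S).symm
    · refine (Function.update_of_ne (by simpa using h) _ _).trans ?_
      simp only [optStk_some, Function.update_of_ne h]

theorem update_optStk_none (y y' : List Bool) (S : ∀ k, List (Γ k)) :
    Function.update (optStk y S) none y' = optStk y' S := by
  funext k'
  rcases k' with _ | k'
  · exact Function.update_self _ _ _
  · exact Function.update_of_ne (by simp) _ _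

/-- A statement of a driven machine as a statement of the driving machine. -/
def liftDriven : Stmt Γ (Option Λ) σ → Stmt (optΓ Γ) (Λ ⊕ Bool) (σ × Option Bool)
  | .push k f q => .push (some k) (fun v => f v.1) (liftDriven q)
  | .peek k f q => .peek (some k) (fun v o => (f v.1 o, v.2)) (liftDriven q)
  | .pop k f q => .pop (some k) (fun v o => (f v.1 o, v.2)) (liftDriven q)
  | .load f q => .load (fun v => (f v.1, v.2)) (liftDriven q)
  | .branch f q₁ q₂ => .branch (fun v => f v.1) (liftDriven q₁) (liftDriven q₂)
  | .goto f => .goto (fun v => (f v.1).elim (.inr true) .inl)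
  | .halt => .goto (fun _ => .inr false)

/-- The lifted statement never halts: acceptance and halting both become jumps to a clearing label,
because a machine output requires all other stacks to be empty. -/
theorem stepAux_liftDriven (s : Stmt Γ (Option Λ) σ) (v : σ) (o : Option Bool) (y : List Bool)
    (S : ∀ k, List (Γ k)) :
    stepAux (liftDriven s) (v, o) (optStk y S) =
      ⟨some ((stepAux s v S).l.elim (.inr false) fun l => l.elim (.inr true) .inl),
        ((stepAux s v S).var, o), optStk y (stepAux s v S).stk⟩ := by
  induction s generalizing v S with
  | branch f q₁ q₂ ih₁ ih₂ =>
    simp only [stepAux, liftDriven]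
    cases f v
    · exact ih₂ _ _
    · exact ih₁ _ _
  | push k f q ih =>
    simp only [stepAux, liftDriven]
    rw [update_optStk_some]; exact ih _ _
  | peek k f q ih => exact ih _ _
  | pop k f q ih =>
    simp only [stepAux, liftDriven]
    rw [update_optStk_some]; exact ih _ _
  | load f q ih => exact ih _ _
  | goto f => rfl
  | halt => rfl

section Clear

variable {Γ' : K → Type} {τ : Type}

/-- Pop one symbol from each of the stacks in a list, and record whether there was any. -/
def popAll : List K → Stmt Γ' Λ (τ × Option Bool) → Stmt Γ' Λ (τ × Option Bool)
  | [], q => q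
  | k :: ks, q => .pop k (fun v o => (v.1, if o.isSome then some true else v.2)) (popAll ks q)

-- The flag records whether any listed stack was nonempty. Without `Nodup` a stack could lose two
-- symbols in one pass.
open Classical in
theorem stepAux_popAll (ks : List K) (hks : ks.Nodup) (q : Stmt Γ' Λ (τ × Option Bool)) (v : τ)
    (o : Option Bool) (S : ∀ k, List (Γ' k)) :
    stepAux (popAll ks q) (v, o) S =
      stepAux q (v, if ∀ k ∈ ks, S k = [] then o else some true)
        (fun k => if k ∈ ks then (S k).tail else S k) := by
  induction ks generalizing o S with
  | nil => simp [popAll]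
  | cons k ks ih =>
    rw [List.nodup_cons] at hks
    simp only [popAll, stepAux]
    rw [ih hks.2]
    congr 1
    · have hrest : (∀ k' ∈ ks, Function.update S k (S k).tail k' = []) ↔ ∀ k' ∈ ks, S k' = [] := by
        refine forall₂_congr fun k' hk' => ?_
        rw [Function.update_of_ne]
        rintro rfl; exact hks.1 hk'
      rw [if_congr hrest rfl rfl]
      cases hS : S k with
      | nil => simp [hS]
      | cons a l => simp [hS]
    · funext k'
      by_cases h : k' = k
      · subst h; simp [hks.1]
      · simp [h]

end Clear

/-- The statement that clears all stacks, writes the answer `b`, and halts. -/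
noncomputable def clearStmt [Fintype K] (v₀ : σ) (b : Bool) :
    Stmt (optΓ Γ) (Λ ⊕ Bool) (σ × Option Bool) :=
  .load (fun v => (v.1, none)) <| popAll (Finset.univ : Finset (Option K)).toList <|
    .branch (fun v => v.2.isSome) (.goto fun _ => .inr b)
      (.push none (fun _ => b) (.load (fun _ => (v₀, none)) .halt))

/-- The driving machine of a driven machine. -/
noncomputable def drive [Fintype K] (D : Λ → Bool → Stmt Γ (Option Λ) σ) (v₀ : σ) :
    Λ ⊕ Bool → Stmt (optΓ Γ) (Λ ⊕ Bool) (σ × Option Bool)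
  | .inl l => .pop none (fun v o => (v.1, o)) <|
      .branch (fun v => v.2.isSome)
        (.branch (fun v => v.2 = some true) (liftDriven (D l true)) (liftDriven (D l false)))
        (.goto fun _ => .inr false)
  | .inr b => clearStmt v₀ b

variable [Fintype K]

/-- One round of the clearing loop shortens all stacks at once. A round that finds them all empty
writes the answer and restores the initial state, as `haltList` demands. -/
theorem step_drive_clear (D : Λ → Bool → Stmt Γ (Option Λ) σ) (v₀ : σ) (b : Bool) (v : σ)
    (o : Option Bool) (y : List Bool) (S : ∀ k, List (Γ k)) [Decidable (y = [] ∧ ∀ k, S k = [])] :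
    step (drive D v₀) ⟨some (.inr b), (v, o), optStk y S⟩ =
      some (if y = [] ∧ ∀ k, S k = [] then ⟨none, (v₀, none), optStk [b] fun _ => []⟩
        else ⟨some (.inr b), (v, some true), optStk y.tail fun k => (S k).tail⟩) := by
  classical
  have h1 : (∀ k ∈ (Finset.univ : Finset (Option K)).toList, optStk y S k = []) ↔
      (y = [] ∧ ∀ k, S k = []) := by
    simp only [Finset.mem_toList, Finset.mem_univ, true_imp_iff, Option.forall, optStk_none,
      optStk_some]
  simp only [step, drive, clearStmt, stepAux]
  rw [stepAux_popAll _ (Finset.nodup_toList _)]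
  simp only [h1]
  -- Only the stack argument is exchanged: every stack is in the list, so the family defined by
  -- cases is the family of tails.
  rw [show ∀ T T' : ∀ k, List (optΓ Γ k), T = T' → ∀ q w, (some (stepAux q w T) :
      Option (Cfg (optΓ Γ) (Λ ⊕ Bool) (σ × Option Bool))) = some (stepAux q w T') from
    fun T T' h q w => by rw [h]]
  rotate_left 1
  · exact optStk y.tail fun k => (S k).tail
  · funext k
    rw [if_pos (by simp)]
    cases k <;> rfl
  split_ifs with h
  · simp only [stepAux, Option.isSome_none, cond_false]
    rw [update_optStk_none]
    obtain ⟨rfl, h⟩ := h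
    obtain rfl : S = fun _ => [] := funext h
    rfl
  · simp only [stepAux, Option.isSome_some, cond_true]

/-- All stacks shrink simultaneously, so the maximal height, not the total, governs the number of
rounds; the last round writes the answer. -/
theorem drive_clear (D : Λ → Bool → Stmt Γ (Option Λ) σ) (v₀ : σ) (b : Bool) (N : ℕ)
    (v : σ) (o : Option Bool) (y : List Bool) (S : ∀ k, List (Γ k))
    (hy : y.length ≤ N) (hS : ∀ k, (S k).length ≤ N) :
    ∃ n ≤ N + 1, ReachesIn (fun x y => step (drive D v₀) x = some y) n
      ⟨some (.inr b), (v, o), optStk y S⟩ ⟨none, (v₀, none), optStk [b] fun _ => []⟩ := by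
  classical
  induction N generalizing v o y S with
  | zero =>
    refine ⟨1, le_rfl, .head (step_drive_clear D v₀ b v o y S) ?_⟩
    rw [if_pos]
    · exact .refl _
    · exact ⟨List.length_eq_zero_iff.1 (by omega),
        fun k => List.length_eq_zero_iff.1 (by have := hS k; omega)⟩
  | succ N ih =>
    by_cases hc : y = [] ∧ ∀ k, S k = []
    · refine ⟨1, by omega, .head (step_drive_clear D v₀ b v o y S) ?_⟩
      rw [if_pos hc]
      exact .refl _
    · obtain ⟨n, hn, hr⟩ := ih v (some true) y.tail (fun k => (S k).tail) (by simp; omega)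
        (fun k => by have := hS k; simp; omega)
      refine ⟨n + 1, by omega, .head (step_drive_clear D v₀ b v o y S) ?_⟩
      rw [if_neg hc]
      exact hr

/-- The number of steps is linear in the input, up to a bound `d` on the number of symbols pushed
in a step. -/
theorem drive_run (D : Λ → Bool → Stmt Γ (Option Λ) σ) (v₀ : σ) (d : ℕ)
    (hd : ∀ l b, pushCount (D l b) ≤ d) (y : List Bool) (l : Λ) (v : σ) (o : Option Bool)
    (S : ∀ k, List (Γ k)) (N : ℕ) (hN : ∀ k, (S k).length ≤ N) :
    ∃ n ≤ N + (d + 2) * y.length + 2,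
      ReachesIn (fun x y => step (drive D v₀) x = some y) n
      ⟨some (.inl l), (v, o), optStk y S⟩
      ⟨none, (v₀, none), optStk [accepts D y l v S] fun _ => []⟩ := by
  induction y generalizing l v o S N with
  | nil =>
    obtain ⟨n, hn, h⟩ := drive_clear D v₀ false N v none [] S (by simp) hN
    refine ⟨n + 1, by simp; omega, .head ?_ h⟩
    simp [drive, step, update_optStk_none]
  | cons b y ih =>
    have hstep : step (drive D v₀) ⟨some (.inl l), (v, o), optStk (b :: y) S⟩ =
        some (stepAux (liftDriven (D l b)) (v, some b) (optStk y S)) := by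
      simp only [step, drive, stepAux, optStk_none, List.head?_cons, Option.isSome_some, cond_true,
        List.tail_cons]
      rw [update_optStk_none]
      cases b <;> simp
    rw [stepAux_liftDriven] at hstep
    have hlen : ∀ k, ((stepAux (D l b) v S).stk k).length ≤ N + d := fun k =>
      (length_stepAux_le _ _ _ k).trans (Nat.add_le_add (hN k) (hd l b))
    have hmul : (d + 2) * (b :: y).length = (d + 2) * y.length + d + 2 := by simp; ring
    rw [hmul]
    simp only [accepts]
    rcases hres : stepAux (D l b) v S with ⟨_ | _ | l', v', S'⟩ <;> rw [hres] at hstep hlen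
    -- The bound covers both the work stacks after this step and the unread bits, which are cleared
    -- too.
    · obtain ⟨n, hn, h⟩ := drive_clear D v₀ false (N + d + y.length) v' (some b) y S' (by omega)
        (fun k => (hlen k).trans (by simp))
      exact ⟨n + 1, by nlinarith, .head hstep h⟩
    · obtain ⟨n, hn, h⟩ := drive_clear D v₀ true (N + d + y.length) v' (some b) y S' (by omega)
        (fun k => (hlen k).trans (by simp))
      exact ⟨n + 1, by nlinarith, .head hstep h⟩
    · obtain ⟨n, hn, h⟩ := ih l' v' (some b) S' (N + d) hlen
      exact ⟨n + 1, by omega, .head hstep h⟩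

/-- Each simulated step uses up an input bit, so the driving machine always stops in linear time.
The extra stack serves both as input and as output. -/
theorem setOf_accepts_mem_classP [Finite Λ] [Finite σ] (D : Λ → Bool → Stmt Γ (Option Λ) σ)
    (l : Λ) (v₀ : σ) : {y | accepts D y l v₀ (fun _ => []) = true} ∈ classP := by
  classical
  cases nonempty_fintype Λ
  cases nonempty_fintype σ
  let d := Finset.univ.sup fun l => max (pushCount (D l true)) (pushCount (D l false))
  have hd : ∀ l b, pushCount (D l b) ≤ d := fun l b => by
    refine le_trans ?_ (Finset.le_sup (f := fun l => max (pushCount (D l true))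
      (pushCount (D l false))) (Finset.mem_univ l))
    cases b <;> simp
  let tm : FinTM2 :=
    { K := Option K, k₀ := none, k₁ := none, Γ := optΓ Γ, Λ := Λ ⊕ Bool, main := .inl l,
      σ := σ × Option Bool, initialState := (v₀, none), m := drive D v₀,
      Γk₀Fin := inferInstanceAs (Fintype Bool) }
  refine ⟨fun y => accepts D y l v₀ fun _ => [], ⟨?_⟩, fun x => Iff.rfl⟩
  refine
    { tm := tm, inputAlphabet := Equiv.refl _, outputAlphabet := Equiv.refl _,
      time := Polynomial.C (d + 2) * Polynomial.X + Polynomial.C 2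
      outputsFun := fun y => Classical.choice ?_ }
  obtain ⟨n, hn, h⟩ := drive_run D v₀ d hd y l v₀ none (fun _ => []) 0 (by simp)
  have hinit : initList tm (y.map (Equiv.refl Bool).invFun) =
      ⟨some (.inl l), (v₀, none), optStk y fun _ => []⟩ := by
    unfold initList
    congr 1
    funext k
    rcases k with _ | k
    · simp [tm]
    · rfl
  have hhalt : haltList tm ((Computability.encodeBool (accepts D y l v₀ fun _ => [])).map
      (Equiv.refl Bool).invFun) =
      ⟨none, (v₀, none), optStk [accepts D y l v₀ fun _ => []] fun _ => []⟩ := by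
    unfold haltList
    congr 1
    funext k
    rcases k with _ | k
    · simp [tm]; rfl
    · rfl
  refine ⟨⟨⟨n, ?_⟩, ?_⟩⟩
  · exact (congrArg (fun c => (flip bind tm.step)^[n] (some c)) hinit).trans
      ((ReachesIn.iterate_bind_iff.2 h).trans (congrArg some hhalt.symm))
  · simpa using hn

end StackMachine

/-! ### Regular programs -/

/-- Regular programs over a type of atomic actions: sequential composition, nondeterministic choice
and nondeterministic iteration. -/
inductive Prog (α : Type) : Type
  | atom (a : α)
  | seq (P Q : Prog α)
  | alt (P Q : Prog α)
  | star (P : Prog α)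

namespace Prog

/-- `P.Exec step n x y`: the program `P` can lead from the state `x` to the state `y`, at cost `n`,
where `step` is the meaning of the actions (partial functions on the states). -/
inductive Exec {α S : Type} (step : α → S → Option S) : Prog α → ℕ → S → S → Prop
  | atom {a : α} {x y : S} (h : step a x = some y) : Exec step (.atom a) 1 x y
  | seq {P Q : Prog α} {m n : ℕ} {x y z : S} (h₁ : Exec step P m x y) (h₂ : Exec step Q n y z) :
      Exec step (.seq P Q) (m + n) x z
  | left {P Q : Prog α} {n : ℕ} {x y : S} (h : Exec step P n x y) :
      Exec step (.alt P Q) (n + 1) x y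
  | right {P Q : Prog α} {n : ℕ} {x y : S} (h : Exec step Q n x y) :
      Exec step (.alt P Q) (n + 1) x y
  | nil {P : Prog α} {x : S} : Exec step (.star P) 1 x x
  | cons {P : Prog α} {m n : ℕ} {x y z : S} (h₁ : Exec step P m x y)
      (h₂ : Exec step (.star P) n y z) : Exec step (.star P) (m + n + 1) x z

/-- Replace the actions of a program. -/
def map {α β : Type} (φ : α → β) : Prog α → Prog β
  | .atom a => .atom (φ a)
  | .seq P Q => .seq (P.map φ) (Q.map φ)
  | .alt P Q => .alt (P.map φ) (Q.map φ)
  | .star P => .star (P.map φ)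

variable {α β S X : Type} {stepS : α → S → Option S} {stepX : β → X → Option X}

/-- If the actions of a program are simulated by other actions, so is the program. -/
theorem exec_map_iff {φ : α → β} {e : S → X}
    (hφ : ∀ a s, stepX (φ a) (e s) = (stepS a s).map e) (P : Prog α) (n : ℕ) (s : S) (y : X) :
    (P.map φ).Exec stepX n (e s) y ↔ ∃ s', e s' = y ∧ P.Exec stepS n s s' := by
  constructor
  · intro h
    generalize hx : e s = x at h
    generalize hP : P.map φ = P' at h
    induction h generalizing P s with
    | @atom a x y h =>
      cases P <;> simp only [map, reduceCtorEq, Prog.atom.injEq] at hP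
      subst hP hx
      rw [hφ, Option.map_eq_some_iff] at h
      obtain ⟨s', hs', rfl⟩ := h
      exact ⟨s', rfl, .atom hs'⟩
    | seq h₁ h₂ ih₁ ih₂ =>
      cases P <;> simp only [map, reduceCtorEq, Prog.seq.injEq] at hP
      obtain ⟨rfl, rfl⟩ := hP
      obtain ⟨t, rfl, ht⟩ := ih₁ _ _ hx rfl
      obtain ⟨t', rfl, ht'⟩ := ih₂ _ _ rfl rfl
      exact ⟨t', rfl, .seq ht ht'⟩
    | left h ih =>
      cases P <;> simp only [map, reduceCtorEq, Prog.alt.injEq] at hP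
      obtain ⟨rfl, rfl⟩ := hP
      obtain ⟨t, rfl, ht⟩ := ih _ _ hx rfl
      exact ⟨t, rfl, .left ht⟩
    | right h ih =>
      cases P <;> simp only [map, reduceCtorEq, Prog.alt.injEq] at hP
      obtain ⟨rfl, rfl⟩ := hP
      obtain ⟨t, rfl, ht⟩ := ih _ _ hx rfl
      exact ⟨t, rfl, .right ht⟩
    | nil =>
      cases P <;> simp only [map, reduceCtorEq, Prog.star.injEq] at hP
      exact ⟨s, hx, .nil⟩
    | cons h₁ h₂ ih₁ ih₂ =>
      cases P <;> simp only [map, reduceCtorEq, Prog.star.injEq] at hP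
      subst hP
      obtain ⟨t, rfl, ht⟩ := ih₁ _ _ hx rfl
      obtain ⟨t', rfl, ht'⟩ := ih₂ (P := Prog.star _) _ rfl rfl
      exact ⟨t', rfl, .cons ht ht'⟩
  · rintro ⟨s', rfl, h⟩
    induction h with
    | atom h => exact .atom (by rw [hφ, h]; rfl)
    | seq _ _ ih₁ ih₂ => exact .seq ih₁ ih₂
    | left _ ih => exact .left ih
    | right _ ih => exact .right ih
    | nil => exact .nil
    | cons _ _ ih₁ ih₂ => exact .cons ih₁ ih₂

end Prog

/-! ### Compiling regular programs to machines driven by guess bits -/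

namespace StackMachine

open TM2 Prog

section Run

variable {K : Type} [DecidableEq K] {Γ : K → Type} {Λ Λ' σ : Type}

/-- `GuessRun D w o x o' y`: reading the bits `w`, the driven machine `D` gets from the label `o` and
state `x` to the label `o'` and state `y` (the label `none` is the accepting one). -/
inductive GuessRun (D : Λ → Bool → Stmt Γ (Option Λ) σ) :
    List Bool → Option Λ → σ × (∀ k, List (Γ k)) → Option Λ → σ × (∀ k, List (Γ k)) → Prop
  | nil (o x) : GuessRun D [] o x o x
  | cons {b w l x o y o' z} (h : stepAux (D l b) x.1 x.2 = ⟨some o, y.1, y.2⟩)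
      (t : GuessRun D w o y o' z) : GuessRun D (b :: w) (some l) x o' z

theorem GuessRun.append {D : Λ → Bool → Stmt Γ (Option Λ) σ} {w w' o x o' y o'' z}
    (h : GuessRun D w o x o' y) (h' : GuessRun D w' o' y o'' z) :
    GuessRun D (w ++ w') o x o'' z := by
  induction h with
  | nil => exact h'
  | cons h _ ih => exact .cons h (ih h')

theorem stepAux_mapLabel_eq_some {φ : Λ → Λ'} {s : Stmt Γ Λ σ} {v : σ} {S : ∀ k, List (Γ k)}
    {o' : Λ'} {v' : σ} {S' : ∀ k, List (Γ k)} :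
    stepAux (mapLabel φ s) v S = ⟨some o', v', S'⟩ ↔
      ∃ o, φ o = o' ∧ stepAux s v S = ⟨some o, v', S'⟩ := by
  rw [stepAux_mapLabel]
  rcases stepAux s v S with ⟨l, v1, S1⟩
  simp only [Cfg.mk.injEq, Option.map_eq_some_iff]
  constructor
  · rintro ⟨⟨o, rfl, rfl⟩, rfl, rfl⟩
    exact ⟨o, rfl, rfl, rfl, rfl⟩
  · rintro ⟨o, rfl, rfl, rfl, rfl⟩
    exact ⟨⟨o, rfl, rfl⟩, rfl, rfl⟩

/-- Transports a run of a component into a compound machine; `ψ` also says where the exit of the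
component leads. -/
theorem GuessRun.map {D : Λ → Bool → Stmt Γ (Option Λ) σ} {D' : Λ' → Bool → Stmt Γ (Option Λ') σ}
    {φ : Λ → Λ'} {ψ : Option Λ → Option Λ'} (hψ : ∀ l, ψ (some l) = some (φ l))
    (hD : ∀ l b, D' (φ l) b = mapLabel ψ (D l b)) {w o x o' y} (h : GuessRun D w o x o' y) :
    GuessRun D' w (ψ o) x (ψ o') y := by
  induction h with
  | nil => exact .nil _ _
  | cons h _ ih =>
    rw [hψ]
    exact .cons (by rw [hD, stepAux_mapLabel_eq_some]; exact ⟨_, rfl, h⟩) ih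

/-- A prefix appears because acceptance is immediate and the remaining bits are ignored. -/
theorem accepts_iff {D : Λ → Bool → Stmt Γ (Option Λ) σ} {y : List Bool} {l : Λ}
    {x : σ × (∀ k, List (Γ k))} :
    accepts D y l x.1 x.2 = true ↔ ∃ w, w <+: y ∧ ∃ z, GuessRun D w (some l) x none z := by
  induction y generalizing l x with
  | nil =>
    simp only [accepts, Bool.false_eq_true, List.prefix_nil, exists_eq_left, false_iff, not_exists]
    intro z h
    cases h
  | cons b y ih =>
    simp only [accepts]
    rcases hres : stepAux (D l b) x.1 x.2 with ⟨_ | _ | l', v', S'⟩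
    · simp only [Bool.false_eq_true, false_iff, not_exists, not_and]
      intro w hw z h
      cases h with
      | cons h _ =>
        obtain ⟨rfl, -⟩ := List.cons_prefix_cons.1 hw
        rw [hres] at h; cases h
    · simp only [true_iff]
      exact ⟨[b], by simp, (v', S'), .cons hres (.nil _ _)⟩
    · simp only
      rw [ih (x := (v', S'))]
      constructor
      · rintro ⟨w, hw, z, h⟩
        exact ⟨b :: w, List.cons_prefix_cons.2 ⟨rfl, hw⟩, z, .cons (y := (v', S')) hres h⟩
      · rintro ⟨w, hw, z, h⟩
        cases h with
        | @cons _ w _ _ _ y _ _ h t =>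
          obtain ⟨rfl, hw'⟩ := List.cons_prefix_cons.1 hw
          rw [hres] at h
          simp only [Cfg.mk.injEq, Option.some.injEq] at h
          obtain ⟨rfl, h1, h2⟩ := h
          exact ⟨w, hw', z, by rw [h1, h2]; exact t⟩

end Run

section Compile

variable {K : Type} [DecidableEq K] {Γ : K → Type} {σ : Type}

/-- The meaning of a statement as an action on the state and the stacks: a jump is success, halting
is failure. -/
def stmtStep (s : Stmt Γ Unit σ) (x : σ × (∀ k, List (Γ k))) : Option (σ × (∀ k, List (Γ k))) :=
  (stepAux s x.1 x.2).l.map fun _ => ((stepAux s x.1 x.2).var, (stepAux s x.1 x.2).stk)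

theorem stmtStep_eq_some {s : Stmt Γ Unit σ} {x y : σ × (∀ k, List (Γ k))} :
    stmtStep s x = some y ↔ stepAux s x.1 x.2 = ⟨some (), y.1, y.2⟩ := by
  unfold stmtStep
  rcases stepAux s x.1 x.2 with ⟨l, v, S⟩
  rcases y with ⟨v', S'⟩
  cases l <;> simp

/-- The labels of the machine of a program. -/
def Label {α : Type} : Prog α → Type
  | .atom _ => Unit
  | .seq P Q => Label P ⊕ Label Q
  | .alt P Q => Option (Label P ⊕ Label Q)
  | .star P => Option (Label P)

instance {α : Type} (P : Prog α) : Finite (Label P) := by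
  induction P with
  | atom a => exact inferInstanceAs (Finite Unit)
  | seq P Q ih₁ ih₂ => exact inferInstanceAs (Finite (Label P ⊕ Label Q))
  | alt P Q ih₁ ih₂ => exact inferInstanceAs (Finite (Option (Label P ⊕ Label Q)))
  | star P ih => exact inferInstanceAs (Finite (Option (Label P)))

/-- The entry label of a program. -/
def start {α : Type} : ∀ P : Prog α, Label P
  | .atom _ => ()
  | .seq P _ => .inl (start P)
  | .alt _ _ => none
  | .star _ => none

/-- The driven machine of a program; the jump target `none` is the exit of the program. -/
def compile : ∀ P : Prog (Stmt Γ Unit σ), Label P → Bool → Stmt Γ (Option (Label P)) σ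
  | .atom s, _, _ => mapLabel (fun _ => none) s
  | .seq P Q, .inl q, b => mapLabel (fun o => some (o.elim (.inr (start Q)) .inl)) (compile P q b)
  | .seq _ Q, .inr q, b => mapLabel (Option.map .inr) (compile Q q b)
  | .alt P _, none, true => .goto fun _ => some (some (.inl (start P)))
  | .alt _ Q, none, false => .goto fun _ => some (some (.inr (start Q)))
  | .alt P _, some (.inl q), b => mapLabel (Option.map fun q => some (.inl q)) (compile P q b)
  | .alt _ Q, some (.inr q), b => mapLabel (Option.map fun q => some (.inr q)) (compile Q q b)
  | .star P, none, true => .goto fun _ => some (some (start P))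
  | .star _, none, false => .goto fun _ => none
  | .star P, some q, b => mapLabel some (compile P q b)

/-- Executions of the rest of a program, from a label on. -/
def Rest : ∀ P : Prog (Stmt Γ Unit σ), Label P → ℕ →
    σ × (∀ k, List (Γ k)) → σ × (∀ k, List (Γ k)) → Prop
  | .atom s, _, n, x, z => Exec stmtStep (.atom s) n x z
  | .seq P Q, .inl q, n, x, z => ∃ m k y, n = m + k ∧ Rest P q m x y ∧ Exec stmtStep Q k y z
  | .seq _ Q, .inr q, n, x, z => Rest Q q n x z
  | .alt P Q, none, n, x, z => Exec stmtStep (.alt P Q) n x z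
  | .alt P _, some (.inl q), n, x, z => Rest P q n x z
  | .alt _ Q, some (.inr q), n, x, z => Rest Q q n x z
  | .star P, none, n, x, z => Exec stmtStep (.star P) n x z
  | .star P, some q, n, x, z =>
      ∃ m k y, n = m + k ∧ Rest P q m x y ∧ Exec stmtStep (.star P) k y z

/-- Executions of the rest of a program, from a label or from the exit on. -/
def RestOpt (P : Prog (Stmt Γ Unit σ)) :
    Option (Label P) → ℕ → σ × (∀ k, List (Γ k)) → σ × (∀ k, List (Γ k)) → Prop
  | none, n, x, z => n = 0 ∧ x = z
  | some q, n, x, z => Rest P q n x z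

theorem exec_of_rest_start (P : Prog (Stmt Γ Unit σ)) {n : ℕ} {x z : σ × (∀ k, List (Γ k))}
    (h : Rest P (start P) n x z) : Exec stmtStep P n x z := by
  induction P generalizing n x z with
  | atom s => exact h
  | seq P Q ih₁ ih₂ =>
    obtain ⟨m, k, y, rfl, h₁, h₂⟩ := h
    exact .seq (ih₁ h₁) h₂
  | alt P Q ih₁ ih₂ => exact h
  | star P ih => exact h

/-- Soundness of compilation, one step at a time: the remaining execution is extended backwards, so
that induction on a run reaches the entry label. -/
theorem rest_of_step (P : Prog (Stmt Γ Unit σ)) (q : Label P) (b : Bool)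
    {x y z : σ × (∀ k, List (Γ k))} {o : Option (Label P)} {n : ℕ}
    (h : stepAux (compile P q b) x.1 x.2 = ⟨some o, y.1, y.2⟩) (hr : RestOpt P o n y z) :
    Rest P q (n + 1) x z := by
  induction P generalizing n x y z with
  | atom s =>
    obtain ⟨_, rfl, h₀⟩ := stepAux_mapLabel_eq_some.1 h
    obtain ⟨rfl, rfl⟩ := hr
    exact .atom (stmtStep_eq_some.2 h₀)
  | seq P Q ih₁ ih₂ =>
    rcases q with q | q
    · obtain ⟨o, rfl, h₀⟩ := stepAux_mapLabel_eq_some.1 h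
      rcases o with _ | q'
      -- The step exits `P`: its rest has cost 0 after the step, and all remaining cost belongs to
      -- `Q`.
      · exact ⟨1, n, y, by omega, by simpa using ih₁ q h₀ (o := none) (n := 0) ⟨rfl, rfl⟩,
          exec_of_rest_start Q hr⟩
      · obtain ⟨m, k, y', rfl, h₁, h₂⟩ := hr
        exact ⟨m + 1, k, y', by omega, ih₁ q h₀ (o := some q') h₁, h₂⟩
    · obtain ⟨o, rfl, h₀⟩ := stepAux_mapLabel_eq_some.1 h
      exact ih₂ q h₀ (by cases o <;> exact hr)
  | alt P Q ih₁ ih₂ =>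
    rcases q with _ | q | q
    · cases b
      · simp only [compile, stepAux, Cfg.mk.injEq, Option.some.injEq] at h
        obtain ⟨rfl, h1, h2⟩ := h
        obtain rfl : x = y := Prod.ext h1 h2
        exact .right (exec_of_rest_start Q hr)
      · simp only [compile, stepAux, Cfg.mk.injEq, Option.some.injEq] at h
        obtain ⟨rfl, h1, h2⟩ := h
        obtain rfl : x = y := Prod.ext h1 h2
        exact .left (exec_of_rest_start P hr)
    · obtain ⟨o, rfl, h₀⟩ := stepAux_mapLabel_eq_some.1 h
      exact ih₁ q h₀ (by cases o <;> exact hr)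
    · obtain ⟨o, rfl, h₀⟩ := stepAux_mapLabel_eq_some.1 h
      exact ih₂ q h₀ (by cases o <;> exact hr)
  | star P ih =>
    rcases q with _ | q
    · cases b
      · simp only [compile, stepAux, Cfg.mk.injEq, Option.some.injEq] at h
        obtain ⟨rfl, h1, h2⟩ := h
        obtain rfl : x = y := Prod.ext h1 h2
        obtain ⟨rfl, rfl⟩ := hr
        exact .nil
      · simp only [compile, stepAux, Cfg.mk.injEq, Option.some.injEq] at h
        obtain ⟨rfl, h1, h2⟩ := h
        obtain rfl : x = y := Prod.ext h1 h2
        obtain ⟨m, k, y, rfl, h₁, h₂⟩ := hr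
        exact .cons (exec_of_rest_start P h₁) h₂
    · obtain ⟨o, rfl, h₀⟩ := stepAux_mapLabel_eq_some.1 h
      rcases o with _ | q'
      · exact ⟨1, n, y, by omega, by simpa using ih q h₀ (o := none) (n := 0) ⟨rfl, rfl⟩, hr⟩
      · obtain ⟨m, k, y', rfl, h₁, h₂⟩ := hr
        exact ⟨m + 1, k, y', by omega, ih q h₀ (o := some q') h₁, h₂⟩

/-- Cost equals the number of bits: one for every choice and loop decision, and one, of arbitrary
value, for every atomic action. -/
theorem exists_guessRun (P : Prog (Stmt Γ Unit σ)) {n : ℕ} {x z : σ × (∀ k, List (Γ k))}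
    (h : Exec stmtStep P n x z) :
    ∃ w : List Bool, w.length = n ∧ GuessRun (compile P) w (some (start P)) x none z := by
  induction h with
  | atom h =>
    exact ⟨[true], rfl, .cons (stepAux_mapLabel_eq_some.2 ⟨(), rfl, stmtStep_eq_some.1 h⟩)
      (.nil _ _)⟩
  | @seq P Q _ _ _ _ _ _ _ ih₁ ih₂ =>
    obtain ⟨w₁, rfl, h₁⟩ := ih₁
    obtain ⟨w₂, rfl, h₂⟩ := ih₂
    refine ⟨w₁ ++ w₂, by simp, .append
      (h₁.map (D' := compile (.seq P Q)) (φ := .inl)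
        (ψ := fun o => some (o.elim (.inr (start Q)) .inl)) (fun _ => rfl) fun _ _ => rfl)
      (h₂.map (D' := compile (.seq P Q)) (φ := .inr) (ψ := Option.map .inr) (fun _ => rfl)
        fun _ _ => rfl)⟩
  | @left P Q _ _ _ _ ih =>
    obtain ⟨w, rfl, h⟩ := ih
    exact ⟨true :: w, rfl, .cons rfl (h.map (D' := compile (.alt P Q)) (φ := fun q => some (.inl q))
      (ψ := Option.map fun q => some (.inl q)) (fun _ => rfl) fun _ _ => rfl)⟩
  | @right P Q _ _ _ _ ih =>
    obtain ⟨w, rfl, h⟩ := ih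
    exact ⟨false :: w, rfl, .cons rfl (h.map (D' := compile (.alt P Q)) (φ := fun q => some (.inr q))
      (ψ := Option.map fun q => some (.inr q)) (fun _ => rfl) fun _ _ => rfl)⟩
  | nil => exact ⟨[false], rfl, .cons rfl (.nil _ _)⟩
  | @cons P _ _ _ _ _ _ _ ih₁ ih₂ =>
    obtain ⟨w₁, rfl, h₁⟩ := ih₁
    obtain ⟨w₂, rfl, h₂⟩ := ih₂
    exact ⟨true :: (w₁ ++ w₂), by simp, .cons rfl (.append
      (h₁.map (D' := compile (.star P)) (φ := some) (ψ := some) (fun _ => rfl) fun _ _ => rfl) h₂)⟩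

/-- The machine of a program, preceded by a loop that reads a self-delimiting input onto a stack. -/
def readCompile (P : Prog (Stmt Γ Unit σ)) (kin : K) (e : Bool → Γ kin) :
    Label P ⊕ Bool → Bool → Stmt Γ (Option (Label P ⊕ Bool)) σ
  | .inl q, b => mapLabel (Option.map .inl) (compile P q b)
  | .inr false, b => .goto fun _ => some (cond b (.inr true) (.inl (start P)))
  | .inr true, b => .push kin (fun _ => e b) (.goto fun _ => some (.inr false))

/-- After the input phase the labels stay within the program, so `rest_of_step` applies to every
step. -/
theorem rest_of_guessRun (P : Prog (Stmt Γ Unit σ)) (kin : K) (e : Bool → Γ kin)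
    {w : List Bool} {o : Option (Label P)} {x z : σ × (∀ k, List (Γ k))}
    (h : GuessRun (readCompile P kin e) w (o.map .inl) x none z) : RestOpt P o w.length x z := by
  generalize ho : o.map Sum.inl = o' at h
  generalize hn : (none : Option (Label P ⊕ Bool)) = o'' at h
  induction h generalizing o with
  | nil =>
    subst hn
    obtain rfl : o = none := by simpa using ho
    exact ⟨rfl, rfl⟩
  | cons h _ ih =>
    rcases o with _ | q
    · cases ho
    · cases ho
      obtain ⟨o, rfl, h₀⟩ := stepAux_mapLabel_eq_some.1 h
      exact rest_of_step P q _ h₀ (ih rfl hn)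

/-- The self-delimiting code separates the input, which lands on its stack in reversed order, from
the certificate, which is left to drive the program. -/
theorem accepts_read (P : Prog (Stmt Γ Unit σ)) (kin : K) (e : Bool → Γ kin) (u w : List Bool)
    (v : σ) (S : ∀ k, List (Γ k)) :
    accepts (readCompile P kin e) (pair u w) (.inr false) v S =
      accepts (readCompile P kin e) w (.inl (start P)) v
        (Function.update S kin (u.reverse.map e ++ S kin)) := by
  induction u generalizing S with
  | nil =>
    simp only [pair, selfDelim, List.flatMap_nil, List.nil_append, List.singleton_append,
      List.reverse_nil, List.map_nil, Function.update_eq_self]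
    rfl
  | cons b u ih =>
    have hp : pair (b :: u) w = true :: b :: pair u w := by simp [pair, selfDelim]
    have hS : Function.update S kin ((b :: u).reverse.map e ++ S kin) =
        Function.update (Function.update S kin (e b :: S kin)) kin
          (u.reverse.map e ++ Function.update S kin (e b :: S kin) kin) := by simp
    rw [hp, hS, ← ih]
    rfl

/-- The inputs on which a regular program has a terminating execution of polynomially bounded cost
form a problem in NP. -/
theorem setOf_exec_mem_classNP [Fintype K] [Finite σ] (P : Prog (Stmt Γ Unit σ)) (kin : K)
    (e : Bool → Γ kin) (v₀ : σ) (q : Polynomial ℕ) :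
    {u : List Bool | ∃ n ≤ q.eval u.length, ∃ z,
      P.Exec stmtStep n (v₀, Function.update (fun _ => []) kin (u.reverse.map e)) z} ∈ classNP := by
  -- The certificate is the bit sequence that drives the execution. Its length is the cost, so the
  -- same `q` bounds both.
  refine ⟨_, setOf_accepts_mem_classP (readCompile P kin e) (.inr false) v₀, q, fun u => ?_⟩
  simp only [Set.mem_ofPred_eq, accepts_read, List.append_nil]
  constructor
  · rintro ⟨n, hn, z, h⟩
    obtain ⟨w, rfl, hw⟩ := exists_guessRun P h
    refine ⟨w, hn, (accepts_iff (x := (v₀, Function.update (fun _ => []) kin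
      (u.reverse.map e)))).2 ⟨w, List.prefix_rfl, z, ?_⟩⟩
    exact hw.map (D' := readCompile P kin e) (φ := .inl) (ψ := Option.map .inl) (fun _ => rfl)
      fun _ _ => rfl
  · rintro ⟨w, hw, h⟩
    obtain ⟨w', hw', z, h⟩ := (accepts_iff (x := (v₀, Function.update (fun _ => []) kin
      (u.reverse.map e)))).1 h
    exact ⟨w'.length, hw'.length_le.trans hw, z, exec_of_rest_start P
      (rest_of_guessRun P kin e (o := some (start P)) h)⟩

end Compile

end StackMachine

/-! ### Inverting and building executions -/

namespace Prog

variable {α S : Type} {step : α → S → Option S}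

theorem exec_atom_iff {a : α} {n : ℕ} {x y : S} :
    (Prog.atom a).Exec step n x y ↔ n = 1 ∧ step a x = some y :=
  ⟨fun h => by cases h with | atom h => exact ⟨rfl, h⟩, fun ⟨hn, h⟩ => hn ▸ .atom h⟩

theorem exec_seq_iff {P Q : Prog α} {n : ℕ} {x z : S} :
    (Prog.seq P Q).Exec step n x z ↔
      ∃ m k y, n = m + k ∧ P.Exec step m x y ∧ Q.Exec step k y z :=
  ⟨fun h => by cases h with | seq h₁ h₂ => exact ⟨_, _, _, rfl, h₁, h₂⟩,
    fun ⟨_, _, _, hn, h₁, h₂⟩ => hn ▸ .seq h₁ h₂⟩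

theorem exec_alt_iff {P Q : Prog α} {n : ℕ} {x z : S} :
    (Prog.alt P Q).Exec step n x z ↔
      ∃ m, n = m + 1 ∧ (P.Exec step m x z ∨ Q.Exec step m x z) :=
  ⟨fun h => by
    cases h with
    | left h => exact ⟨_, rfl, .inl h⟩
    | right h => exact ⟨_, rfl, .inr h⟩,
   fun ⟨_, hn, h⟩ => hn ▸ h.elim .left .right⟩

theorem exec_star_iff {P : Prog α} {n : ℕ} {x z : S} :
    (Prog.star P).Exec step n x z ↔ (n = 1 ∧ x = z) ∨
      ∃ m k y, n = m + k + 1 ∧ P.Exec step m x y ∧ (Prog.star P).Exec step k y z :=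
  ⟨fun h => by
    cases h with
    | nil => exact .inl ⟨rfl, rfl⟩
    | cons h₁ h₂ => exact .inr ⟨_, _, _, rfl, h₁, h₂⟩,
   fun h => by
    rcases h with ⟨rfl, rfl⟩ | ⟨m, k, y, rfl, h₁, h₂⟩
    · exact .nil
    · exact .cons h₁ h₂⟩

/-- A predicate that is kept by `P` is kept by the iterations of `P`. -/
theorem star_induction {P : Prog α} {n : ℕ} {x z : S} (p : S → Prop) (hx : p x)
    (hP : ∀ m y y', p y → P.Exec step m y y' → p y') (h : (Prog.star P).Exec step n x z) : p z := by
  generalize hQ : Prog.star P = Q at h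
  induction h with
  | atom => cases hQ
  | seq => cases hQ
  | left => cases hQ
  | right => cases hQ
  | nil => exact hx
  | cons h₁ _ _ ih => cases hQ; exact ih (hP _ _ _ hx h₁) rfl

/-- Choice of a bit. -/
def anyBit (P : Bool → Prog α) : Prog α := .alt (P true) (P false)

theorem exec_anyBit_iff {P : Bool → Prog α} {n : ℕ} {x z : S} :
    (anyBit P).Exec step n x z ↔ ∃ m b, n = m + 1 ∧ (P b).Exec step m x z := by
  simp only [anyBit, exec_alt_iff, Bool.exists_bool, ← and_or_left]
  exact exists_congr fun m => and_congr_right fun _ => or_comm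

/-- Choice among a list of actions. -/
def anyOf (a₀ : α) : List α → Prog α
  | [] => .atom a₀
  | a :: l => .alt (.atom a) (anyOf a₀ l)

/-- The action `a₀` only closes the chain of alternatives; since it always fails, success comes from
the list. -/
theorem exists_of_exec_anyOf {a₀ : α} (h₀ : ∀ x, step a₀ x = none) {l : List α} {n : ℕ} {x z : S}
    (h : (anyOf a₀ l).Exec step n x z) : ∃ a ∈ l, step a x = some z := by
  induction l generalizing n with
  | nil =>
    obtain ⟨-, h⟩ := exec_atom_iff.1 h
    simp [h₀] at h
  | cons a l ih =>
    obtain ⟨m, -, h | h⟩ := exec_alt_iff.1 h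
    · exact ⟨a, by simp, (exec_atom_iff.1 h).2⟩
    · obtain ⟨a', ha', h⟩ := ih h
      exact ⟨a', by simp [ha'], h⟩

theorem exec_anyOf (a₀ : α) {l : List α} {a : α} (ha : a ∈ l) {x z : S} (h : step a x = some z) :
    ∃ n ≤ l.length + 1, (anyOf a₀ l).Exec step n x z := by
  induction l with
  | nil => simp at ha
  | cons a' l ih =>
    rcases List.mem_cons.1 ha with rfl | ha
    · exact ⟨2, by simp, .left (.atom h)⟩
    · obtain ⟨n, hn, h⟩ := ih ha
      exact ⟨n + 1, by simp; omega, .right h⟩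

/-- `FoldRel g r t t'`: processing the list `r`, with the effect `g b` of a symbol `b` on an
accumulator, may turn the accumulator `t` into `t'`. -/
def FoldRel {T : Type} (g : Bool → T → T → Prop) : List Bool → T → T → Prop
  | [], t, t' => t' = t
  | b :: r, t, t'' => ∃ t', g b t t' ∧ FoldRel g r t' t''

/-- For loops that copy: stacks grow at the head, hence the reversal. -/
theorem foldRel_push_iff {f : Bool → List Bool} {r t t' : List Bool} :
    FoldRel (fun b t t' => t' = (f b).reverse ++ t) r t t' ↔ t' = (r.flatMap f).reverse ++ t := by
  induction r generalizing t with
  | nil => simp [FoldRel]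
  | cons b r ih => simp [FoldRel, ih]

/-- For loops that compare the processed list with the top of a stack. -/
theorem foldRel_pop_iff {r t t' : List Bool} :
    FoldRel (fun b t t' => t = b :: t') r t t' ↔ t = r ++ t' := by
  induction r generalizing t with
  | nil => simp [FoldRel, eq_comm]
  | cons b r ih => simp [FoldRel, ih]

theorem foldRel_skip_iff {r : List Bool} {t t' : Unit} :
    FoldRel (fun _ _ _ => True) r t t' ↔ True := by
  induction r generalizing t with
  | nil => simp [FoldRel]
  | cons b r ih => simp [FoldRel, ih]

/-- A loop that processes the symbols of a list one by one, with an accumulator. -/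
theorem exec_drain_iff {T : Type} {B E : Prog α} {F : List Bool → T → S} {G : T → S}
    {g : Bool → T → T → Prop} {c : ℕ}
    (hB : ∀ r t n s, B.Exec step n (F r t) s ↔
      ∃ b r' t', r = b :: r' ∧ g b t t' ∧ s = F r' t' ∧ n = c)
    (hE : ∀ r t n s, E.Exec step n (F r t) s ↔ r = [] ∧ s = G t ∧ n = 1)
    (r : List Bool) (t : T) (n : ℕ) (s : S) :
    (Prog.seq (.star B) E).Exec step n (F r t) s ↔
      ∃ t', FoldRel g r t t' ∧ s = G t' ∧ n = (c + 1) * r.length + 2 := by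
  -- The body needs a nonempty list and the exit an empty one, so the number of iterations is
  -- forced. Each costs `c + 1`; leaving the loop and the exit cost 1 each.
  induction r generalizing n t with
  | nil =>
    rw [exec_seq_iff]
    constructor
    · rintro ⟨m, k, y, rfl, h₁, h₂⟩
      rcases exec_star_iff.1 h₁ with ⟨rfl, rfl⟩ | ⟨_, _, _, _, h, _⟩
      · obtain ⟨-, rfl, rfl⟩ := (hE _ _ _ _).1 h₂
        exact ⟨t, rfl, rfl, rfl⟩
      · obtain ⟨_, _, _, h, -⟩ := (hB _ _ _ _).1 h
        cases h
    · rintro ⟨t', rfl, rfl, rfl⟩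
      exact ⟨1, 1, _, rfl, .nil, (hE _ _ _ _).2 ⟨rfl, rfl, rfl⟩⟩
  | cons b r ih =>
    rw [exec_seq_iff]
    constructor
    · rintro ⟨m, k, y, rfl, h₁, h₂⟩
      rcases exec_star_iff.1 h₁ with ⟨rfl, rfl⟩ | ⟨m, k', y', rfl, h, h₃⟩
      · obtain ⟨h, -, -⟩ := (hE _ _ _ _).1 h₂
        cases h
      · obtain ⟨b', r', t', hbr, hg, rfl, rfl⟩ := (hB _ _ _ _).1 h
        cases hbr
        obtain ⟨t'', hf, rfl, h⟩ := (ih _ _).1 (.seq h₃ h₂)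
        refine ⟨t'', ⟨t', hg, hf⟩, rfl, ?_⟩
        simp only [List.length_cons, mul_add, mul_one]
        omega
    · rintro ⟨t'', ⟨t', hg, hf⟩, rfl, rfl⟩
      obtain ⟨m, k, y, hn, h₁, h₂⟩ := exec_seq_iff.1 ((ih t' _).2 ⟨t'', hf, rfl, rfl⟩)
      refine ⟨c + m + 1, k, y, ?_, .cons ((hB _ _ _ _).2 ⟨b, r, t', rfl, hg, rfl, rfl⟩) h₁, h₂⟩
      simp only [List.length_cons, mul_add, mul_one]
      omega

end Prog

/-! ### Hosting a family of machines -/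

namespace Host

open TM2 StackMachine Prog

variable {I : Type} (tm : I → FinTM2) (A : Type)

/-- A state of a host of the machines `tm i`, with auxiliary stacks of bits. -/
@[ext] structure State where
  /-- the configurations of the machines -/
  cfg : ∀ i, (tm i).Cfg
  /-- the auxiliary stacks -/
  aux : A → List Bool

/-- The stacks of a host. -/
abbrev Stack : Type := (Σ i, (tm i).K) ⊕ A

/-- The stack alphabets of a host. -/
abbrev alphabet : Stack tm A → Type
  | .inl p => (tm p.1).Γ p.2
  | .inr _ => Bool

/-- The internal states of a host: the labels and internal states of the machines, and a register. -/
abbrev Ctrl : Type := (∀ i, Option (tm i).Λ × (tm i).σ) × Bool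

/-- The statements by which a host acts on the configuration of a hosted machine. -/
abbrev LocalStmt (t : FinTM2) : Type := Stmt t.Γ Unit ((Option t.Λ × t.σ) × Bool)

/-- The atomic actions of a host. -/
inductive Action : Type
  | push (a : A) (w : List Bool)
  | pop (a : A) (b : Bool)
  | empty (a : A)
  | machine (i : I) (s : LocalStmt (tm i))

variable {tm A}

instance (t : FinTM2) : Fintype t.K := t.kFin

instance (t : FinTM2) : Fintype t.Λ := t.ΛFin

instance (t : FinTM2) : Fintype t.σ := t.σFin

/-- A configuration, from its parts. -/
def mkCfg {t : FinTM2} (l : Option t.Λ) (v : t.σ) (S : ∀ k, List (t.Γ k)) : t.Cfg := ⟨l, v, S⟩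

@[simp] theorem mkCfg_l {t : FinTM2} (l : Option t.Λ) (v : t.σ) (S : ∀ k, List (t.Γ k)) :
    (mkCfg l v S).l = l := rfl

@[simp] theorem mkCfg_var {t : FinTM2} (l : Option t.Λ) (v : t.σ) (S : ∀ k, List (t.Γ k)) :
    (mkCfg l v S).var = v := rfl

@[simp] theorem mkCfg_stk {t : FinTM2} (l : Option t.Λ) (v : t.σ) (S : ∀ k, List (t.Γ k)) :
    (mkCfg l v S).stk = S := rfl

/-- The effect of a statement on the configuration of a hosted machine. -/
def localStep {t : FinTM2} (s : LocalStmt t) (c : t.Cfg) : Option t.Cfg :=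
  let r := stepAux s ((c.l, c.var), false) c.stk
  r.l.map fun _ => mkCfg r.var.1.1 r.var.1.2 r.stk

/-- The effect of an action. -/
def Action.step [DecidableEq I] [DecidableEq A] : Action tm A → State tm A → Option (State tm A)
  | .push a w, s => some { s with aux := Function.update s.aux a (w.reverse ++ s.aux a) }
  | .pop a b, s =>
    if (s.aux a).head? = some b then
      some { s with aux := Function.update s.aux a (s.aux a).tail } else none
  | .empty a, s => if s.aux a = [] then some s else none
  | .machine i t, s =>
    (localStep t (s.cfg i)).map fun c => { s with cfg := Function.update s.cfg i c }

/-- The internal states of the machines in a family of configurations. -/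
def ctrl (cfg : ∀ i, (tm i).Cfg) : ∀ i, Option (tm i).Λ × (tm i).σ :=
  fun i => ((cfg i).l, (cfg i).var)

/-- The stackOf of a host. -/
def stackOf (cfg : ∀ i, (tm i).Cfg) (aux : A → List Bool) : ∀ k, List (alphabet tm A k)
  | .inl p => (cfg p.1).stk p.2
  | .inr a => aux a

/-- A state of a host, in terms of internal states and stackOf. -/
def encodeState (s : State tm A) : Ctrl tm × (∀ k, List (alphabet tm A k)) :=
  ((ctrl s.cfg, false), stackOf s.cfg s.aux)

/-- A statement on a hosted machine as a statement of the host. -/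
def hostStmt [DecidableEq I] (i : I) :
    LocalStmt (tm i) → Stmt (alphabet tm A) Unit (Ctrl tm)
  | .push k f q => .push (.inl ⟨i, k⟩) (fun v => f (v.1 i, v.2)) (hostStmt i q)
  | .peek k f q => .peek (.inl ⟨i, k⟩)
      (fun v o => (Function.update v.1 i (f (v.1 i, v.2) o).1, (f (v.1 i, v.2) o).2)) (hostStmt i q)
  | .pop k f q => .pop (.inl ⟨i, k⟩)
      (fun v o => (Function.update v.1 i (f (v.1 i, v.2) o).1, (f (v.1 i, v.2) o).2)) (hostStmt i q)
  | .load f q => .load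
      (fun v => (Function.update v.1 i (f (v.1 i, v.2)).1, (f (v.1 i, v.2)).2)) (hostStmt i q)
  | .branch f q₁ q₂ => .branch (fun v => f (v.1 i, v.2)) (hostStmt i q₁) (hostStmt i q₂)
  | .goto _ => .load (fun v => (v.1, false)) (.goto fun _ => ())
  | .halt => .halt

/-- The statement of an action. -/
def Action.toStmt [DecidableEq I] : Action tm A → Stmt (alphabet tm A) Unit (Ctrl tm)
  | .push a w => w.foldr (fun b q => .push (.inr a) (fun _ => b) q) (.goto fun _ => ())
  | .pop a b => .pop (.inr a) (fun v o => (v.1, decide (o = some b))) <|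
      .branch (fun v => v.2) (.load (fun v => (v.1, false)) (.goto fun _ => ())) .halt
  | .empty a => .peek (.inr a) (fun v o => (v.1, o.isNone)) <|
      .branch (fun v => v.2) (.load (fun v => (v.1, false)) (.goto fun _ => ())) .halt
  | .machine i s => hostStmt i s

variable [DecidableEq I] [DecidableEq A]

omit [DecidableEq I] in
theorem update_stackOf_inr [DecidableEq (Stack tm A)] (cfg : ∀ i, (tm i).Cfg) (aux : A → List Bool)
    (a : A) (w : List Bool) :
    Function.update (stackOf cfg aux) (.inr a) w = stackOf cfg (Function.update aux a w) := by
  funext k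
  rcases k with p | a'
  · exact Function.update_of_ne (by simp) _ _
  · by_cases h : a' = a
    · subst h
      refine (Function.update_self _ _ _).trans ?_
      simp [stackOf]
    · refine (Function.update_of_ne (by simpa using h) _ _).trans ?_
      simp [stackOf, Function.update_of_ne h]

omit [DecidableEq A] in
theorem update_stackOf_inl [DecidableEq (Stack tm A)] (cfg : ∀ i, (tm i).Cfg) (aux : A → List Bool)
    (i : I) (l : Option (tm i).Λ) (v : (tm i).σ) (S : ∀ k, List ((tm i).Γ k)) (k : (tm i).K)
    (w : List ((tm i).Γ k)) :
    Function.update (stackOf (Function.update cfg i (mkCfg l v S)) aux) (.inl ⟨i, k⟩) w =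
      stackOf (Function.update cfg i (mkCfg l v (Function.update S k w))) aux := by
  funext k'
  rcases k' with ⟨j, k'⟩ | a'
  · by_cases h : j = i
    · subst h
      by_cases hk : k' = k
      · subst hk
        refine (Function.update_self _ _ _).trans ?_
        simp [stackOf]
      · refine (Function.update_of_ne (by simpa using hk) _ _).trans ?_
        simp [stackOf, Function.update_of_ne hk]
    · refine (Function.update_of_ne (by simp [h]) _ _).trans ?_
      simp [stackOf, Function.update_of_ne h]
  · exact Function.update_of_ne (by simp) _ _

omit [DecidableEq A] in
theorem stackOf_inl (cfg : ∀ i, (tm i).Cfg) (aux : A → List Bool) (i : I) (c : (tm i).Cfg)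
    (k : (tm i).K) : stackOf (Function.update cfg i c) aux (.inl ⟨i, k⟩) = c.stk k := by
  simp [stackOf]

theorem update_ctrl (cfg : ∀ i, (tm i).Cfg) (i : I) (x y : Option (tm i).Λ × (tm i).σ)
    (S : ∀ k, List ((tm i).Γ k)) :
    Function.update (ctrl (Function.update cfg i (mkCfg x.1 x.2 S))) i y =
      ctrl (Function.update cfg i (mkCfg y.1 y.2 S)) := by
  funext j
  by_cases h : j = i
  · subst h; simp [ctrl]
  · simp [ctrl, Function.update_of_ne h]

theorem ctrl_self (cfg : ∀ i, (tm i).Cfg) (i : I) (x : Option (tm i).Λ × (tm i).σ)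
    (S : ∀ k, List ((tm i).Γ k)) : ctrl (Function.update cfg i (mkCfg x.1 x.2 S)) i = x := by
  simp [ctrl]

/-- Control does not see stacks. This and `stackOf_congr` let control and stacks, which a statement
changes separately, be read off one common configuration. -/
theorem ctrl_congr (cfg : ∀ i, (tm i).Cfg) (i : I) (x : Option (tm i).Λ × (tm i).σ)
    (S S' : ∀ k, List ((tm i).Γ k)) :
    ctrl (Function.update cfg i (mkCfg x.1 x.2 S)) =
      ctrl (Function.update cfg i (mkCfg x.1 x.2 S')) := by
  rw [← update_ctrl cfg i x x S', ← update_ctrl cfg i x x S]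
  funext j
  by_cases h : j = i
  · subst h; simp
  · simp [ctrl, Function.update_of_ne h]

omit [DecidableEq A] in
theorem stackOf_congr (cfg : ∀ i, (tm i).Cfg) (aux : A → List Bool) (i : I)
    (x y : Option (tm i).Λ × (tm i).σ) (S : ∀ k, List ((tm i).Γ k)) :
    stackOf (Function.update cfg i (mkCfg x.1 x.2 S)) aux =
      stackOf (Function.update cfg i (mkCfg y.1 y.2 S)) aux := by
  funext k'
  rcases k' with ⟨j, k'⟩ | a'
  · by_cases h : j = i
    · subst h; simp [stackOf]
    · simp [stackOf, Function.update_of_ne h]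
  · rfl

/-- The configuration of machine `i` is given in parts, since the induction passes through
intermediate states, stacks and register values. The final jump resets the register, as
`encodeState` requires. -/
theorem stmtStep_hostStmt (i : I) (t : LocalStmt (tm i)) (cfg : ∀ i, (tm i).Cfg)
    (aux : A → List Bool) (x : Option (tm i).Λ × (tm i).σ) (b : Bool)
    (S : ∀ k, List ((tm i).Γ k)) :
    stmtStep (hostStmt (A := A) i t)
        ((ctrl (Function.update cfg i (mkCfg x.1 x.2 S)), b),
          stackOf (Function.update cfg i (mkCfg x.1 x.2 S)) aux) =
      (stepAux t (x, b) S).l.map fun _ =>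
        encodeState ⟨Function.update cfg i
          (mkCfg (stepAux t (x, b) S).var.1.1 (stepAux t (x, b) S).var.1.2
            (stepAux t (x, b) S).stk), aux⟩ := by
  induction t generalizing x b S with
  | push k f q ih =>
    rw [stepAux, ← ih]
    simp only [stmtStep, hostStmt, stepAux]
    rw [update_stackOf_inl, ctrl_self, stackOf_inl, mkCfg_stk,
      ctrl_congr cfg i x S (Function.update S k (f (x, b) :: S k))]
  | peek k f q ih =>
    rw [stepAux, ← ih]
    simp only [stmtStep, hostStmt, stepAux]
    rw [update_ctrl, ctrl_self, stackOf_inl, mkCfg_stk,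
      stackOf_congr cfg aux i x (f (x, b) (S k).head?).1 S]
  | pop k f q ih =>
    rw [stepAux, ← ih]
    simp only [stmtStep, hostStmt, stepAux]
    rw [update_stackOf_inl, update_ctrl, ctrl_self, stackOf_inl, mkCfg_stk,
      ctrl_congr cfg i (f (x, b) (S k).head?).1 S (Function.update S k (S k).tail),
      stackOf_congr cfg aux i x (f (x, b) (S k).head?).1 (Function.update S k (S k).tail)]
  | load f q ih =>
    rw [stepAux, ← ih]
    simp only [stmtStep, hostStmt, stepAux]
    rw [update_ctrl, ctrl_self, stackOf_congr cfg aux i x (f (x, b)).1 S]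
  | branch f q₁ q₂ ih₁ ih₂ =>
    simp only [stmtStep, hostStmt, stepAux, ctrl_self] at *
    cases f (x, b)
    · exact ih₂ _ _ _
    · exact ih₁ _ _ _
  | goto f => rfl
  | halt => rfl

/-- This is the simulation hypothesis of `exec_map_iff`; through it programs can be analysed on host
states instead of raw stacks. -/
theorem stmtStep_toStmt (a : Action tm A) (s : State tm A) :
    stmtStep a.toStmt (encodeState s) = (a.step s).map encodeState := by
  cases a with
  | push a w =>
    obtain ⟨cfg, aux⟩ := s
    simp only [Action.toStmt, Action.step, Option.map_some]
    induction w generalizing aux with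
    | nil => simp [stmtStep, stepAux]
    | cons b w ih =>
      have := ih (Function.update aux a (b :: aux a))
      simp only [Function.update_self, Function.update_idem] at this
      simp only [List.reverse_cons, List.append_assoc, List.singleton_append]
      rw [← this]
      simp only [stmtStep, List.foldr_cons, stepAux, encodeState]
      rw [update_stackOf_inr]
      rfl
  | pop a b =>
    obtain ⟨cfg, aux⟩ := s
    simp only [Action.toStmt, Action.step, stmtStep, stepAux, encodeState]
    rw [update_stackOf_inr]
    have h : (stackOf cfg aux (Sum.inr a)) = aux a := rfl
    rw [h]
    split_ifs with h1 <;> simp [h1, encodeState]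
  | empty a =>
    obtain ⟨cfg, aux⟩ := s
    simp only [Action.toStmt, Action.step, stmtStep, stepAux, encodeState]
    have h : (stackOf cfg aux (Sum.inr a)) = aux a := rfl
    rw [h]
    by_cases h1 : aux a = []
    · simp [h1, encodeState]
    · have : (aux a).head?.isNone = false := by simpa using h1
      simp [this, h1]
  | machine i t =>
    obtain ⟨cfg, aux⟩ := s
    have := stmtStep_hostStmt (A := A) i t cfg aux ((cfg i).l, (cfg i).var) false (cfg i).stk
    have h : Function.update cfg i (mkCfg (cfg i).l (cfg i).var (cfg i).stk) = cfg :=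
      Function.update_eq_self i cfg
    simp only [h] at this
    simp only [Action.toStmt, encodeState, this, Action.step, localStep, Option.map_map]
    rfl

/-- The configuration of a machine that is not in use. -/
def idleCfg (t : FinTM2) : t.Cfg := mkCfg none t.initialState fun _ => []

variable (tm) in
/-- The state in which no machine is in use. -/
abbrev idle (aux : A → List Bool) : State tm A := ⟨fun i => idleCfg (tm i), aux⟩

/-- A host of finitely many machines is itself a finite stack machine, so NP membership carries over
along `encodeState`. -/
theorem setOf_exec_mem_classNP [Fintype I] [Fintype A] (P : Prog (Action tm A)) (a : A)
    (q : Polynomial ℕ) :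
    {u : List Bool | ∃ n ≤ q.eval u.length, ∃ s,
      P.Exec Action.step n (idle tm (Function.update (fun _ => []) a u.reverse)) s} ∈ classNP := by
  have h := StackMachine.setOf_exec_mem_classNP (Γ := alphabet tm A) (P.map Action.toStmt) (.inr a)
    id (encodeState (idle tm fun _ => [] : State tm A)).1 q
  have hinit : ∀ u : List Bool, ((encodeState (idle tm fun _ => [] : State tm A)).1,
      Function.update (fun _ => [] : ∀ k, List (alphabet tm A k)) (Sum.inr a)
        (u.reverse.map id)) =
        encodeState (idle tm (Function.update (fun _ => []) a u.reverse) : State tm A) := by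
    intro u
    refine Prod.ext rfl ?_
    have := update_stackOf_inr (idle tm fun _ => [] : State tm A).cfg (fun _ => []) a u.reverse
    rw [List.map_id]
    simp only [encodeState] at this ⊢
    rw [← this]
    congr 1
    funext k
    rcases k with k | k <;> rfl
  simp only [hinit, exec_map_iff stmtStep_toStmt] at h
  convert h using 7 with u n
  constructor
  · rintro ⟨s, hs⟩
    exact ⟨_, s, rfl, hs⟩
  · rintro ⟨_, s, -, hs⟩
    exact ⟨s, hs⟩

end Host

/-! ### Elementary host programs and their exact effects -/

namespace Host

open TM2 StackMachine Prog

section LocalStmt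

variable {t : FinTM2}

/-- Push a symbol. -/
def pushSym (k : t.K) (γ : t.Γ k) : LocalStmt t := .push k (fun _ => γ) (.goto fun _ => ())

open Classical in
/-- Pop a given symbol. -/
noncomputable def popSym (k : t.K) (γ : t.Γ k) : LocalStmt t :=
  .pop k (fun v o => (v.1, decide (o = some γ))) (.branch (fun v => v.2) (.goto fun _ => ()) .halt)

/-- Test whether a stack is empty. -/
def emptySym (k : t.K) : LocalStmt t :=
  .peek k (fun v o => (v.1, o.isNone)) (.branch (fun v => v.2) (.goto fun _ => ()) .halt)

/-- Set the label. -/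
def setLabel (l : Option t.Λ) : LocalStmt t :=
  .load (fun v => ((l, v.1.2), v.2)) (.goto fun _ => ())

open Classical in
/-- Test the label. -/
noncomputable def testLabel (l : Option t.Λ) : LocalStmt t :=
  .branch (fun v => decide (v.1.1 = l)) (.goto fun _ => ()) .halt

/-- A statement of a machine, with the label as a part of the internal state. -/
def internalize : Stmt t.Γ t.Λ t.σ → LocalStmt t
  | .push k f q => .push k (fun v => f v.1.2) (internalize q)
  | .peek k f q => .peek k (fun v o => ((v.1.1, f v.1.2 o), v.2)) (internalize q)
  | .pop k f q => .pop k (fun v o => ((v.1.1, f v.1.2 o), v.2)) (internalize q)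
  | .load f q => .load (fun v => ((v.1.1, f v.1.2), v.2)) (internalize q)
  | .branch f q₁ q₂ => .branch (fun v => f v.1.2) (internalize q₁) (internalize q₂)
  | .goto f => .load (fun v => ((some (f v.1.2), v.1.2), v.2)) (.goto fun _ => ())
  | .halt => .load (fun v => ((none, v.1.2), v.2)) (.goto fun _ => ())

open Classical in
/-- Carry out a step of a machine, if its label is `l`. -/
noncomputable def stepLabel (l : t.Λ) : LocalStmt t :=
  .branch (fun v => decide (v.1.1 = some l)) (internalize (t.m l)) .halt

theorem localStep_pushSym (k : t.K) (γ : t.Γ k) (c : t.Cfg) :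
    localStep (pushSym k γ) c =
      some (mkCfg c.l c.var (Function.update c.stk k (γ :: c.stk k))) := by
  simp [localStep, pushSym, stepAux]

theorem localStep_popSym (k : t.K) (γ : t.Γ k) (c c' : t.Cfg) :
    localStep (popSym k γ) c = some c' ↔
      ∃ w, c.stk k = γ :: w ∧ c' = mkCfg c.l c.var (Function.update c.stk k w) := by
  rcases hc : c.stk k with _ | ⟨γ', w⟩
  · simp [localStep, popSym, stepAux, hc]
  · by_cases h : γ' = γ
    · simp [localStep, popSym, stepAux, hc, h, eq_comm]
    · simp [localStep, popSym, stepAux, hc, h]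

theorem localStep_emptySym (k : t.K) (c c' : t.Cfg) :
    localStep (emptySym k) c = some c' ↔ c.stk k = [] ∧ c' = c := by
  rcases hc : c.stk k with _ | ⟨γ', w⟩
  · simp [localStep, emptySym, stepAux, hc, eq_comm]
    exact eq_comm
  · simp [localStep, emptySym, stepAux, hc]

theorem localStep_setLabel (l : Option t.Λ) (c : t.Cfg) :
    localStep (setLabel l) c = some (mkCfg l c.var c.stk) := rfl

theorem localStep_testLabel (l : Option t.Λ) (c c' : t.Cfg) :
    localStep (testLabel l) c = some c' ↔ c.l = l ∧ c' = c := by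
  by_cases h : c.l = l
  · simp [localStep, testLabel, stepAux, h, eq_comm]
    subst h
    exact eq_comm
  · simp [localStep, testLabel, stepAux, h]

/-- Jumps and halting of the hosted machine become changes of the recorded label, so the host always
continues. -/
theorem stepAux_internalize (q : Stmt t.Γ t.Λ t.σ) (l : Option t.Λ) (v : t.σ) (b : Bool)
    (S : ∀ k, List (t.Γ k)) :
    stepAux (internalize q) ((l, v), b) S =
      ⟨some (), (((stepAux q v S).l, (stepAux q v S).var), b), (stepAux q v S).stk⟩ := by
  induction q generalizing v S with
  | branch f q₁ q₂ ih₁ ih₂ =>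
    simp only [internalize, stepAux]
    cases f v
    · exact ih₂ _ _
    · exact ih₁ _ _
  | push k f q ih => exact ih _ _
  | peek k f q ih => exact ih _ _
  | pop k f q ih => exact ih _ _
  | load f q ih => exact ih _ _
  | goto f => rfl
  | halt => rfl

theorem localStep_stepLabel (l : t.Λ) (c c' : t.Cfg) :
    localStep (stepLabel l) c = some c' ↔ c.l = some l ∧ t.step c = some c' := by
  rcases c with ⟨l', v, S⟩
  by_cases h : l' = some l
  · subst h
    simp only [localStep, stepLabel, stepAux, decide_true, cond_true, stepAux_internalize,
      FinTM2.step, step, true_and, Option.map_some]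
    exact Iff.rfl
  · simp [localStep, stepLabel, stepAux, h]

end LocalStmt

variable {I A : Type} [DecidableEq I] [DecidableEq A] {tm : I → FinTM2}

section Atoms

variable {cfg : ∀ i, (tm i).Cfg} {aux : A → List Bool} {n : ℕ} {s : State tm A}

theorem exec_push_iff {a : A} {w : List Bool} :
    (Prog.atom (Action.push a w)).Exec Action.step n ⟨cfg, aux⟩ s ↔
      n = 1 ∧ s = ⟨cfg, Function.update aux a (w.reverse ++ aux a)⟩ := by
  simp [exec_atom_iff, Action.step, eq_comm]

theorem exec_pop_iff {a : A} {b : Bool} :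
    (Prog.atom (Action.pop a b)).Exec Action.step n ⟨cfg, aux⟩ s ↔
      n = 1 ∧ ∃ r, aux a = b :: r ∧ s = ⟨cfg, Function.update aux a r⟩ := by
  rcases h : aux a with _ | ⟨b', r⟩
  · simp [exec_atom_iff, Action.step, h]
  · by_cases hb : b' = b
    · simp [exec_atom_iff, Action.step, h, hb, eq_comm]
    · simp [exec_atom_iff, Action.step, h, hb]

theorem exec_empty_iff {a : A} :
    (Prog.atom (Action.empty a)).Exec Action.step n ⟨cfg, aux⟩ s ↔
      n = 1 ∧ aux a = [] ∧ s = ⟨cfg, aux⟩ := by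
  by_cases h : aux a = []
  · simp [exec_atom_iff, Action.step, h, eq_comm]
  · simp [exec_atom_iff, Action.step, h]

theorem exec_machine_iff {i : I} {t : LocalStmt (tm i)} {c : (tm i).Cfg} :
    (Prog.atom (Action.machine i t)).Exec Action.step n ⟨Function.update cfg i c, aux⟩ s ↔
      n = 1 ∧ ∃ c', localStep t c = some c' ∧ s = ⟨Function.update cfg i c', aux⟩ := by
  simp [exec_atom_iff, Action.step, eq_comm]

end Atoms

/-- Move the content of a stack to another stack, in reversed order. -/
def moveAux (a b : A) : Prog (Action tm A) :=
  .seq (.star (anyBit fun c => .seq (.atom (.pop a c)) (.atom (.push b [c])))) (.atom (.empty a))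

theorem exec_moveAux_iff {a b : A} (hab : a ≠ b) {cfg : ∀ i, (tm i).Cfg} {aux : A → List Bool}
    {n : ℕ} {s : State tm A} :
    (moveAux a b).Exec Action.step n ⟨cfg, aux⟩ s ↔
      s = ⟨cfg, Function.update (Function.update aux a []) b ((aux a).reverse ++ aux b)⟩ ∧
        n = 4 * (aux a).length + 2 := by
  -- Cost 3 is the choice of a bit, the pop and the push. The pop succeeds only for the right bit,
  -- so the choice is no real freedom.
  have key := exec_drain_iff (step := Action.step)
    (B := anyBit fun c => .seq (.atom (.pop a c)) (.atom (.push b [c]))) (E := .atom (.empty a))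
    (F := fun r t => (⟨cfg, Function.update (Function.update aux a r) b t⟩ : State tm A))
    (G := fun t => (⟨cfg, Function.update (Function.update aux a []) b t⟩ : State tm A))
    (g := fun c t t' => t' = [c].reverse ++ t) (c := 3) (by
      intro r t n s
      simp only [exec_anyBit_iff, exec_seq_iff, exec_pop_iff,
        Function.update_of_ne hab, Function.update_self]
      constructor
      · rintro ⟨_, c, rfl, _, _, y, rfl, ⟨rfl, r', rfl, rfl⟩, h⟩
        obtain ⟨rfl, rfl⟩ := exec_push_iff.1 h
        refine ⟨c, r', _, rfl, rfl, ?_, rfl⟩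
        congr 1
        funext d
        by_cases h1 : d = b <;> by_cases h2 : d = a <;> simp_all [Function.update_apply]
      · rintro ⟨c, r', _, rfl, rfl, rfl, rfl⟩
        refine ⟨2, c, rfl, 1, 1, _, rfl, ⟨rfl, r', rfl, rfl⟩, exec_push_iff.2 ⟨rfl, ?_⟩⟩
        congr 1
        funext d
        by_cases h1 : d = b <;> by_cases h2 : d = a <;> simp_all [Function.update_apply]) (by
      intro r t n s
      simp only [exec_empty_iff, Function.update_of_ne hab, Function.update_self]
      constructor
      · rintro ⟨rfl, rfl, rfl⟩; exact ⟨rfl, rfl, rfl⟩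
      · rintro ⟨rfl, rfl, rfl⟩; exact ⟨rfl, rfl, rfl⟩)
    (aux a) (aux b) n s
  simp only [Function.update_eq_self] at key
  rw [moveAux, key]
  simp only [foldRel_push_iff, exists_eq_left, List.flatMap_singleton']

section Machine

variable (i : I)

/-- Move the content of an auxiliary stack to a stack of a machine, in reversed order. -/
def load (a : A) (k : (tm i).K) (e : (tm i).Γ k ≃ Bool) : Prog (Action tm A) :=
  .seq (.star (anyBit fun c => .seq (.atom (.pop a c)) (.atom (.machine i (pushSym k (e.symm c))))))
    (.atom (.empty a))

/-- Move the content of a stack of a machine to an auxiliary stack, in reversed order, with each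
symbol replaced by a string. -/
noncomputable def unload (k : (tm i).K) (e : (tm i).Γ k ≃ Bool) (a : A) (f : Bool → List Bool) :
    Prog (Action tm A) :=
  .seq (.star (anyBit fun c => .seq (.atom (.machine i (popSym k (e.symm c))))
    (.atom (.push a (f c))))) (.atom (.machine i (emptySym k)))

variable {i} {cfg : ∀ i, (tm i).Cfg} {aux : A → List Bool} {n : ℕ} {s : State tm A}

theorem exec_load_iff {a : A} {k : (tm i).K} {e : (tm i).Γ k ≃ Bool} {l : Option (tm i).Λ}
    {v : (tm i).σ} {S : ∀ k, List ((tm i).Γ k)} (hS : S k = []) :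
    (load i a k e).Exec Action.step n ⟨Function.update cfg i (mkCfg l v S), aux⟩ s ↔
      s = ⟨Function.update cfg i
          (mkCfg l v (Function.update S k ((aux a).reverse.map e.symm))),
          Function.update aux a []⟩ ∧
        n = 4 * (aux a).length + 2 := by
  have key := exec_drain_iff (step := Action.step)
    (B := anyBit fun c => .seq (.atom (.pop a c))
      (.atom (.machine i (pushSym k (e.symm c))))) (E := .atom (.empty a))
    (F := fun r t => (⟨Function.update cfg i (mkCfg l v (Function.update S k (t.map e.symm))),
      Function.update aux a r⟩ : State tm A))
    (G := fun t => (⟨Function.update cfg i (mkCfg l v (Function.update S k (t.map e.symm))),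
      Function.update aux a []⟩ : State tm A))
    (g := fun c t t' => t' = [c].reverse ++ t) (c := 3) (by
      intro r t n s
      simp only [exec_anyBit_iff, exec_seq_iff, exec_pop_iff, Function.update_self,
        Function.update_idem]
      constructor
      · rintro ⟨_, c, rfl, _, _, y, rfl, ⟨rfl, r', rfl, rfl⟩, h⟩
        obtain ⟨rfl, c', hc', rfl⟩ := exec_machine_iff.1 h
        rw [localStep_pushSym] at hc'
        cases hc'
        exact ⟨c, r', _, rfl, rfl, by simp, rfl⟩
      · rintro ⟨c, r', _, rfl, rfl, rfl, rfl⟩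
        exact ⟨2, c, rfl, 1, 1, _, rfl, ⟨rfl, r', rfl, rfl⟩,
          exec_machine_iff.2 ⟨rfl, _, localStep_pushSym _ _ _, by simp⟩⟩) (by
      intro r t n s
      simp only [exec_empty_iff, Function.update_self]
      constructor
      · rintro ⟨rfl, rfl, rfl⟩; exact ⟨rfl, rfl, rfl⟩
      · rintro ⟨rfl, rfl, rfl⟩; exact ⟨rfl, rfl, rfl⟩)
    (aux a) [] n s
  have hS' : Function.update S k (List.map e.symm []) = S := by
    rw [List.map_nil, ← hS, Function.update_eq_self]
  simp only [Function.update_eq_self, hS'] at key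
  rw [load, key]
  simp only [foldRel_push_iff, exists_eq_left, List.flatMap_singleton', List.append_nil]

theorem exec_unload_iff {a : A} {k : (tm i).K} {e : (tm i).Γ k ≃ Bool} {f : Bool → List Bool}
    {l : Option (tm i).Λ} {v : (tm i).σ} {S : ∀ k, List ((tm i).Γ k)} {w : List Bool}
    (hS : S k = w.map e.symm) :
    (unload i k e a f).Exec Action.step n ⟨Function.update cfg i (mkCfg l v S), aux⟩ s ↔
      s = ⟨Function.update cfg i (mkCfg l v (Function.update S k [])),
          Function.update aux a ((w.flatMap f).reverse ++ aux a)⟩ ∧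
        n = 4 * w.length + 2 := by
  have key := exec_drain_iff (step := Action.step)
    (B := anyBit fun c => .seq (.atom (.machine i (popSym k (e.symm c))))
      (.atom (.push a (f c)))) (E := .atom (.machine i (emptySym k)))
    (F := fun r t => (⟨Function.update cfg i (mkCfg l v (Function.update S k (r.map e.symm))),
      Function.update aux a t⟩ : State tm A))
    (G := fun t => (⟨Function.update cfg i (mkCfg l v (Function.update S k [])),
      Function.update aux a t⟩ : State tm A))
    (g := fun c t t' => t' = (f c).reverse ++ t) (c := 3) (by
      intro r t n s
      simp only [exec_anyBit_iff, exec_seq_iff, exec_machine_iff, localStep_popSym, mkCfg_stk,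
        Function.update_self, mkCfg_l, mkCfg_var, Function.update_idem]
      constructor
      · rintro ⟨_, c, rfl, _, _, y, rfl, ⟨rfl, _, ⟨r', hr, rfl⟩, rfl⟩, h⟩
        obtain ⟨rfl, rfl⟩ := exec_push_iff.1 h
        rcases r with _ | ⟨c', r⟩
        · cases hr
        · simp only [List.map_cons, List.cons.injEq, EmbeddingLike.apply_eq_iff_eq] at hr
          obtain ⟨rfl, rfl⟩ := hr
          exact ⟨c', r, _, rfl, rfl, by simp, rfl⟩
      · rintro ⟨c, r', _, rfl, rfl, rfl, rfl⟩
        exact ⟨2, c, rfl, 1, 1, _, rfl, ⟨rfl, _, ⟨_, rfl, rfl⟩, rfl⟩,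
          exec_push_iff.2 ⟨rfl, by simp⟩⟩) (by
      intro r t n s
      simp only [exec_machine_iff, localStep_emptySym, mkCfg_stk, Function.update_self,
        List.map_eq_nil_iff]
      constructor
      · rintro ⟨rfl, _, ⟨rfl, rfl⟩, rfl⟩; exact ⟨rfl, rfl, rfl⟩
      · rintro ⟨rfl, rfl, rfl⟩; exact ⟨rfl, _, ⟨rfl, rfl⟩, rfl⟩)
    w (aux a) n s
  simp only [← hS, Function.update_eq_self] at key
  rw [unload, key]
  simp only [foldRel_push_iff, exists_eq_left]

variable (i) in
open Classical in
/-- Carry out a step of a machine, at one of the labels in a given set. -/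
noncomputable def machineStep (p : Set (tm i).Λ) : Prog (Action tm A) :=
  anyOf (.machine i .halt)
    ((Finset.univ.filter (· ∈ p)).toList.map fun l => .machine i (stepLabel l))

/-- The label is guessed but also tested by `stepLabel`; the closing alternative `.halt` always
fails. -/
theorem of_exec_machineStep {p : Set (tm i).Λ} {c : (tm i).Cfg}
    (h : (machineStep i p).Exec Action.step n ⟨Function.update cfg i c, aux⟩ s) :
    ∃ c', (∃ l ∈ p, c.l = some l) ∧ (tm i).step c = some c' ∧
      s = ⟨Function.update cfg i c', aux⟩ := by
  obtain ⟨a, ha, h⟩ := exists_of_exec_anyOf (fun x => rfl) h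
  simp only [List.mem_map, Finset.mem_toList, Finset.mem_filter, Finset.mem_univ, true_and] at ha
  obtain ⟨l, hl, rfl⟩ := ha
  obtain ⟨-, c', hc', rfl⟩ := exec_machine_iff.1 (exec_atom_iff.2 ⟨rfl, h⟩)
  obtain ⟨h1, h2⟩ := (localStep_stepLabel _ _ _).1 hc'
  exact ⟨c', ⟨l, hl, h1⟩, h2, rfl⟩

/-- Reaching the alternative of the current label costs up to the number of labels, a constant of
the machine. -/
theorem exec_machineStep {p : Set (tm i).Λ} {c c' : (tm i).Cfg} {l : (tm i).Λ} (hl : l ∈ p)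
    (hc : c.l = some l) (h : (tm i).step c = some c') :
    ∃ n ≤ Fintype.card (tm i).Λ + 1, (machineStep i p).Exec Action.step n
      ⟨Function.update cfg i c, aux⟩ ⟨Function.update cfg i c', aux⟩ := by
  classical
  obtain ⟨n, hn, h⟩ := exec_anyOf (step := Action.step (tm := tm) (A := A)) (.machine i .halt)
    (l := (Finset.univ.filter (· ∈ p)).toList.map fun l => .machine i (stepLabel l))
    (a := .machine i (stepLabel l)) (x := ⟨Function.update cfg i c, aux⟩)
    (z := ⟨Function.update cfg i c', aux⟩)
    (List.mem_map.2 ⟨l, by simp [hl], rfl⟩)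
    (exec_atom_iff.1 (exec_machine_iff.2 ⟨rfl, c', (localStep_stepLabel _ _ _).2 ⟨hc, h⟩, rfl⟩)).2
  refine ⟨n, hn.trans ?_, h⟩
  rw [List.length_map, Finset.length_toList]
  exact Nat.add_le_add_right (Finset.card_le_univ _) 1

end Machine

/-- Read a self-delimiting string, and process its symbols. -/
def readDelim (a : A) (act : Bool → Action tm A) : Prog (Action tm A) :=
  .seq (.star (.seq (.atom (.pop a true)) (anyBit fun c => .seq (.atom (.pop a c)) (.atom (act c)))))
    (.atom (.pop a false))

/-- The state is abstracted to a tape and an accumulator, so that one lemma serves copying, skipping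
and matching. A symbol costs 5: the marker, the choice, the pop, the action and the loop. -/
theorem exec_readDelim_iff {T : Type} {a : A} {act : Bool → Action tm A}
    {G : List Bool → T → State tm A} {g : Bool → T → T → Prop}
    (hpop : ∀ b r t n s, (Prog.atom (.pop a b)).Exec Action.step n (G r t) s ↔
      n = 1 ∧ ∃ r', r = b :: r' ∧ s = G r' t)
    (hact : ∀ b r t n s, (Prog.atom (act b)).Exec Action.step n (G r t) s ↔
      n = 1 ∧ ∃ t', g b t t' ∧ s = G r t')
    {x r : List Bool} {t : T} {n : ℕ} {s : State tm A} :
    (readDelim a act).Exec Action.step n (G (pair x r) t) s ↔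
      ∃ t', FoldRel g x t t' ∧ s = G r t' ∧ n = 5 * x.length + 2 := by
  have hnil : pair [] r = false :: r := rfl
  have hcons : ∀ b x, pair (b :: x) r = true :: b :: pair x r := fun b x => by
    simp [pair, selfDelim]
  refine exec_drain_iff (step := Action.step) (F := fun x t => G (pair x r) t) (G := fun t => G r t)
    (c := 4) ?_ ?_ x t n s
  · intro x t n s
    simp only [exec_seq_iff, exec_anyBit_iff, hpop]
    constructor
    · rintro ⟨_, _, _, rfl, ⟨rfl, r', hr', rfl⟩, _, c, rfl, _, _, _, rfl, h, h'⟩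
      obtain ⟨rfl, r'', rfl, rfl⟩ := (hpop _ _ _ _ _).1 h
      obtain ⟨rfl, t', ht', rfl⟩ := (hact _ _ _ _ _).1 h'
      rcases x with _ | ⟨b, x⟩
      · rw [hnil] at hr'; cases hr'
      · rw [hcons] at hr'; cases hr'
        exact ⟨c, x, t', rfl, ht', rfl, rfl⟩
    · rintro ⟨b, x, t', rfl, ht', rfl, rfl⟩
      exact ⟨1, 3, _, rfl, ⟨rfl, _, hcons _ _, rfl⟩, 2, b, rfl, 1, 1, _, rfl,
        (hpop _ _ _ _ _).2 ⟨rfl, _, rfl, rfl⟩, (hact _ _ _ _ _).2 ⟨rfl, t', ht', rfl⟩⟩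
  · intro x t n s
    simp only [hpop]
    rcases x with _ | ⟨b, x⟩
    · rw [hnil]
      constructor
      · rintro ⟨rfl, r', hr, rfl⟩
        cases hr
        exact ⟨rfl, rfl, rfl⟩
      · rintro ⟨-, rfl, rfl⟩
        exact ⟨rfl, r, rfl, rfl⟩
    · rw [hcons]
      constructor
      · rintro ⟨rfl, r', hr, rfl⟩
        cases hr
      · rintro ⟨h, -, -⟩
        cases h

end Host

theorem ReachesIn.snoc {α : Type*} {r : α → α → Prop} {n : ℕ} {a b c : α} (h : ReachesIn r n a b)
    (h' : r b c) : ReachesIn r (n + 1) a c := h.trans (.head h' (.refl _))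

/-! ### Calling a hosted machine as a subroutine -/

namespace Host

open TM2 StackMachine Prog

theorem initList_eq (t : FinTM2) (w : List (t.Γ t.k₀)) :
    initList t w = mkCfg (some t.main) t.initialState (Function.update (fun _ => []) t.k₀ w) := by
  unfold initList mkCfg
  congr 1
  funext k
  by_cases h : k = t.k₀
  · subst h; simp
  · simp [h]

theorem haltList_eq (t : FinTM2) (w : List (t.Γ t.k₁)) :
    haltList t w = mkCfg none t.initialState (Function.update (fun _ => []) t.k₁ w) := by
  unfold haltList mkCfg
  congr 1
  funext k
  by_cases h : k = t.k₁
  · subst h; simp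
  · simp [h]

theorem exists_label_of_step {t : FinTM2} {c c' : t.Cfg} (h : t.step c = some c') :
    ∃ l, c.l = some l := by
  rcases c with ⟨_ | l, v, S⟩
  · simp at h
  · exact ⟨l, rfl⟩

theorem step_eq_none {t : FinTM2} {c : t.Cfg} (h : c.l = none) : t.step c = none := by
  rcases c with ⟨_ | l, v, S⟩
  · rfl
  · cases h

variable {I A : Type} [DecidableEq I] [DecidableEq A] {tm : I → FinTM2} {i : I}
  {cfg : ∀ i, (tm i).Cfg} {aux : A → List Bool} {n : ℕ} {s : State tm A}

/-- The loop may be left at any moment; only a subsequent label test forces it to run to the end. -/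
theorem of_exec_star_machineStep {c : (tm i).Cfg}
    (h : (Prog.star (machineStep i Set.univ)).Exec Action.step n
      ⟨Function.update cfg i c, aux⟩ s) :
    ∃ m c', ReachesIn (fun x y => (tm i).step x = some y) m c c' ∧
      s = ⟨Function.update cfg i c', aux⟩ := by
  refine star_induction (fun s => ∃ m c', ReachesIn (fun x y => (tm i).step x = some y) m c c' ∧
      s = ⟨Function.update cfg i c', aux⟩) ⟨0, c, .refl _, rfl⟩ ?_ h
  rintro k _ y' ⟨m, c', hm, rfl⟩ hk
  obtain ⟨c'', -, hc'', rfl⟩ := of_exec_machineStep hk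
  exact ⟨m + 1, c'', hm.snoc hc'', rfl⟩

theorem exec_star_machineStep {c c' : (tm i).Cfg} {m : ℕ}
    (h : ReachesIn (fun x y => (tm i).step x = some y) m c c') :
    ∃ n ≤ m * (Fintype.card (tm i).Λ + 2) + 1, (Prog.star (machineStep i Set.univ)).Exec Action.step n
      ⟨Function.update cfg i c, aux⟩ ⟨Function.update cfg i c', aux⟩ := by
  induction h with
  | refl c => exact ⟨1, by omega, .nil⟩
  | head h _ ih =>
    obtain ⟨n, hn, h₂⟩ := ih
    obtain ⟨l, hl⟩ := exists_label_of_step h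
    obtain ⟨k, hk, h₁⟩ := exec_machineStep (cfg := cfg) (aux := aux) (Set.mem_univ l) hl h
    refine ⟨k + n + 1, ?_, .cons h₁ h₂⟩
    rw [add_mul]
    omega

variable (i) in
/-- Run a machine on the (reversed) content of a stack, and append its output, with each symbol
replaced by a string, (reversed) to another stack. -/
noncomputable def callFun (e₀ : (tm i).Γ (tm i).k₀ ≃ Bool) (e₁ : (tm i).Γ (tm i).k₁ ≃ Bool)
    (a b : A) (f : Bool → List Bool) : Prog (Action tm A) :=
  .seq (load i a (tm i).k₀ e₀) <|
  .seq (.atom (.machine i (setLabel (some (tm i).main)))) <|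
  .seq (.star (machineStep i Set.univ)) <|
  .seq (.atom (.machine i (testLabel none))) (unload i (tm i).k₁ e₁ b f)

theorem eq_of_exec_load_input {e₀ : (tm i).Γ (tm i).k₀ ≃ Bool} {a : A} {w : List Bool}
    (hw : aux a = w.reverse) (hidle : cfg i = idleCfg (tm i)) :
    (Prog.seq (load i a (tm i).k₀ e₀)
      (.atom (.machine i (setLabel (some (tm i).main))))).Exec Action.step n ⟨cfg, aux⟩ s ↔
      s = ⟨Function.update cfg i (initList (tm i) (w.map e₀.symm)), Function.update aux a []⟩ ∧
        n = 4 * w.length + 3 := by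
  have hcfg : cfg = Function.update cfg i (mkCfg none (tm i).initialState fun _ => []) := by
    rw [show (mkCfg none (tm i).initialState fun _ => []) = cfg i from hidle.symm,
      Function.update_eq_self]
  rw [exec_seq_iff]
  conv_lhs => rw [hcfg]
  simp only [exec_load_iff, hw, List.length_reverse, List.reverse_reverse]
  constructor
  · rintro ⟨_, _, _, rfl, ⟨rfl, rfl⟩, h⟩
    obtain ⟨rfl, c', hc', rfl⟩ := exec_machine_iff.1 h
    rw [localStep_setLabel] at hc'
    cases hc'
    refine ⟨?_, rfl⟩
    rw [initList_eq]
    rfl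
  · rintro ⟨rfl, rfl⟩
    refine ⟨_, 1, _, rfl, ⟨rfl, rfl⟩, exec_machine_iff.2 ⟨rfl, _, localStep_setLabel _ _, ?_⟩⟩
    rw [initList_eq]
    rfl

variable {e₀ : (tm i).Γ (tm i).k₀ ≃ Bool} {e₁ : (tm i).Γ (tm i).k₁ ≃ Bool} {a b : A}
  {f : Bool → List Bool} {w out : List Bool} {T : ℕ}

/-- A successful call is a complete run, because the label test admits only halted configurations
and the hosted machine is deterministic. It leaves the machine idle, ready for further calls. -/
theorem eq_of_exec_callFun (hab : a ≠ b) (hw : aux a = w.reverse)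
    (hidle : cfg i = idleCfg (tm i))
    (hrun : ReachesIn (fun x y => (tm i).step x = some y) T (initList (tm i) (w.map e₀.symm))
      (haltList (tm i) (out.map e₁.symm)))
    (h : (callFun i e₀ e₁ a b f).Exec Action.step n ⟨cfg, aux⟩ s) :
    s = ⟨cfg, Function.update (Function.update aux a []) b
      ((out.flatMap f).reverse ++ aux b)⟩ := by
  obtain ⟨_, _, _, -, h₁, h⟩ := exec_seq_iff.1 h
  obtain ⟨_, _, _, -, h₂, h⟩ := exec_seq_iff.1 h
  obtain ⟨rfl, -⟩ := (eq_of_exec_load_input hw hidle).1 (.seq h₁ h₂)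
  obtain ⟨_, _, _, -, h₃, h⟩ := exec_seq_iff.1 h
  obtain ⟨m, c, hc, rfl⟩ := of_exec_star_machineStep h₃
  obtain ⟨_, _, _, -, h₄, h₅⟩ := exec_seq_iff.1 h
  obtain ⟨-, c', hc', rfl⟩ := exec_machine_iff.1 h₄
  obtain ⟨hl, rfl⟩ := (localStep_testLabel _ _ _).1 hc'
  obtain rfl : c' = haltList (tm i) (out.map e₁.symm) := by
    refine ReachesIn.eq_of_terminal (fun a b c h h' => Option.some.inj (h.symm.trans h')) hc hrun
      (fun x hx => ?_) (fun x hx => ?_)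
    · rw [step_eq_none hl] at hx; cases hx
    · rw [step_eq_none rfl] at hx; cases hx
  rw [haltList_eq] at h₅
  obtain ⟨rfl, -⟩ := (exec_unload_iff (w := out) (Function.update_self _ _ _)).1 h₅
  -- Once its output stack is emptied, the halted configuration is exactly the idle one.
  rw [Function.update_idem, show Function.update (fun _ => []) (tm i).k₁ [] =
    (fun _ => [] : ∀ k, List ((tm i).Γ k)) from Function.update_eq_self _ _,
    show (mkCfg none (tm i).initialState fun _ => []) = cfg i from hidle.symm,
      Function.update_eq_self, Function.update_of_ne hab.symm]

theorem exec_callFun (hab : a ≠ b) (hw : aux a = w.reverse)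
    (hidle : cfg i = idleCfg (tm i))
    (hrun : ReachesIn (fun x y => (tm i).step x = some y) T (initList (tm i) (w.map e₀.symm))
      (haltList (tm i) (out.map e₁.symm))) :
    ∃ n ≤ 4 * w.length + 4 * out.length + T * (Fintype.card (tm i).Λ + 2) + 7,
      (callFun i e₀ e₁ a b f).Exec Action.step n ⟨cfg, aux⟩
        ⟨cfg, Function.update (Function.update aux a []) b ((out.flatMap f).reverse ++ aux b)⟩ := by
  obtain ⟨n₁, n₂, y, hn, h₁, h₂⟩ := exec_seq_iff.1
    ((eq_of_exec_load_input (e₀ := e₀) hw hidle).2 ⟨rfl, rfl⟩)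
  obtain ⟨n₃, hn₃, h₃⟩ := exec_star_machineStep (cfg := cfg)
    (aux := Function.update aux a []) hrun
  have h₄ : (Prog.atom (Action.machine i (testLabel none))).Exec Action.step 1
      ⟨Function.update cfg i (haltList (tm i) (out.map e₁.symm)), Function.update aux a []⟩
      ⟨Function.update cfg i (haltList (tm i) (out.map e₁.symm)), Function.update aux a []⟩ :=
    exec_machine_iff.2 ⟨rfl, _, (localStep_testLabel _ _ _).2 ⟨rfl, rfl⟩, rfl⟩
  have h₅ := (exec_unload_iff (cfg := cfg) (aux := Function.update aux a []) (a := b) (f := f)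
    (l := none) (v := (tm i).initialState) (e := e₁)
    (S := Function.update (fun _ => []) (tm i).k₁ (out.map e₁.symm)) (w := out) (by simp)).2
    ⟨rfl, rfl⟩
  rw [Function.update_idem, show Function.update (fun _ => []) (tm i).k₁ [] =
    (fun _ => [] : ∀ k, List ((tm i).Γ k)) from Function.update_eq_self _ _,
    show (mkCfg none (tm i).initialState fun _ => []) = cfg i from hidle.symm,
      Function.update_eq_self, Function.update_of_ne hab.symm, ← haltList_eq] at h₅
  exact ⟨_, by omega, .seq h₁ (.seq h₂ (.seq h₃ (.seq h₄ h₅)))⟩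

end Host

/-! ### Encodings and determinism of oracle runs -/

namespace ParamComplexity

theorem pair_cons (b : Bool) (x r : List Bool) : pair (b :: x) r = true :: b :: pair x r := by
  simp [pair, selfDelim]

theorem length_selfDelim (x : List Bool) : (selfDelim x).length = 2 * x.length + 1 := by
  induction x with
  | nil => rfl
  | cons b x ih => simp [selfDelim] at ih ⊢; omega

theorem length_pair (x r : List Bool) : (pair x r).length = 2 * x.length + 1 + r.length := by
  simp [pair, length_selfDelim]

theorem pair_injective {x y r s : List Bool} (h : pair x r = pair y s) : x = y ∧ r = s := by
  induction x generalizing y with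
  | nil =>
    cases y with
    | nil => exact ⟨rfl, by simpa [pair, selfDelim] using h⟩
    | cons b y => rw [pair_cons] at h; cases h
  | cons b x ih =>
    cases y with
    | nil => rw [pair_cons] at h; cases h
    | cons c y =>
      rw [pair_cons, pair_cons] at h
      simp only [List.cons.injEq, true_and] at h
      obtain ⟨rfl, h⟩ := h
      obtain ⟨rfl, rfl⟩ := ih h
      exact ⟨rfl, rfl⟩

/-- Ensures that the content of the query stack determines the instance asked, and hence that oracle
steps are deterministic. -/
theorem encodeInstance_injective : Function.Injective encodeInstance := by
  rintro ⟨x, p⟩ ⟨y, q⟩ h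
  obtain ⟨rfl, h⟩ := pair_injective h
  have := congrArg List.length h
  simp only [List.length_replicate] at this
  exact Prod.ext rfl this

/-- A table of strings with answers, as one binary string. -/
def encodeTable (E : List (List Bool × Bool)) : List Bool :=
  E.flatMap fun e => pair e.1 [e.2]

theorem encodeTable_cons (q : List Bool) (b : Bool) (E : List (List Bool × Bool)) :
    encodeTable ((q, b) :: E) = pair q (b :: encodeTable E) := by
  simp [encodeTable, pair]

/-- A step of a machine with an oracle. -/
def OracleTM.OracleStep (M : OracleTM) (R : Set (List Bool × ℕ)) (c c' : M.tm.Cfg) : Prop :=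
  (c.l ≠ some M.ask ∧ M.tm.step c = some c') ∨
    ∃ v S z, c = ⟨some M.ask, v, S⟩ ∧ (S M.kq).map M.queryAlphabet = encodeInstance z ∧
      c' = M.answer R z v S

theorem OracleTM.OracleStep.deterministic {M : OracleTM} {R : Set (List Bool × ℕ)}
    {a b c : M.tm.Cfg} (hb : M.OracleStep R a b) (hc : M.OracleStep R a c) : b = c := by
  rcases hb with ⟨h1, hb⟩ | ⟨v, S, z, rfl, hz, rfl⟩
  · rcases hc with ⟨-, hc⟩ | ⟨v, S, z, rfl, hz, rfl⟩
    · exact Option.some.inj (hb.symm.trans hc)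
    · exact absurd rfl h1
  · rcases hc with ⟨h1, -⟩ | ⟨v', S', z', h, hz', rfl⟩
    · exact absurd rfl h1
    · cases h
      rw [encodeInstance_injective (hz.symm.trans hz')]

theorem OracleTM.Runs.reachesIn {M : OracleTM} {R : Set (List Bool × ℕ)} {c c' : M.tm.Cfg}
    {qs : List (List Bool × ℕ)} {n : ℕ} (h : M.Runs R c qs n c') :
    ReachesIn (M.OracleStep R) n c c' := by
  induction h with
  | refl c => exact .refl c
  | step hl hs _ ih => exact .head (.inl ⟨hl, hs⟩) ih
  | query hz _ ih => exact .head (.inr ⟨_, _, _, rfl, hz, rfl⟩) ih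

end ParamComplexity

/-! ### The verifier: parsing its input and guessing a tuple -/

namespace Host

open TM2 StackMachine Prog

theorem update_vec_zero (a b c d e : List Bool) :
    Function.update ![a, b, c, d] 0 e = ![e, b, c, d] := by
  funext i; fin_cases i <;> rfl

theorem update_vec_one (a b c d e : List Bool) :
    Function.update ![a, b, c, d] 1 e = ![a, e, c, d] := by
  funext i; fin_cases i <;> rfl

theorem update_vec_two (a b c d e : List Bool) :
    Function.update ![a, b, c, d] 2 e = ![a, b, e, d] := by
  funext i; fin_cases i <;> rfl

theorem update_vec_three (a b c d e : List Bool) :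
    Function.update ![a, b, c, d] 3 e = ![a, b, c, e] := by
  funext i; fin_cases i <;> rfl

theorem vec_zero (a b c d : List Bool) : (![a, b, c, d] : Fin 4 → List Bool) 0 = a := rfl

theorem vec_one (a b c d : List Bool) : (![a, b, c, d] : Fin 4 → List Bool) 1 = b := rfl

theorem vec_two (a b c d : List Bool) : (![a, b, c, d] : Fin 4 → List Bool) 2 = c := rfl

theorem vec_three (a b c d : List Bool) : (![a, b, c, d] : Fin 4 → List Bool) 3 = d := rfl

variable {I : Type} [DecidableEq I] (M : I → OracleTM)

/-- The actions of the verifier. It has four auxiliary stacks: a work stack, a tape with a table of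
answers, a stack for an instance, and an output buffer. -/
abbrev VAction : Type := Action (fun i => (M i).tm) (Fin 4)

/-- The states of the verifier. -/
abbrev VState : Type := State (fun i => (M i).tm) (Fin 4)

variable {M} {cfg : ∀ i, (M i).tm.Cfg} {n : ℕ} {s : VState M}

section Parse

variable (M) in
/-- Split the input into an instance and a table of answers. -/
def parse : Prog (VAction M) :=
  .seq (moveAux 0 1) (readDelim 1 fun b => .push 2 [b])

/-- The input arrives reversed, and moving it makes it readable from the front. The instance ends up
reversed, which is the form that `callFun` expects. -/
theorem exec_parse_iff {x a : List Bool} :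
    (parse M).Exec Action.step n ⟨cfg, ![(pair x a).reverse, [], [], []]⟩ s ↔
      s = ⟨cfg, ![[], a, x.reverse, []]⟩ ∧ n = 4 * (pair x a).length + 2 + (5 * x.length + 2) := by
  have key := fun n' => exec_readDelim_iff (tm := fun i => (M i).tm) (a := (1 : Fin 4))
    (act := fun b => .push 2 [b]) (T := List Bool)
    (G := fun r t => ⟨cfg, ![[], r, t, []]⟩) (g := fun b t t' => t' = [b].reverse ++ t)
    (by
      intro b r t n s
      simp only [exec_pop_iff, vec_one, update_vec_one])
    (by
      intro b r t n s
      simp only [exec_push_iff, vec_two, update_vec_two, exists_eq_left])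
    (x := x) (r := a) (t := []) (n := n') (s := s)
  simp only [foldRel_push_iff, exists_eq_left, List.flatMap_singleton', List.append_nil] at key
  simp only [parse, exec_seq_iff, exec_moveAux_iff (show (0 : Fin 4) ≠ 1 by decide), vec_zero,
    vec_one, update_vec_zero, update_vec_one, List.reverse_reverse, List.length_reverse,
    List.append_nil]
  constructor
  · rintro ⟨_, _, _, rfl, ⟨rfl, rfl⟩, h⟩
    obtain ⟨rfl, rfl⟩ := (key _).1 h
    exact ⟨rfl, rfl⟩
  · rintro ⟨rfl, rfl⟩
    exact ⟨_, _, _, rfl, ⟨rfl, rfl⟩, (key _).2 ⟨rfl, rfl⟩⟩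

end Parse

/-- The machine of `M` computes `out` from `w` within `T` steps (without using the oracle). -/
def Computes (M : OracleTM) (w out : List Bool) (T : ℕ) : Prop :=
  ReachesIn (fun x y => M.tm.step x = some y) T (initList M.tm (w.map M.inputAlphabet.symm))
    (haltList M.tm (out.map M.outputAlphabet.symm))

section Tuple

variable (M) in
/-- Append the value of a function at a string to the buffer. -/
noncomputable def appendItem (g : I) (a : Fin 4) : Prog (VAction M) :=
  .seq (callFun g (M g).inputAlphabet (M g).outputAlphabet a 3 fun b => [true, b])
    (.atom (.push 3 [false]))

variable (M) in
/-- Guess a string and append its value to the buffer. -/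
noncomputable def guessItem (g : I) : Prog (VAction M) :=
  .seq (.star (anyBit fun b => .atom (.push 0 [b]))) (appendItem M g 0)

variable (M) in
/-- Write the values at a guessed tuple that contains the instance. -/
noncomputable def guessTuple (g : I) : Prog (VAction M) :=
  .seq (.star (guessItem M g)) (.seq (appendItem M g 2) (.star (guessItem M g)))

variable {g : I} {aux : Fin 4 → List Bool} {a : Fin 4} {w out : List Bool} {T : ℕ}

/-- The call puts the marker `true` before every output bit, and the final `false` completes the
self-delimiting code. -/
theorem eq_of_exec_appendItem (ha : a ≠ 3) (hw : aux a = w.reverse)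
    (hidle : cfg g = idleCfg (M g).tm) (hrun : Computes (M g) w out T)
    (h : (appendItem M g a).Exec Action.step n ⟨cfg, aux⟩ s) :
    s = ⟨cfg, Function.update (Function.update aux a []) 3
      ((selfDelim out).reverse ++ aux 3)⟩ := by
  obtain ⟨_, _, _, -, h₁, h⟩ := exec_seq_iff.1 h
  obtain rfl := eq_of_exec_callFun ha hw hidle hrun h₁
  obtain ⟨-, rfl⟩ := exec_push_iff.1 h
  simp [selfDelim]

theorem exec_appendItem (ha : a ≠ 3) (hw : aux a = w.reverse)
    (hidle : cfg g = idleCfg (M g).tm) (hrun : Computes (M g) w out T) :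
    ∃ n ≤ 4 * w.length + 4 * out.length + T * (Fintype.card (M g).tm.Λ + 2) + 8,
      (appendItem M g a).Exec Action.step n ⟨cfg, aux⟩
        ⟨cfg, Function.update (Function.update aux a []) 3 ((selfDelim out).reverse ++ aux 3)⟩ := by
  obtain ⟨n, hn, h⟩ := exec_callFun (tm := fun i => (M i).tm) (f := fun b => [true, b]) ha hw hidle
    hrun
  refine ⟨n + 1, by omega, .seq h (exec_push_iff.2 ⟨rfl, ?_⟩)⟩
  simp [selfDelim]

variable {gf : List Bool → List Bool} {Tg : List Bool → ℕ} {t c d : List Bool}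

theorem eq_of_exec_guessItem (hidle : cfg g = idleCfg (M g).tm)
    (hrun : ∀ w, Computes (M g) w (gf w) (Tg w))
    (h : (guessItem M g).Exec Action.step n ⟨cfg, ![[], t, c, d]⟩ s) :
    ∃ w, s = ⟨cfg, ![[], t, c, (selfDelim (gf w)).reverse ++ d]⟩ := by
  obtain ⟨_, _, _, -, h₁, h⟩ := exec_seq_iff.1 h
  obtain ⟨w, rfl⟩ := star_induction (fun s => ∃ w, s = (⟨cfg, ![w, t, c, d]⟩ : VState M))
    ⟨[], rfl⟩ (by
      rintro m _ y' ⟨w, rfl⟩ h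
      obtain ⟨_, b, -, h⟩ := exec_anyBit_iff.1 h
      obtain ⟨-, rfl⟩ := exec_push_iff.1 h
      exact ⟨_, by rw [update_vec_zero]⟩) h₁
  obtain rfl := eq_of_exec_appendItem (by decide) (w := w.reverse) (by simp) hidle
    (hrun _) h
  exact ⟨w.reverse, by rw [update_vec_zero, update_vec_three, vec_three]⟩

theorem exec_guessItem (hidle : cfg g = idleCfg (M g).tm)
    (hrun : ∀ w, Computes (M g) w (gf w) (Tg w)) (w : List Bool) :
    ∃ n ≤ 7 * w.length + 4 * (gf w).length + Tg w * (Fintype.card (M g).tm.Λ + 2) + 9,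
      (guessItem M g).Exec Action.step n ⟨cfg, ![[], t, c, d]⟩
        ⟨cfg, ![[], t, c, (selfDelim (gf w)).reverse ++ d]⟩ := by
  -- Guessing a bit costs 3 (choice, push, loop); with the 4 for loading it this gives the 7 in the
  -- bound.
  have h₁ : ∀ u v : List Bool, (Prog.star (anyBit fun b => .atom (.push 0 [b]))).Exec Action.step
      (3 * u.length + 1) (⟨cfg, ![v, t, c, d]⟩ : VState M) ⟨cfg, ![u.reverse ++ v, t, c, d]⟩ := by
    intro u
    induction u with
    | nil => exact fun _ => .nil
    | cons b u ih =>
      intro v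
      have hb : (anyBit fun b => .atom (.push 0 [b])).Exec Action.step 2
          (⟨cfg, ![v, t, c, d]⟩ : VState M) ⟨cfg, ![b :: v, t, c, d]⟩ :=
        exec_anyBit_iff.2 ⟨1, b, rfl, exec_push_iff.2 ⟨rfl, by rw [update_vec_zero]; rfl⟩⟩
      convert Prog.Exec.cons hb (ih (b :: v)) using 1
      · simp only [List.length_cons]; omega
      · simp
  obtain ⟨n, hn, h⟩ := exec_appendItem (cfg := cfg) (aux := ![w.reverse, t, c, d])
    (a := 0) (by decide) rfl hidle (hrun w)
  rw [update_vec_zero, update_vec_three, vec_three] at h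
  have h1 := h₁ w []
  rw [List.append_nil] at h1
  exact ⟨_, by omega, .seq h1 h⟩

theorem encodeTuple_append (l l' : List (List Bool)) :
    encodeTuple (l ++ l') = encodeTuple l ++ encodeTuple l' := List.flatMap_append

theorem encodeTuple_singleton (y : List Bool) : encodeTuple [y] = selfDelim y := by
  simp [encodeTuple]

theorem of_exec_star_guessItem (hidle : cfg g = idleCfg (M g).tm)
    (hrun : ∀ w, Computes (M g) w (gf w) (Tg w)) {l : List (List Bool)}
    (h : (Prog.star (guessItem M g)).Exec Action.step n
      ⟨cfg, ![[], t, c, (encodeTuple (l.map gf)).reverse]⟩ s) :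
    ∃ l', s = ⟨cfg, ![[], t, c, (encodeTuple ((l ++ l').map gf)).reverse]⟩ := by
  refine star_induction (fun s => ∃ l',
    s = (⟨cfg, ![[], t, c, (encodeTuple ((l ++ l').map gf)).reverse]⟩ : VState M))
    ⟨[], by simp⟩ ?_ h
  rintro m _ y' ⟨l', rfl⟩ h
  obtain ⟨w, rfl⟩ := eq_of_exec_guessItem hidle hrun h
  refine ⟨l' ++ [w], ?_⟩
  rw [← List.append_assoc, List.map_append (l₂ := [w]), encodeTuple_append, List.map_singleton,
    encodeTuple_singleton, List.reverse_append]

theorem exec_star_guessItem (hidle : cfg g = idleCfg (M g).tm)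
    (hrun : ∀ w, Computes (M g) w (gf w) (Tg w)) {B : ℕ} (l l' : List (List Bool))
    (hB : ∀ w ∈ l', 7 * w.length + 4 * (gf w).length + Tg w * (Fintype.card (M g).tm.Λ + 2) + 9 ≤ B) :
    ∃ n ≤ l'.length * (B + 1) + 1, (Prog.star (guessItem M g)).Exec Action.step n
      ⟨cfg, ![[], t, c, (encodeTuple (l.map gf)).reverse]⟩
      ⟨cfg, ![[], t, c, (encodeTuple ((l ++ l').map gf)).reverse]⟩ := by
  induction l' generalizing l with
  | nil => exact ⟨1, by simp, by simpa using Prog.Exec.nil⟩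
  | cons w l' ih =>
    obtain ⟨n₁, hn₁, h₁⟩ := exec_guessItem (t := t) (c := c) (d := (encodeTuple (l.map gf)).reverse)
      hidle hrun w
    obtain ⟨n₂, hn₂, h₂⟩ := ih (l ++ [w]) fun w' hw' => hB w' (by simp [hw'])
    have hw := hB w (by simp)
    rw [List.map_append (l₂ := [w]), encodeTuple_append, List.map_singleton,
      encodeTuple_singleton, List.reverse_append, List.append_assoc] at h₂
    exact ⟨_, by rw [List.length_cons, add_mul]; omega, .cons h₁ h₂⟩

/-- Neither the number nor the lengths of the guessed strings are controlled: soundness needs only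
that `x` occurs. -/
theorem of_exec_guessTuple (hidle : cfg g = idleCfg (M g).tm)
    (hrun : ∀ w, Computes (M g) w (gf w) (Tg w)) {x : List Bool}
    (h : (guessTuple M g).Exec Action.step n ⟨cfg, ![[], t, x.reverse, []]⟩ s) :
    ∃ xs : List (List Bool), x ∈ xs ∧
      s = ⟨cfg, ![[], t, [], (encodeTuple (xs.map gf)).reverse]⟩ := by
  obtain ⟨_, _, _, -, h₁, h⟩ := exec_seq_iff.1 h
  obtain ⟨_, _, _, -, h₂, h₃⟩ := exec_seq_iff.1 h
  obtain ⟨l, rfl⟩ := of_exec_star_guessItem (l := []) hidle hrun h₁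
  obtain rfl := eq_of_exec_appendItem (by decide) (w := x) rfl hidle (hrun _) h₂
  rw [update_vec_two, update_vec_three, vec_three, ← List.reverse_append,
    ← encodeTuple_singleton, ← List.map_singleton, ← encodeTuple_append, ← List.map_append] at h₃
  obtain ⟨l', rfl⟩ := of_exec_star_guessItem hidle hrun h₃
  exact ⟨_, by simp, rfl⟩

theorem exec_guessTuple (hidle : cfg g = idleCfg (M g).tm)
    (hrun : ∀ w, Computes (M g) w (gf w) (Tg w)) {B : ℕ} {x : List Bool} {xs : List (List Bool)}
    (hx : x ∈ xs)
    (hB : ∀ w ∈ xs, 7 * w.length + 4 * (gf w).length + Tg w * (Fintype.card (M g).tm.Λ + 2) + 9 ≤ B) :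
    ∃ n ≤ xs.length * (B + 1) + 1, (guessTuple M g).Exec Action.step n
      ⟨cfg, ![[], t, x.reverse, []]⟩
      ⟨cfg, ![[], t, [], (encodeTuple (xs.map gf)).reverse]⟩ := by
  -- The two guessing loops produce the parts of the tuple before and after an occurrence of `x`.
  obtain ⟨l, l', rfl⟩ := List.append_of_mem hx
  obtain ⟨n₁, hn₁, h₁⟩ := exec_star_guessItem (t := t) (c := x.reverse) hidle hrun [] l
    fun w hw => hB w (by simp [hw])
  obtain ⟨n₂, hn₂, h₂⟩ := exec_appendItem (aux := ![[], t, x.reverse,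
    (encodeTuple (l.map gf)).reverse]) (by decide) (a := 2) (w := x) rfl hidle (hrun _)
  rw [update_vec_two, update_vec_three, vec_three, ← List.reverse_append,
    ← encodeTuple_singleton, ← List.map_singleton, ← encodeTuple_append, ← List.map_append] at h₂
  obtain ⟨n₃, hn₃, h₃⟩ := exec_star_guessItem (t := t) (c := []) hidle hrun (l ++ [x]) l'
    fun w hw => hB w (by simp [hw])
  have hxB := hB x (by simp)
  rw [List.append_assoc] at h₃
  refine ⟨_, ?_, .seq h₁ (.seq h₂ h₃)⟩
  rw [List.length_append, List.length_cons, add_mul, add_mul]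
  omega

end Tuple

end Host

/-! ### Answering oracle queries from the table -/

namespace Host

open TM2 StackMachine Prog

variable {I : Type} [DecidableEq I] {M : I → OracleTM} {cfg : ∀ i, (M i).tm.Cfg} {n : ℕ}
  {s : VState M} {o : I}

section Query

variable (M) in
/-- Skip an entry of the table of answers. -/
def skipEntry : Prog (VAction M) :=
  .seq (readDelim 1 fun _ => .push 1 []) (anyBit fun b => .atom (.pop 1 b))

variable (M o) in
/-- Look up the query of the oracle machine in the table of answers, and answer it. -/
noncomputable def answerQuery : Prog (VAction M) :=
  .seq (.atom (.machine o (testLabel (some (M o).ask)))) <|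
  .seq (.star (skipEntry M)) <|
  .seq (readDelim 1 fun b => .machine o (popSym (M o).kq ((M o).queryAlphabet.symm b))) <|
  .seq (.atom (.machine o (emptySym (M o).kq)))
    (anyBit fun b => .seq (.atom (.pop 1 b))
      (.atom (.machine o (setLabel (some (cond b (M o).yes (M o).no))))))

/-- A lookup past the end of the table fails instead of inventing an answer. -/
theorem not_exec_readDelim_nil {act : Bool → VAction M} {x y z : List Bool} :
    ¬ (readDelim 1 act).Exec Action.step n ⟨cfg, ![x, [], y, z]⟩ s := by
  intro h
  obtain ⟨_, _, _, -, h₁, h₂⟩ := exec_seq_iff.1 h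
  rcases exec_star_iff.1 h₁ with ⟨rfl, rfl⟩ | ⟨_, _, _, -, h, -⟩
  · obtain ⟨-, r, hr, -⟩ := exec_pop_iff.1 h₂
    cases hr
  · obtain ⟨_, _, _, -, h, -⟩ := exec_seq_iff.1 h
    obtain ⟨-, r, hr, -⟩ := exec_pop_iff.1 h
    cases hr

theorem exec_skipEntry_iff {x y z q r : List Bool} {b : Bool} :
    (skipEntry M).Exec Action.step n ⟨cfg, ![x, pair q (b :: r), y, z]⟩ s ↔
      s = ⟨cfg, ![x, r, y, z]⟩ ∧ n = 5 * q.length + 4 := by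
  have key := fun n' s' => exec_readDelim_iff (tm := fun i => (M i).tm) (a := (1 : Fin 4))
    (act := fun _ => .push 1 []) (T := Unit)
    (G := fun r _ => ⟨cfg, ![x, r, y, z]⟩) (g := fun _ _ _ => True)
    (by
      intro b r t n s
      simp only [exec_pop_iff, vec_one, update_vec_one])
    (by
      intro b r t n s
      simp [exec_push_iff, update_vec_one])
    (x := q) (r := b :: r) (t := ()) (n := n') (s := s')
  simp only [foldRel_skip_iff, exists_const, true_and] at key
  simp only [skipEntry, exec_seq_iff, key, exec_anyBit_iff]
  constructor
  · rintro ⟨_, _, _, rfl, ⟨rfl, rfl⟩, _, b', rfl, h⟩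
    obtain ⟨rfl, r', hr', rfl⟩ := exec_pop_iff.1 h
    rw [vec_one] at hr'
    cases hr'
    exact ⟨by rw [update_vec_one], rfl⟩
  · rintro ⟨rfl, rfl⟩
    exact ⟨_, 2, _, rfl, ⟨rfl, rfl⟩, 1, b, rfl, exec_pop_iff.2 ⟨rfl, r, rfl, by
      rw [update_vec_one]⟩⟩

theorem of_exec_star_skipEntry {x y z : List Bool} {E : List (List Bool × Bool)}
    (h : (Prog.star (skipEntry M)).Exec Action.step n ⟨cfg, ![x, encodeTable E, y, z]⟩ s) :
    ∃ E', E' <:+ E ∧ s = ⟨cfg, ![x, encodeTable E', y, z]⟩ := by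
  refine star_induction (fun s => ∃ E', E' <:+ E ∧
    s = (⟨cfg, ![x, encodeTable E', y, z]⟩ : VState M)) ⟨E, List.suffix_rfl, rfl⟩ ?_ h
  rintro m _ y' ⟨E', hE', rfl⟩ h
  rcases E' with _ | ⟨⟨q, b⟩, E'⟩
  · obtain ⟨_, _, _, -, h, -⟩ := exec_seq_iff.1 h
    exact absurd h not_exec_readDelim_nil
  · rw [encodeTable_cons] at h
    obtain ⟨rfl, -⟩ := exec_skipEntry_iff.1 h
    exact ⟨E', (List.suffix_cons _ _).trans hE', rfl⟩

/-- The cost is charged to the consumed part of the table, 5 per bit. The inequality is arranged so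
that successive lookups telescope. -/
theorem exec_star_skipEntry {x y z : List Bool} (E E' : List (List Bool × Bool)) :
    ∃ n, n + 5 * (encodeTable E').length ≤ 5 * (encodeTable (E ++ E')).length + 1 ∧
      (Prog.star (skipEntry M)).Exec Action.step n ⟨cfg, ![x, encodeTable (E ++ E'), y, z]⟩
        ⟨cfg, ![x, encodeTable E', y, z]⟩ := by
  induction E with
  | nil => exact ⟨1, by simp; omega, .nil⟩
  | cons e E ih =>
    obtain ⟨q, b⟩ := e
    obtain ⟨n, hn, h⟩ := ih
    rw [List.cons_append, encodeTable_cons]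
    refine ⟨_, ?_, .cons (exec_skipEntry_iff.2 ⟨rfl, rfl⟩) h⟩
    rw [length_pair, List.length_cons]
    omega

/-- Matching alone shows only that the entry is a prefix of the query; the emptiness test that
follows in `answerQuery` excludes a proper prefix. -/
theorem exec_matchQuery_iff {q r y z : List Bool} {c : (M o).tm.Cfg} :
    (readDelim 1 fun b => .machine o (popSym (M o).kq ((M o).queryAlphabet.symm b))).Exec
      Action.step n (⟨Function.update cfg o c, ![y, pair q r, z, []]⟩ : VState M) s ↔
      (∃ w, (c.stk (M o).kq).map (M o).queryAlphabet = q ++ w ∧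
        s = ⟨Function.update cfg o (mkCfg c.l c.var (Function.update c.stk (M o).kq
          (w.map (M o).queryAlphabet.symm))), ![y, r, z, []]⟩) ∧
      n = 5 * q.length + 2 := by
  have key := exec_readDelim_iff (tm := fun i => (M i).tm) (a := (1 : Fin 4))
    (act := fun b => .machine o (popSym (M o).kq ((M o).queryAlphabet.symm b))) (T := List Bool)
    (G := fun r t => ⟨Function.update cfg o (mkCfg c.l c.var (Function.update c.stk (M o).kq
      (t.map (M o).queryAlphabet.symm))), ![y, r, z, []]⟩) (g := fun b t t' => t = b :: t')
    (by
      intro b r t n s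
      simp only [exec_pop_iff, vec_one, update_vec_one])
    (by
      intro b r t n s
      refine exec_machine_iff.trans (and_congr_right fun _ => ?_)
      simp only [localStep_popSym, mkCfg_stk, mkCfg_l, mkCfg_var, Function.update_self,
        Function.update_idem]
      constructor
      · rintro ⟨_, ⟨w, hw, rfl⟩, rfl⟩
        rcases t with _ | ⟨b', t⟩
        · cases hw
        · simp only [List.map_cons, List.cons.injEq, EmbeddingLike.apply_eq_iff_eq] at hw
          obtain ⟨rfl, rfl⟩ := hw
          exact ⟨t, rfl, rfl⟩
      · rintro ⟨t', rfl, rfl⟩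
        exact ⟨_, ⟨_, rfl, rfl⟩, rfl⟩)
    (x := q) (r := r) (t := (c.stk (M o).kq).map (M o).queryAlphabet) (n := n) (s := s)
  have hc : mkCfg c.l c.var (Function.update c.stk (M o).kq
      (((c.stk (M o).kq).map (M o).queryAlphabet).map (M o).queryAlphabet.symm)) = c := by
    rw [List.map_map, Equiv.symm_comp_self, List.map_id, Function.update_eq_self]
    rfl
  simp only [hc, foldRel_pop_iff] at key
  rw [key]
  simp only [← and_assoc, exists_and_right]

theorem of_exec_answerQuery {y z : List Bool} {E : List (List Bool × Bool)} {c : (M o).tm.Cfg}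
    (h : (answerQuery M o).Exec Action.step n
      ⟨Function.update cfg o c, ![y, encodeTable E, z, []]⟩ s) :
    ∃ q b E', (q, b) :: E' <:+ E ∧ c.l = some (M o).ask ∧
      (c.stk (M o).kq).map (M o).queryAlphabet = q ∧
      s = ⟨Function.update cfg o (mkCfg (some (cond b (M o).yes (M o).no)) c.var
        (Function.update c.stk (M o).kq [])), ![y, encodeTable E', z, []]⟩ := by
  obtain ⟨_, _, _, -, h₁, k1⟩ := exec_seq_iff.1 h
  obtain ⟨-, c', hc', rfl⟩ := exec_machine_iff.1 h₁
  obtain ⟨hl, rfl⟩ := (localStep_testLabel _ _ _).1 hc'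
  obtain ⟨_, _, _, -, h₂, k2⟩ := exec_seq_iff.1 k1
  obtain ⟨E₁, hE₁, rfl⟩ := of_exec_star_skipEntry h₂
  obtain ⟨_, _, _, -, h₃, k3⟩ := exec_seq_iff.1 k2
  rcases E₁ with _ | ⟨⟨q, b⟩, E'⟩
  · exact absurd h₃ not_exec_readDelim_nil
  rw [encodeTable_cons] at h₃
  obtain ⟨⟨w, hw, rfl⟩, -⟩ := exec_matchQuery_iff.1 h₃
  obtain ⟨_, _, _, -, h₄, k4⟩ := exec_seq_iff.1 k3
  obtain ⟨-, c'', hc'', rfl⟩ := exec_machine_iff.1 h₄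
  obtain ⟨hw', rfl⟩ := (localStep_emptySym _ _ _).1 hc''
  obtain rfl : w = [] := by simpa using hw'
  obtain ⟨_, b', -, k0⟩ := exec_anyBit_iff.1 k4
  obtain ⟨_, _, _, -, h₅, h₆⟩ := exec_seq_iff.1 k0
  obtain ⟨-, r, hr, rfl⟩ := exec_pop_iff.1 h₅
  rw [vec_one] at hr
  cases hr
  obtain ⟨-, c₃, hc₃, rfl⟩ := exec_machine_iff.1 h₆
  rw [localStep_setLabel] at hc₃
  cases hc₃
  refine ⟨q, b, E', hE₁, hl, by simpa using hw, ?_⟩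
  rw [update_vec_one]
  rfl

/-- The list `E` is skipped and then lost: the table is read only once, front to back. -/
theorem exec_answerQuery {y z : List Bool} (E E' : List (List Bool × Bool)) {c : (M o).tm.Cfg}
    (q : List Bool) (b : Bool) (hc : c.l = some (M o).ask)
    (hq : (c.stk (M o).kq).map (M o).queryAlphabet = q) :
    ∃ n, n + 5 * (encodeTable E').length ≤ 5 * (encodeTable (E ++ (q, b) :: E')).length ∧
      (answerQuery M o).Exec Action.step n
      ⟨Function.update cfg o c, ![y, encodeTable (E ++ (q, b) :: E'), z, []]⟩
      ⟨Function.update cfg o (mkCfg (some (cond b (M o).yes (M o).no)) c.var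
        (Function.update c.stk (M o).kq [])), ![y, encodeTable E', z, []]⟩ := by
  obtain ⟨n, hn, h⟩ := exec_star_skipEntry (cfg := Function.update cfg o c) (x := y) (y := z)
    (z := []) E ((q, b) :: E')
  rw [encodeTable_cons, length_pair, List.length_cons] at hn
  rw [encodeTable_cons q b E'] at h
  refine ⟨_, ?_, .seq (exec_machine_iff.2 ⟨rfl, c, (localStep_testLabel _ _ _).2 ⟨hc, rfl⟩, rfl⟩) <|
    .seq h <| .seq (exec_matchQuery_iff.2 ⟨⟨[], by simpa using hq, rfl⟩, rfl⟩) <|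
    .seq (exec_machine_iff.2 ⟨rfl, _, (localStep_emptySym _ _ _).2 ⟨by simp, rfl⟩, rfl⟩) <|
    exec_anyBit_iff.2 ⟨2, b, rfl, .seq (m := 1) (n := 1) (exec_pop_iff.2 ⟨rfl, _, rfl, rfl⟩)
      (exec_machine_iff.2 ⟨rfl, _, localStep_setLabel _ _, ?_⟩)⟩⟩
  · omega
  · rw [update_vec_one]
    rfl

end Query

section Loop

variable {R : Set (List Bool × ℕ)}

theorem mkCfg_eq_answer {M : OracleTM} {b : Bool} {z : List Bool × ℕ} {v : M.tm.σ}
    {S : ∀ k, List (M.tm.Γ k)} (hb : b = true ↔ z ∈ R) :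
    mkCfg (some (cond b M.yes M.no)) v (Function.update S M.kq []) = M.answer R z v S := by
  unfold OracleTM.answer mkCfg
  by_cases hz : z ∈ R
  · obtain rfl := hb.2 hz
    simp [hz]; rfl
  · obtain rfl : b = false := by simpa [hz] using hb
    simp [hz]; rfl

variable (M o) in
/-- Run the oracle machine, with answers from the table. -/
noncomputable def oracleLoop : Prog (VAction M) :=
  .star (.alt (machineStep o {l | l ≠ (M o).ask}) (answerQuery M o))

/-- Every entry is correct, so it does not matter which matching entry is used: each lookup is a
genuine oracle step. Suffixes of the table inherit correctness. -/
theorem of_exec_oracleLoop {y z : List Bool} {E : List (List Bool × Bool)} {c : (M o).tm.Cfg}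
    (hE : ∀ e ∈ E, ∃ z, e.1 = encodeInstance z ∧ (e.2 = true ↔ z ∈ R))
    (h : (oracleLoop M o).Exec Action.step n
      ⟨Function.update cfg o c, ![y, encodeTable E, z, []]⟩ s) :
    ∃ m c' r, ReachesIn ((M o).OracleStep R) m c c' ∧
      s = ⟨Function.update cfg o c', ![y, r, z, []]⟩ := by
  obtain ⟨m, c', E', hm, -, rfl⟩ := star_induction (fun s => ∃ m c' E',
    ReachesIn ((M o).OracleStep R) m c c' ∧ E' <:+ E ∧
      s = (⟨Function.update cfg o c', ![y, encodeTable E', z, []]⟩ : VState M))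
    ⟨0, c, E, .refl _, List.suffix_rfl, rfl⟩ (by
      rintro k _ s' ⟨m, c', E', hm, hE', rfl⟩ h
      obtain ⟨_, -, h | h⟩ := exec_alt_iff.1 h
      · obtain ⟨c'', ⟨l, hl, hl'⟩, hc'', rfl⟩ := of_exec_machineStep h
        refine ⟨m + 1, c'', E', hm.snoc (.inl ⟨?_, hc''⟩), hE', rfl⟩
        rw [hl']
        exact fun h => hl (Option.some.inj h)
      · obtain ⟨q, b, E'', hE'', hl, hq, rfl⟩ := of_exec_answerQuery h
        obtain ⟨x, hx, hb⟩ := hE (q, b) ((hE''.trans hE').mem (by simp))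
        refine ⟨m + 1, _, E'', hm.snoc (.inr ⟨c'.var, c'.stk, x, ?_, hq.trans hx, ?_⟩),
          ((List.suffix_cons _ _).trans hE'').trans hE', rfl⟩
        · rw [← hl]; rfl
        · exact mkCfg_eq_answer hb) h
  exact ⟨m, c', _, hm, rfl⟩

open Classical in
/-- The correct answers to a list of queries. -/
noncomputable def answers (R : Set (List Bool × ℕ)) (qs : List (List Bool × ℕ)) :
    List (List Bool × Bool) :=
  qs.map fun z => (encodeInstance z, decide (z ∈ R))

/-- The answers must form a contiguous block in the order of the queries, because the table cannot
be rewound. A machine step costs at most its label search plus a choice and a loop decision. -/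
theorem exec_oracleLoop {y z : List Bool} {c c' : (M o).tm.Cfg} {qs : List (List Bool × ℕ)} {T : ℕ}
    (h : (M o).Runs R c qs T c') (E E' : List (List Bool × Bool)) :
    ∃ n r, n + 5 * r.length ≤ 5 * (encodeTable (E ++ (answers R qs ++ E'))).length +
        T * (Fintype.card (M o).tm.Λ + 3) + 1 ∧
      (oracleLoop M o).Exec Action.step n
      ⟨Function.update cfg o c, ![y, encodeTable (E ++ (answers R qs ++ E')), z, []]⟩
      ⟨Function.update cfg o c', ![y, r, z, []]⟩ := by
  induction h generalizing E with
  | refl c => exact ⟨1, _, by omega, .nil⟩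
  | @step c c' c'' qs n hl hs _ ih =>
    obtain ⟨m, r, hm, h₂⟩ := ih E
    obtain ⟨l, hl'⟩ := exists_label_of_step hs
    obtain ⟨k, hk, h₁⟩ := exec_machineStep (tm := fun i => (M i).tm) (cfg := cfg)
      (aux := ![y, encodeTable (E ++ (answers R qs ++ E')), z, []]) (i := o)
      (p := {l | l ≠ (M o).ask}) (l := l) (fun h => hl (by rw [hl', h])) hl' hs
    exact ⟨_, r, by rw [add_mul]; omega, .cons (.left h₁) h₂⟩
  | @query v S x c'' qs n hz _ ih =>
    classical
    -- Only the first query has to skip `E`; afterwards the next answer stands at the front.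
    obtain ⟨m, r, hm, h₂⟩ := ih []
    obtain ⟨k, hk, h₁⟩ := exec_answerQuery (cfg := cfg) (y := y) (z := z) E (answers R qs ++ E')
      (c := ⟨some (M o).ask, v, S⟩) _ (decide (x ∈ R)) rfl hz
    have hc := mkCfg_eq_answer (M := M o) (v := v) (S := S) (decide_eq_true_iff (p := x ∈ R))
    simp only [hc] at h₁
    exact ⟨_, r, by
      simp only [answers, List.map_cons, List.cons_append, List.nil_append, add_mul] at hm hk ⊢
      omega, .cons (.right h₁) h₂⟩

end Loop

end Host

/-! ### Soundness and completeness of the verifier -/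

namespace Host

open TM2 StackMachine Prog

variable {I : Type} [DecidableEq I] (M : I → OracleTM) (g f o : I)

/-- The verifier: for an input `pair x (encodeTable E)`, guess a tuple of strings that contains `x`,
map its elements by the machine `g`, combine the results by the machine `f`, and check that the
oracle machine `o`, with answers from the table `E`, rejects. -/
noncomputable def verifier : Prog (VAction M) :=
  .seq (parse M) <|
  .seq (guessTuple M g) <|
  .seq (callFun f (M f).inputAlphabet (M f).outputAlphabet 3 2 fun b => [b]) <|
  .seq (.seq (load o 2 (M o).tm.k₀ (M o).inputAlphabet)
    (.atom (.machine o (setLabel (some (M o).tm.main))))) <|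
  .seq (oracleLoop M o) <|
  .seq (.atom (.machine o (testLabel none)))
    (.atom (.machine o (popSym (M o).tm.k₁ ((M o).outputAlphabet.symm false))))

/-- The start state of the verifier. -/
abbrev verifierInit (u : List Bool) : VState M :=
  idle (fun i => (M i).tm) ![u.reverse, [], [], []]

variable {M g f o} {R : Set (List Bool × ℕ)} {gf : List Bool → List Bool} {Tg : List Bool → ℕ}
  {F : List (List Bool) → List Bool × ℕ} {Tf : List (List Bool) → ℕ}
  {E : List (List Bool × Bool)} {x : List Bool}

/-- Soundness. The simulation and the true run of the oracle machine both end in terminal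
configurations; by determinism these coincide, so the output `false` that was popped is the true
answer. -/
theorem exists_tuple_of_exec_verifier (hg : ∀ w, Computes (M g) w (gf w) (Tg w))
    (hf : ∀ ys, ys ≠ [] → Computes (M f) (encodeTuple ys) (encodeInstance (F ys)) (Tf ys))
    (ho : ∀ z, ∃ b qs n, (M o).Outputs R z b qs n ∧ (b = true ↔ z ∈ R))
    (hE : ∀ e ∈ E, ∃ z, e.1 = encodeInstance z ∧ (e.2 = true ↔ z ∈ R)) {n : ℕ} {s : VState M}
    (h : (verifier M g f o).Exec Action.step n (verifierInit M (pair x (encodeTable E))) s) :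
    ∃ xs : List (List Bool), x ∈ xs ∧ F (xs.map gf) ∉ R := by
  obtain ⟨_, _, _, -, h₁, k₁⟩ := exec_seq_iff.1 h
  obtain ⟨rfl, -⟩ := exec_parse_iff.1 h₁
  obtain ⟨_, _, _, -, h₂, k₂⟩ := exec_seq_iff.1 k₁
  obtain ⟨xs, hx, rfl⟩ := of_exec_guessTuple rfl hg h₂
  refine ⟨xs, hx, ?_⟩
  obtain ⟨_, _, _, -, h₃, k₃⟩ := exec_seq_iff.1 k₂
  have hne : xs.map gf ≠ [] := by
    rintro h
    rw [List.map_eq_nil_iff] at h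
    subst h
    simp at hx
  obtain rfl := eq_of_exec_callFun (tm := fun i => (M i).tm) (i := f)
    (out := encodeInstance (F (xs.map gf))) (by decide) (w := encodeTuple (xs.map gf)) (by rfl) rfl
    (hf _ hne) h₃
  rw [update_vec_three, update_vec_two, vec_two, List.flatMap_singleton', List.append_nil] at k₃
  set z := F (xs.map gf) with hz
  obtain ⟨_, _, _, -, h₄, k₄⟩ := exec_seq_iff.1 k₃
  obtain ⟨rfl, -⟩ := (eq_of_exec_load_input (w := encodeInstance z) (by rfl) rfl).1 h₄
  rw [update_vec_two] at k₄
  obtain ⟨_, _, _, -, h₅, k₅⟩ := exec_seq_iff.1 k₄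
  obtain ⟨m, c, r, hm, rfl⟩ := of_exec_oracleLoop hE h₅
  obtain ⟨_, _, _, -, h₆, h₇⟩ := exec_seq_iff.1 k₅
  obtain ⟨-, c', hc', rfl⟩ := exec_machine_iff.1 h₆
  obtain ⟨hl, rfl⟩ := (localStep_testLabel _ _ _).1 hc'
  obtain ⟨-, c'', hc'', rfl⟩ := exec_machine_iff.1 h₇
  obtain ⟨w, hw, -⟩ := (localStep_popSym _ _ _ _).1 hc''
  obtain ⟨b, qs, n', hout, hb⟩ := ho z
  -- A halted configuration admits neither an ordinary step nor a query.
  have hterm : ∀ {c : (M o).tm.Cfg}, c.l = none → ∀ y, ¬ (M o).OracleStep R c y := by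
    rintro c hc y (⟨-, h⟩ | ⟨v, S, z, rfl, -⟩)
    · rw [step_eq_none hc] at h; cases h
    · cases hc
  obtain rfl := ReachesIn.eq_of_terminal (r := (M o).OracleStep R)
    (fun _ _ _ => OracleTM.OracleStep.deterministic) hm (OracleTM.Runs.reachesIn hout) (hterm hl)
    (hterm rfl)
  rw [haltList_eq, mkCfg_stk, Function.update_self] at hw
  simp only [List.map_cons, List.map_nil, List.cons.injEq, EmbeddingLike.apply_eq_iff_eq] at hw
  rw [← hb, hw.1]
  simp

/-- The cost of the verifier on a tuple of `t` strings, where `a` is the length of the input, `B` a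
bound on the cost of handling a string of the tuple, `y`, `z` the lengths of the input and output of
the machine `f`, `τ₁` and `τ₂` the running times of the machines `f` and `o`, and `d₁`, `d₂` the
numbers of their labels. -/
def verifierCost (a t B y z τ₁ τ₂ d₁ d₂ : ℕ) : ℕ :=
  14 * a + t * (B + 1) + 4 * y + 8 * z + τ₁ * (d₁ + 2) + τ₂ * (d₂ + 3) + 30

/-- Completeness: the pieces are chained along the given tuple, with the entries of `E` around the
relevant block skipped or left unread. -/
theorem exec_verifier (hg : ∀ w, Computes (M g) w (gf w) (Tg w))
    (hf : ∀ ys, ys ≠ [] → Computes (M f) (encodeTuple ys) (encodeInstance (F ys)) (Tf ys))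
    {xs : List (List Bool)} (hx : x ∈ xs) {B : ℕ}
    (hB : ∀ w ∈ xs, 7 * w.length + 4 * (gf w).length + Tg w * (Fintype.card (M g).tm.Λ + 2) + 9 ≤ B)
    {qs : List (List Bool × ℕ)} {τ : ℕ} (ho : (M o).Outputs R (F (xs.map gf)) false qs τ)
    (hE : answers R qs <:+: E) :
    ∃ n ≤ verifierCost (pair x (encodeTable E)).length xs.length B
        (encodeTuple (xs.map gf)).length (encodeInstance (F (xs.map gf))).length (Tf (xs.map gf)) τ
        (Fintype.card (M f).tm.Λ) (Fintype.card (M o).tm.Λ),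
      ∃ s, (verifier M g f o).Exec Action.step n (verifierInit M (pair x (encodeTable E))) s := by
  have hne : xs.map gf ≠ [] := by
    rintro h
    rw [List.map_eq_nil_iff] at h
    subst h
    simp at hx
  set z := F (xs.map gf) with hz
  obtain ⟨E₁, E₂, rfl⟩ := hE
  rw [List.append_assoc]
  set E := E₁ ++ (answers R qs ++ E₂) with hE
  have h₁ := (exec_parse_iff (M := M) (cfg := fun i => idleCfg (M i).tm) (x := x)
    (a := encodeTable E)).2 ⟨rfl, rfl⟩
  obtain ⟨n₂, hn₂, h₂⟩ := exec_guessTuple (cfg := fun i => idleCfg (M i).tm) (t := encodeTable E)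
    rfl hg hx hB
  obtain ⟨n₃, hn₃, h₃⟩ := exec_callFun (tm := fun i => (M i).tm) (i := f) (a := (3 : Fin 4)) (b := 2)
    (f := fun b => [b]) (cfg := fun i => idleCfg (M i).tm)
    (aux := ![[], encodeTable E, [], (encodeTuple (xs.map gf)).reverse]) (by decide)
    (w := encodeTuple (xs.map gf)) (by rfl) rfl (hf _ hne)
  rw [update_vec_three, update_vec_two, vec_two, List.flatMap_singleton', List.append_nil] at h₃
  have h₄ := (eq_of_exec_load_input (tm := fun i => (M i).tm) (i := o)
    (cfg := fun i => idleCfg (M i).tm) (a := 2)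
    (aux := ![[], encodeTable E, (encodeInstance z).reverse, []]) (e₀ := (M o).inputAlphabet)
    (w := encodeInstance z) (by rfl) rfl).2 ⟨rfl, rfl⟩
  rw [update_vec_two] at h₄
  obtain ⟨n₅, r, hn₅, h₅⟩ := exec_oracleLoop (cfg := fun i => idleCfg (M i).tm) (y := []) (z := [])
    ho E₁ E₂
  have h₆ := (exec_machine_iff (tm := fun i => (M i).tm) (i := o)
    (cfg := fun i => idleCfg (M i).tm) (aux := ![[], r, [], []])
    (t := testLabel none)).2 ⟨rfl, _, (localStep_testLabel _
      (haltList (M o).tm ([false].map (M o).outputAlphabet.symm)) _).2 ⟨rfl, rfl⟩, rfl⟩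
  have h₇ := (exec_machine_iff (tm := fun i => (M i).tm) (i := o)
    (cfg := fun i => idleCfg (M i).tm) (aux := ![[], r, [], []])
    (t := popSym (M o).tm.k₁ ((M o).outputAlphabet.symm false))).2 ⟨rfl, _,
      (localStep_popSym _ _ (haltList (M o).tm ([false].map (M o).outputAlphabet.symm)) _).2
        ⟨[], by rw [haltList_eq, mkCfg_stk, Function.update_self]; rfl, rfl⟩, rfl⟩
  refine ⟨_, ?_, _, .seq h₁ (.seq h₂ (.seq h₃ (.seq h₄ (.seq h₅ (.seq h₆ h₇)))))⟩
  have hlen := length_pair x (encodeTable E)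
  simp only [← hz, ← hE] at *
  unfold verifierCost
  omega

/-- The inputs that the verifier accepts at polynomially bounded cost form a problem in NP. -/
theorem setOf_exec_verifier_mem_classNP [Fintype I] (q : Polynomial ℕ) :
    {u | ∃ n ≤ q.eval u.length, ∃ s,
      (verifier M g f o).Exec Action.step n (verifierInit M u) s} ∈ classNP := by
  have h := setOf_exec_mem_classNP (verifier M g f o) 0 q
  have hinit : ∀ u : List Bool, Function.update (fun _ : Fin 4 => ([] : List Bool)) 0 u.reverse =
      ![u.reverse, [], [], []] := by
    intro u
    funext i
    fin_cases i <;> rfl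
  simpa only [hinit] using h

end Host

/-! ### Counting -/

/-- If a function of the `t`-tuples from a finite set takes at most `2 ^ t` values on them, then
few values suffice for the tuples with these values to cover the set. -/
theorem exists_list_cover {α T : Type*} [DecidableEq α] [DecidableEq T] {t : ℕ} (ht : t ≠ 0)
    (τ : (Fin t → α) → T) {V : Finset T} (hV : V.card ≤ 2 ^ t) (k : ℕ) (S : Finset α)
    (hS : S.card < 2 ^ k) (hτ : ∀ X, (∀ i, X i ∈ S) → τ X ∈ V) :
    ∃ l : List T, l.length ≤ k ∧ (∀ v ∈ l, v ∈ V) ∧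
      ∀ x ∈ S, ∃ X : Fin t → α, (∀ i, X i ∈ S) ∧ x ∈ Set.range X ∧ τ X ∈ l := by
  classical
  induction k generalizing S with
  | zero =>
    obtain rfl : S = ∅ := by rw [← Finset.card_eq_zero]; simpa using hS
    exact ⟨[], by simp, by simp, by simp⟩
  | succ k ih =>
    rcases S.eq_empty_or_nonempty with rfl | hne
    · exact ⟨[], by simp, by simp, by simp⟩
    set P := Fintype.piFinset fun _ : Fin t => S with hP
    have hmem : ∀ X, X ∈ P ↔ ∀ i, X i ∈ S := fun X => by simp [hP]
    have hPV : ∀ X ∈ P, τ X ∈ V := fun X hX => hτ X ((hmem X).1 hX)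
    obtain ⟨x₀, hx₀⟩ := hne
    have hVne : V.Nonempty := ⟨_, hτ (fun _ => x₀) fun _ => hx₀⟩
    -- Pigeonhole: if all fibres were smaller than the average, their sum would be too small.
    obtain ⟨v, hv, hcard⟩ : ∃ v ∈ V, P.card ≤ V.card * {X ∈ P | τ X = v}.card := by
      by_contra! h
      have h₁ := Finset.card_eq_sum_card_fiberwise (f := τ) (s := P) (t := V) hPV
      have h₂ : V.card * P.card < V.card * P.card := calc
        V.card * P.card = ∑ v ∈ V, V.card * {X ∈ P | τ X = v}.card := by
          rw [← Finset.mul_sum, ← h₁]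
        _ < ∑ _v ∈ V, P.card := Finset.sum_lt_sum_of_nonempty hVne h
        _ = V.card * P.card := by rw [Finset.sum_const, smul_eq_mul]
      exact lt_irrefl _ h₂
    set C := {x ∈ S | ∃ X : Fin t → α, (∀ i, X i ∈ S) ∧ x ∈ Set.range X ∧ τ X = v} with hC
    have hCS : C ⊆ S := Finset.filter_subset _ _
    -- Every entry of a tuple in the fibre is covered by that very tuple, so the fibre lies in the
    -- power of `C`.
    have hfib : {X ∈ P | τ X = v}.card ≤ C.card ^ t := by
      have : {X ∈ P | τ X = v} ⊆ Fintype.piFinset fun _ : Fin t => C := by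
        intro X hX
        obtain ⟨hXP, hXv⟩ := Finset.mem_filter.1 hX
        have hXS := (hmem X).1 hXP
        exact Fintype.mem_piFinset.2 fun i => Finset.mem_filter.2 ⟨hXS i, X, hXS, ⟨i, rfl⟩, hXv⟩
      simpa using Finset.card_le_card this
    -- Taking `t`-th roots turns the factor `2 ^ t` into a mere 2.
    have hhalf : S.card ≤ 2 * C.card := by
      refine (Nat.pow_le_pow_iff_left ht).1 ?_
      calc S.card ^ t = P.card := by simp [hP]
        _ ≤ V.card * {X ∈ P | τ X = v}.card := hcard
        _ ≤ 2 ^ t * C.card ^ t := Nat.mul_le_mul hV hfib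
        _ = (2 * C.card) ^ t := (mul_pow _ _ _).symm
    have hsdiff := Finset.card_sdiff_add_card_eq_card hCS
    -- At most half of `S` remains, and tuples over the remainder are still tuples over `S`.
    obtain ⟨l, hl, hlV, h⟩ := ih (S \ C) (by rw [pow_succ] at hS; omega)
      fun X hX => hτ X fun i => (Finset.mem_sdiff.1 (hX i)).1
    refine ⟨v :: l, by simpa using hl, by simpa using ⟨hv, hlV⟩, fun x hx => ?_⟩
    by_cases hxC : x ∈ C
    · obtain ⟨-, X, hX, hxX, hXv⟩ := Finset.mem_filter.1 hxC
      exact ⟨X, hX, hxX, by simp [hXv]⟩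
    · obtain ⟨X, hX, hxX, hXl⟩ := h x (Finset.mem_sdiff.2 ⟨hx, hxC⟩)
      exact ⟨X, fun i => (Finset.mem_sdiff.1 (hX i)).1, hxX, List.mem_cons_of_mem _ hXl⟩

/-- The lists of bounded length with entries from a finite set. -/
theorem exists_finset_list {α : Type*} (Z : Finset α) (n : ℕ) :
    ∃ V : Finset (List α), V.card ≤ (Z.card + 1) ^ n ∧
      ∀ l, l.length ≤ n → (∀ a ∈ l, a ∈ Z) → l ∈ V := by
  classical
  induction n with
  | zero => exact ⟨{[]}, by simp, by simp⟩
  | succ n ih =>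
    obtain ⟨V, hV, h⟩ := ih
    refine ⟨insert [] ((Z ×ˢ V).image fun p => p.1 :: p.2), ?_, fun l hl hlZ => ?_⟩
    · calc _ ≤ ((Z ×ˢ V).image fun p => p.1 :: p.2).card + 1 := Finset.card_insert_le _ _
        _ ≤ Z.card * V.card + 1 := by
          rw [← Finset.card_product]; exact Nat.add_le_add_right Finset.card_image_le 1
        _ ≤ Z.card * (Z.card + 1) ^ n + (Z.card + 1) ^ n :=
          Nat.add_le_add (Nat.mul_le_mul_left _ hV) (Nat.one_le_pow _ _ (Nat.succ_pos _))
        _ = (Z.card + 1) ^ (n + 1) := by ring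
    · cases l with
      | nil => simp
      | cons a l =>
        simp only [List.length_cons, Nat.add_le_add_iff_right, List.mem_cons,
          forall_eq_or_imp] at hl hlZ
        simp [hlZ.1, h l hl hlZ.2]

/-! ### Short tables of correct answers -/

namespace ParamComplexity

/-- There are few lists of small instances. -/
theorem exists_finset_queries (Q F t : ℕ) (ht : (3 * F + 1) * Q ≤ t) :
    ∃ V : Finset (List (List Bool × ℕ)), V.card ≤ 2 ^ t ∧
      ∀ l, l.length ≤ Q → (∀ z ∈ l, z.1.length + z.2 ≤ F) → l ∈ V := by
  obtain ⟨Y, hY, hYmem⟩ := exists_finset_list (Finset.univ : Finset Bool) F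
  obtain ⟨V, hV, hVmem⟩ := exists_finset_list (Y ×ˢ Finset.range (F + 1)) Q
  have h3 : (Finset.univ : Finset Bool).card + 1 = 3 := rfl
  rw [h3] at hY
  -- At most `3 ^ F ≤ 2 ^ (2 * F)` strings and `F + 1 ≤ 2 ^ F` parameters; the last factor 2 absorbs
  -- the additional 1 needed to count lists.
  have hZ : (Y ×ˢ Finset.range (F + 1)).card + 1 ≤ 2 ^ (3 * F + 1) := by
    rw [Finset.card_product, Finset.card_range]
    have h₁ : 3 ^ F ≤ 2 ^ (2 * F) := by
      rw [pow_mul]; exact Nat.pow_le_pow_left (by norm_num) F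
    have h₂ : F + 1 ≤ 2 ^ F := Nat.lt_two_pow_self
    have h₃ := Nat.mul_le_mul (hY.trans h₁) h₂
    rw [← pow_add, show 2 * F + F = 3 * F by ring] at h₃
    have h₄ : 1 ≤ 2 ^ (3 * F) := Nat.one_le_two_pow
    rw [pow_succ]
    omega
  refine ⟨V, hV.trans ?_, fun l hl hlF => hVmem l hl fun z hz => ?_⟩
  · calc _ ≤ (2 ^ (3 * F + 1)) ^ Q := Nat.pow_le_pow_left hZ Q
      _ = 2 ^ ((3 * F + 1) * Q) := (pow_mul _ _ _).symm
      _ ≤ 2 ^ t := Nat.pow_le_pow_right (by norm_num) ht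
  · have := hlF z hz
    exact Finset.mem_product.2 ⟨hYmem _ (by omega) (by simp), Finset.mem_range.2 (by omega)⟩

theorem length_encodeInstance (z : List Bool × ℕ) :
    (encodeInstance z).length = 2 * z.1.length + 1 + z.2 := by
  simp [encodeInstance, length_pair]

theorem length_encodeTable_le {E : List (List Bool × Bool)} {B : ℕ}
    (hE : ∀ e ∈ E, e.1.length ≤ B) : (encodeTable E).length ≤ E.length * (2 * B + 2) := by
  induction E with
  | nil => simp [encodeTable]
  | cons e E ih =>
    obtain ⟨q, b⟩ := e
    have h := ih fun e he => hE e (by simp [he])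
    have hq : q.length ≤ B := hE (q, b) (by simp)
    rw [encodeTable_cons, length_pair, List.length_cons, List.length_cons, add_mul]
    omega

/-- A short table of correct answers that covers a set `S` of strings: each element of `S` lies on a
tuple over `S` for which the table contains the answers to the queries. -/
theorem exists_table (R : Set (List Bool × ℕ)) {Q F t k : ℕ} (ht : t ≠ 0)
    (hQ : (3 * F + 1) * Q ≤ t) (S : Finset (List Bool)) (hS : S.card < 2 ^ k)
    (qs : (Fin t → List Bool) → List (List Bool × ℕ))
    (hqs : ∀ X, (∀ i, X i ∈ S) →
      (qs X).length ≤ Q ∧ ∀ z ∈ qs X, z.1.length + z.2 ≤ F) :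
    ∃ E : List (List Bool × Bool),
      (∀ e ∈ E, ∃ z, e.1 = encodeInstance z ∧ (e.2 = true ↔ z ∈ R)) ∧
      (encodeTable E).length ≤ k * Q * (4 * F + 4) ∧
      ∀ x ∈ S, ∃ X : Fin t → List Bool, (∀ i, X i ∈ S) ∧ x ∈ Set.range X ∧
        Host.answers R (qs X) <:+: E := by
  obtain ⟨V, hV, hVmem⟩ := exists_finset_queries Q F t hQ
  -- The set `V` may contain other lists; restricting it bounds the selected lists and thereby the
  -- table.
  set V' := {l ∈ V | l.length ≤ Q ∧ ∀ z ∈ l, z.1.length + z.2 ≤ F} with hV'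
  obtain ⟨l, hl, hlV, h⟩ := exists_list_cover ht qs (V := V')
    ((Finset.card_le_card (Finset.filter_subset _ _)).trans hV) k S hS
    fun X hX => Finset.mem_filter.2 ⟨hVmem _ (hqs X hX).1 (hqs X hX).2, hqs X hX⟩
  have hlV' : ∀ v ∈ l, v.length ≤ Q ∧ ∀ z ∈ v, z.1.length + z.2 ≤ F :=
    fun v hv => (Finset.mem_filter.1 (hlV v hv)).2
  have hmem : ∀ e ∈ l.flatMap (Host.answers R), ∃ v ∈ l, ∃ z ∈ v,
      e.1 = encodeInstance z ∧ (e.2 = true ↔ z ∈ R) := by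
    intro e he
    obtain ⟨v, hv, he⟩ := List.mem_flatMap.1 he
    obtain ⟨z, hz, rfl⟩ := List.mem_map.1 he
    exact ⟨v, hv, z, hz, rfl, by simp⟩
  refine ⟨l.flatMap (Host.answers R), fun e he => ?_, ?_, fun x hx => ?_⟩
  · obtain ⟨-, -, z, -, h⟩ := hmem e he
    exact ⟨z, h⟩
  -- An encoded query has length `2 * |y| + 1 + p ≤ 2 * F + 1`, so a table entry takes at most `4 *
  -- F + 4` bits.
  · refine (length_encodeTable_le (B := 2 * F + 1) fun e he => ?_).trans ?_
    · obtain ⟨v, hv, z, hz, he, -⟩ := hmem e he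
      have := (hlV' v hv).2 z hz
      rw [he, length_encodeInstance]
      omega
    · refine Nat.mul_le_mul ?_ (by omega)
      rw [List.length_flatMap]
      refine (List.sum_le_card_nsmul _ Q ?_).trans ?_
      · intro n hn
        obtain ⟨v, hv, rfl⟩ := List.mem_map.1 hn
        simpa [Host.answers] using (hlV' v hv).1
      · simpa using Nat.mul_le_mul_right Q hl
  · obtain ⟨X, hX, hxX, hXl⟩ := h x hx
    refine ⟨X, hX, hxX, ?_⟩
    obtain ⟨l₁, l₂, rfl⟩ := List.append_of_mem hXl
    exact ⟨l₁.flatMap (Host.answers R), l₂.flatMap (Host.answers R), by simp⟩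

end ParamComplexity

/-! ### Polynomials with natural coefficients -/

namespace Polynomial

theorem eval_mono_of_nat (p : Polynomial ℕ) {a b : ℕ} (h : a ≤ b) : p.eval a ≤ p.eval b := by
  rw [eval_eq_sum, eval_eq_sum]
  exact Finset.sum_le_sum fun i _ => Nat.mul_le_mul_left _ (Nat.pow_le_pow_left h i)

theorem eval_le_mul_pow (p : Polynomial ℕ) {a : ℕ} (ha : 1 ≤ a) :
    p.eval a ≤ p.eval 1 * a ^ p.natDegree := by
  rw [eval_eq_sum, eval_eq_sum, Polynomial.sum, Polynomial.sum, Finset.sum_mul]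
  refine Finset.sum_le_sum fun i hi => ?_
  rw [one_pow, mul_one]
  exact Nat.mul_le_mul_left _ (Nat.pow_le_pow_right ha (le_natDegree_of_mem_supp i hi))

/-- A large power exceeds a polynomial, even if the argument of the latter grows linearly with the
exponent. -/
theorem exists_eval_mul_le_pow (p : Polynomial ℕ) :
    ∃ k, 1 ≤ k ∧ ∀ n : ℕ, p.eval (k * (n + 2)) ≤ (n + 2) ^ k := by
  set d := p.natDegree
  set c := p.eval 1
  -- An exponential in `k` outgrows `c * 2 ^ d * k ^ d`; this fixes `k` independently of `n`.
  have hlim := (tendsto_pow_const_div_const_pow_of_one_lt d (one_lt_two : (1 : ℝ) < 2)).const_mul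
    ((c : ℝ) * 2 ^ d)
  rw [mul_zero] at hlim
  obtain ⟨k, hk, hk1⟩ := ((hlim.eventually_le_const one_pos).and
    (Filter.eventually_ge_atTop (d + 1))).exists
  have hk2 : c * k ^ d * 2 ^ d ≤ 2 ^ k := by
    have h2 : (0 : ℝ) < 2 ^ k := by positivity
    rw [← mul_div_assoc, div_le_one h2] at hk
    have : ((c * k ^ d * 2 ^ d : ℕ) : ℝ) ≤ ((2 ^ k : ℕ) : ℝ) := by
      push_cast
      linarith
    exact_mod_cast this
  -- The exponent `d` pays for `(n + 2) ^ d`, and `e` for the constant, because the base is at least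
  -- 2.
  obtain ⟨e, rfl⟩ : ∃ e, k = d + e := ⟨k - d, by omega⟩
  refine ⟨d + e, by omega, fun n => ?_⟩
  have hk3 : c * (d + e) ^ d ≤ 2 ^ e := by
    rw [pow_add, mul_comm (2 ^ d)] at hk2
    exact Nat.le_of_mul_le_mul_right hk2 (by positivity)
  calc p.eval ((d + e) * (n + 2)) ≤ c * ((d + e) * (n + 2)) ^ d :=
        eval_le_mul_pow p (Nat.mul_pos (by omega) (by omega))
    _ = (c * (d + e) ^ d) * (n + 2) ^ d := by rw [mul_pow, mul_assoc]
    _ ≤ (n + 2) ^ e * (n + 2) ^ d := Nat.mul_le_mul_right _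
        (hk3.trans (Nat.pow_le_pow_left (by omega) e))
    _ = (n + 2) ^ (d + e) := by rw [pow_add, mul_comm]

end Polynomial

/-- The bound on the number of queries of a tuple, with a root instead of a real exponent. -/
theorem exists_pow_le_of_le_rpow {ε : ℝ} (hε : 0 < ε) (C : ℝ) :
    ∃ m c : ℕ, 0 < m ∧ ∀ Q N : ℕ, 1 ≤ N → (Q : ℝ) ≤ C * (N : ℝ) ^ (1 - ε) →
      Q ^ m ≤ c ^ m * N ^ (m - 1) := by
  -- From `1 / (m + 1) < ε` the exponent `1 - ε` may be replaced by `m / (m + 1)`, which becomes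
  -- integral on raising to the power `m + 1`.
  obtain ⟨m, hm⟩ := exists_nat_one_div_lt hε
  obtain ⟨c, hc⟩ := exists_nat_ge C
  refine ⟨m + 1, c, m.succ_pos, fun Q N hN h => ?_⟩
  have hN' : (1 : ℝ) ≤ N := by exact_mod_cast hN
  have h₁ : (Q : ℝ) ≤ c * (N : ℝ) ^ ((m : ℝ) / (m + 1)) := by
    refine h.trans (mul_le_mul hc (Real.rpow_le_rpow_of_exponent_le hN' ?_) (by positivity)
      (by positivity))
    have : (m : ℝ) / (m + 1) = 1 - 1 / (m + 1) := by field_simp; ring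
    linarith
  have h₂ : (Q : ℝ) ^ (m + 1) ≤ (c : ℝ) ^ (m + 1) * (N : ℝ) ^ m := by
    calc (Q : ℝ) ^ (m + 1) ≤ (c * (N : ℝ) ^ ((m : ℝ) / (m + 1))) ^ (m + 1) :=
          pow_le_pow_left₀ (by positivity) h₁ _
      _ = _ := by
        rw [mul_pow, ← Real.rpow_natCast ((N : ℝ) ^ _), ← Real.rpow_mul (by positivity)]
        push_cast
        rw [div_mul_cancel₀ _ (by positivity), Real.rpow_natCast]
  exact_mod_cast h₂

/-! ### Polynomial bounds and the length of the tuples -/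

namespace ParamComplexity

/-- A machine that does not use its oracle. -/
def OracleTM.ofAux (c : TM2ComputableAux Bool Bool) : OracleTM where
  tm := c.tm
  inputAlphabet := c.inputAlphabet
  outputAlphabet := c.outputAlphabet
  kq := c.tm.k₀
  queryAlphabet := c.inputAlphabet
  ask := c.tm.main
  yes := c.tm.main
  no := c.tm.main

/-- Outputs are polynomially long because each step pushes boundedly many symbols. This bound is
what makes the images under `g` short enough for the composition. -/
theorem exists_computes {α β : Type} {ea : α → List Bool} {eb : β → List Bool} {f : α → β}
    (h : Nonempty (TM2ComputableInPolyTime ea eb f)) :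
    ∃ (M : OracleTM) (p q : Polynomial ℕ) (T : α → ℕ), ∀ a,
      Host.Computes M (ea a) (eb (f a)) (T a) ∧ T a ≤ p.eval (ea a).length ∧
        (eb (f a)).length ≤ q.eval (ea a).length := by
  obtain ⟨c⟩ := h
  obtain ⟨d, hd⟩ := StackMachine.exists_growth c.tm.m
  refine ⟨.ofAux c.toTM2ComputableAux, c.time, Polynomial.X + c.time * Polynomial.C d,
    fun a => (c.outputsFun a).steps, fun a => ?_⟩
  have hT := (c.outputsFun a).steps_le_m
  have hrun : Host.Computes (.ofAux c.toTM2ComputableAux) (ea a) (eb (f a))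
      (c.outputsFun a).steps := ReachesIn.iterate_bind_iff.1 (c.outputsFun a).evals_in_steps
  refine ⟨hrun, hT, ?_⟩
  have hlen := hd _ _ _ hrun c.tm.k₁
  have h₁ : ((haltList c.tm ((eb (f a)).map c.outputAlphabet.symm)).stk c.tm.k₁).length =
      (eb (f a)).length := by
    rw [Host.haltList_eq, Host.mkCfg_stk, Function.update_self, List.length_map]
  have h₂ : ((initList c.tm ((ea a).map c.inputAlphabet.symm)).stk c.tm.k₁).length ≤
      (ea a).length := by
    rw [Host.initList_eq, Host.mkCfg_stk]
    -- If input and output share a stack, the input already counts towards its height.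
    by_cases h : c.tm.k₁ = c.tm.k₀
    · rw [h, Function.update_self, List.length_map]
    · rw [Function.update_of_ne h]; simp
  calc (eb (f a)).length ≤ (ea a).length + (c.outputsFun a).steps * d :=
        (h₁.symm.trans_le hlen).trans (Nat.add_le_add_right h₂ _)
    _ ≤ (ea a).length + c.time.eval (ea a).length * d :=
        Nat.add_le_add_left (Nat.mul_le_mul_right _ hT) _
    _ = _ := by simp

theorem maxLength_le {ys : List (List Bool)} {B : ℕ} (h : ∀ y ∈ ys, y.length ≤ B) :
    maxLength ys ≤ B := by
  induction ys with
  | nil => simp [maxLength]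
  | cons z ys ih =>
    have := ih fun y hy => h y (by simp [hy])
    simpa [maxLength] using ⟨h z (by simp), this⟩

theorem length_encodeTuple_le {ys : List (List Bool)} {B : ℕ} (h : ∀ y ∈ ys, y.length ≤ B) :
    (encodeTuple ys).length ≤ ys.length * (2 * B + 1) := by
  induction ys with
  | nil => simp [encodeTuple]
  | cons z ys ih =>
    have h₁ := ih fun y hy => h y (by simp [hy])
    have h₂ := h z (by simp)
    have h₃ : (encodeTuple (z :: ys)).length = (selfDelim z).length + (encodeTuple ys).length := by
      simp [encodeTuple]
    rw [h₃, length_selfDelim, List.length_cons, add_mul]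
    omega

/-- If a tuple of `t` strings is composed to one instance and the Turing kernel is applied to the
latter, then for a suitable polynomial `t` there are fewer than `t` bits in all queries. -/
theorem exists_tuple_length {f : {xs : List (List Bool) // xs ≠ []} → List Bool × ℕ}
    {qs : List Bool × ℕ → List (List Bool × ℕ)} {q₁ q₂ q₃ h : Polynomial ℕ} {C ε : ℝ}
    (hsize : ∀ xs, instSize (f xs) ≤
      xs.1.length * q₁.eval (Nat.log 2 xs.1.length) * q₂.eval (maxLength xs.1))
    (hpar : ∀ xs, (f xs).2 ≤ q₃.eval (maxLength xs.1 + Nat.log 2 xs.1.length))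
    (hqs : ∀ z, ∀ z' ∈ qs z, z'.1.length + z'.2 ≤ h.eval z.2) (hε : 0 < ε)
    (hnum : ∀ z, ((qs z).length : ℝ) ≤ C * (instSize z : ℝ) ^ (1 - ε)) (G : Polynomial ℕ) :
    ∃ (k : ℕ) (F N : Polynomial ℕ), ∀ n xs, xs.1.length = (n + 2) ^ k →
      maxLength xs.1 ≤ G.eval n →
      (3 * F.eval n + 1) * (qs (f xs)).length ≤ (n + 2) ^ k ∧
      (∀ z ∈ qs (f xs), z.1.length + z.2 ≤ F.eval n) ∧ instSize (f xs) ≤ N.eval n := by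
  obtain ⟨m, c, hm, hroot⟩ := exists_pow_le_of_le_rpow hε C
  set F₀ : Polynomial ℕ := h.comp (q₃.comp (G + .X)) with hF₀
  set S : Polynomial ℕ := q₁ * q₂.comp G with hS
  -- The circularity: `t` must beat a polynomial in `log t`, which depends on `k`. It is harmless
  -- because `log t ≤ k * (n + 2)` is linear in `k`.
  obtain ⟨k, hk1, hk⟩ := Polynomial.exists_eval_mul_le_pow
    ((3 * F₀ + 1) ^ m * .C c ^ m * S ^ (m - 1))
  set V : Polynomial ℕ := .C k * (.X + 2) with hV
  refine ⟨k, F₀.comp V, (.X + 2) ^ k * S.comp V, fun n xs ht hmax => ?_⟩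
  set v := k * (n + 2) with hv
  have hVv : V.eval n = v := by simp [hV, hv]
  simp only [Polynomial.eval_comp, Polynomial.eval_mul, Polynomial.eval_pow, Polynomial.eval_add,
    Polynomial.eval_X, Polynomial.eval_ofNat, hVv]
  set t := (n + 2) ^ k with ht'
  have hnv : n ≤ v := calc
    n ≤ 1 * (n + 2) := by omega
    _ ≤ v := Nat.mul_le_mul_right _ hk1
  have hlog : Nat.log 2 xs.1.length ≤ v := by
    rw [ht]
    refine (Nat.log_mono_right (b := 2) ?_).trans_eq (Nat.log_pow (by norm_num) v)
    rw [hv, mul_comm, pow_mul]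
    exact Nat.pow_le_pow_left Nat.lt_two_pow_self.le k
  have hmax' : maxLength xs.1 ≤ G.eval v := hmax.trans (G.eval_mono_of_nat hnv)
  have hN : instSize (f xs) ≤ t * S.eval v := by
    refine (hsize xs).trans ?_
    rw [ht, mul_assoc, hS, Polynomial.eval_mul, Polynomial.eval_comp]
    exact Nat.mul_le_mul_left _ (Nat.mul_le_mul (q₁.eval_mono_of_nat (ht ▸ hlog))
      (q₂.eval_mono_of_nat hmax'))
  have hF : ∀ z ∈ qs (f xs), z.1.length + z.2 ≤ F₀.eval v := by
    intro z hz
    refine (hqs _ z hz).trans ?_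
    rw [hF₀, Polynomial.eval_comp, Polynomial.eval_comp, Polynomial.eval_add, Polynomial.eval_X]
    exact h.eval_mono_of_nat ((hpar xs).trans (q₃.eval_mono_of_nat (Nat.add_le_add hmax' hlog)))
  refine ⟨?_, hF, hN⟩
  have hQ := hroot (qs (f xs)).length (instSize (f xs)) (by unfold instSize; omega) (hnum _)
  have hk := hk n
  simp only [Polynomial.eval_mul, Polynomial.eval_pow, Polynomial.eval_add, Polynomial.eval_one,
    Polynomial.eval_ofNat, Polynomial.eval_C] at hk
  -- Comparing `m`-th powers: the queries contribute only `t ^ (m - 1)`, and the spare factor `t`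
  -- absorbs all polynomial factors.
  refine (Nat.pow_le_pow_iff_left hm.ne').1 ?_
  calc ((3 * F₀.eval v + 1) * (qs (f xs)).length) ^ m
      = (3 * F₀.eval v + 1) ^ m * (qs (f xs)).length ^ m := mul_pow _ _ _
    _ ≤ (3 * F₀.eval v + 1) ^ m * (c ^ m * (t * S.eval v) ^ (m - 1)) :=
      Nat.mul_le_mul_left _ (hQ.trans (Nat.mul_le_mul_left _ (Nat.pow_le_pow_left hN _)))
    _ = ((3 * F₀.eval v + 1) ^ m * c ^ m * S.eval v ^ (m - 1)) * t ^ (m - 1) := by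
      rw [mul_pow]; ring
    _ ≤ t * t ^ (m - 1) := Nat.mul_le_mul_right _ hk
    _ = t ^ m := mul_pow_sub_one hm.ne' t

end ParamComplexity

namespace Host

theorem verifierCost_mono {a a' t B y y' z z' τ₁ τ₁' τ₂ τ₂' d₁ d₂ : ℕ} (ha : a ≤ a') (hy : y ≤ y')
    (hz : z ≤ z') (h₁ : τ₁ ≤ τ₁') (h₂ : τ₂ ≤ τ₂') :
    verifierCost a t B y z τ₁ τ₂ d₁ d₂ ≤ verifierCost a' t B y' z' τ₁' τ₂' d₁ d₂ := by
  unfold verifierCost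
  gcongr

end Host

/-! ### From a Turing kernel to coNP/poly -/

namespace ParamComplexity

/-- The strings of length `n` that are not in `A`. -/
theorem exists_finset_nonmembers (A : Set (List Bool)) (n : ℕ) :
    ∃ S : Finset (List Bool), S.card < 2 ^ (2 * n + 1) ∧
      ∀ x, x ∈ S ↔ x.length = n ∧ x ∉ A := by
  classical
  obtain ⟨V, hV, hmem⟩ := exists_finset_list (Finset.univ : Finset Bool) n
  refine ⟨{x ∈ V | x.length = n ∧ x ∉ A}, ?_, fun x => ?_⟩
  · calc _ ≤ V.card := Finset.card_filter_le _ _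
      _ ≤ 3 ^ n := hV
      _ ≤ 4 ^ n := Nat.pow_le_pow_left (by norm_num) n
      _ = 2 ^ (2 * n) := by rw [pow_mul]; rfl
      _ < 2 ^ (2 * n + 1) := Nat.pow_lt_pow_right (by norm_num) (by omega)
  · rw [Finset.mem_filter, and_iff_right_iff_imp]
    exact fun h => hmem x h.1.le (by simp)

/-- The advice for length `n` is a table covering the nonmembers of that length, and the coNP
problem is the complement of what the verifier accepts. -/
theorem mem_classCoNPPoly_of_kernel {A L : Set (List Bool)} {R : Set (List Bool × ℕ)} {ε : ℝ}
    (hAL : KarpReducible A L) (hLR : HasLinearORComposition L R) (hε : 0 < ε)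
    (hR : HasPolyTuringKernel R (1 - ε)) : A ∈ classCoNPPoly := by
  obtain ⟨g, hg, hgA⟩ := hAL
  obtain ⟨f, hf, ⟨q₁, q₂, hsize⟩, ⟨q₃, hpar⟩, hfR⟩ := hLR
  obtain ⟨Mo, po, h, C, hker⟩ := hR
  choose b qs τ hout hb hτ hsmall hnum using hker
  obtain ⟨Mg, pg, G, Tg, hMg⟩ := exists_computes hg
  obtain ⟨Mf, pf, _, Tf, hMf⟩ := exists_computes hf
  obtain ⟨k, F, N, hkFN⟩ := exists_tuple_length hsize hpar hsmall hε hnum G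
  set M : Fin 3 → OracleTM := ![Mg, Mf, Mo] with hM
  -- The default on the empty list is never used, since guessed tuples contain `x`.
  set F' : List (List Bool) → List Bool × ℕ :=
    fun ys => if h : ys ≠ [] then f ⟨ys, h⟩ else ([], 0) with hF'
  set Tf' : List (List Bool) → ℕ := fun ys => if h : ys ≠ [] then Tf ⟨ys, h⟩ else 0 with hTf'
  have hF'eq : ∀ ys (h : ys ≠ []), F' ys = f ⟨ys, h⟩ := fun ys h => dif_pos h
  have hTf'eq : ∀ ys (h : ys ≠ []), Tf' ys = Tf ⟨ys, h⟩ := fun ys h => dif_pos h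
  have hcompg : ∀ w, Host.Computes (M 0) w (g w) (Tg w) := fun w => (hMg w).1
  have hcompf : ∀ ys, ys ≠ [] →
      Host.Computes (M 1) (encodeTuple ys) (encodeInstance (F' ys)) (Tf' ys) := by
    intro ys h
    rw [hF'eq ys h, hTf'eq ys h]
    exact (hMf ⟨ys, h⟩).1
  have hF'R : ∀ ys, ys ≠ [] → (F' ys ∈ R ↔ ∃ y ∈ ys, y ∈ L) := by
    intro ys h
    rw [hF'eq ys h]
    exact hfR ⟨ys, h⟩
  have htable : ∀ n, ∃ E : List (List Bool × Bool),
      (∀ e ∈ E, ∃ z, e.1 = encodeInstance z ∧ (e.2 = true ↔ z ∈ R)) ∧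
      (encodeTable E).length ≤ (2 * n + 1) * (n + 2) ^ k * (4 * F.eval n + 4) ∧
      ∀ x, x.length = n → x ∉ A → ∃ xs : List (List Bool), xs.length = (n + 2) ^ k ∧ x ∈ xs ∧
        (∀ w ∈ xs, w.length = n) ∧ instSize (F' (xs.map g)) ≤ N.eval n ∧
        F' (xs.map g) ∉ R ∧ Host.answers R (qs (F' (xs.map g))) <:+: E := by
    intro n
    obtain ⟨S, hS, hSmem⟩ := exists_finset_nonmembers A n
    set t := (n + 2) ^ k with ht
    have ht0 : 0 < t := by positivity
    have hne : ∀ X : Fin t → List Bool, (List.ofFn X).map g ≠ [] := by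
      intro X h
      have := congrArg List.length h
      simp at this
      omega
    have hX : ∀ X : Fin t → List Bool, (∀ i, X i ∈ S) →
        (3 * F.eval n + 1) * (qs (F' ((List.ofFn X).map g))).length ≤ t ∧
        (∀ z ∈ qs (F' ((List.ofFn X).map g)), z.1.length + z.2 ≤ F.eval n) ∧
        instSize (F' ((List.ofFn X).map g)) ≤ N.eval n := by
      intro X hX
      rw [hF'eq _ (hne X)]
      refine hkFN n ⟨_, hne X⟩ (by simp [ht]) (maxLength_le fun y hy => ?_)
      obtain ⟨w, hw, rfl⟩ := List.mem_map.1 hy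
      obtain ⟨i, rfl⟩ := (List.mem_ofFn).1 hw
      have := (hMg (X i)).2.2
      rwa [id, id, ((hSmem _).1 (hX i)).1] at this
    -- The largest number of queries for which the description of all of them still fits into `t`
    -- bits.
    obtain ⟨E, hE, hlen, hcov⟩ := exists_table R (Q := t / (3 * F.eval n + 1)) ht0.ne'
      (Nat.mul_div_le _ _) S hS (fun X => qs (F' ((List.ofFn X).map g))) fun X hXS =>
        ⟨(Nat.le_div_iff_mul_le (Nat.succ_pos _)).2 (by rw [mul_comm]; exact (hX X hXS).1),
          (hX X hXS).2.1⟩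
    refine ⟨E, hE, hlen.trans ?_, fun x hx hxA => ?_⟩
    · gcongr
      exact Nat.div_le_self _ _
    · obtain ⟨X, hXS, hxX, hXE⟩ := hcov x ((hSmem x).2 ⟨hx, hxA⟩)
      have hmem : ∀ w ∈ List.ofFn X, w.length = n ∧ w ∉ A := by
        intro w hw
        obtain ⟨i, rfl⟩ := (List.mem_ofFn).1 hw
        exact (hSmem _).1 (hXS i)
      refine ⟨List.ofFn X, by simp, (List.mem_ofFn).2 hxX, fun w hw => (hmem w hw).1,
        (hX X hXS).2.2, ?_, hXE⟩
      -- All entries are outside `A`, so no image under `g` is in `L`, and the composed instance is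
      -- negative.
      rw [hF'R _ (hne X)]
      rintro ⟨y, hy, hyL⟩
      obtain ⟨w, hw, rfl⟩ := List.mem_map.1 hy
      exact (hmem w hw).2 ((hgA w).2 hyL)
  choose E hER hElen hEcov using htable
  set a : Polynomial ℕ := (2 * .X + 1) * (.X + 2) ^ k * (4 * F + 4) with ha
  set d : Fin 3 → ℕ := fun i => Fintype.card (M i).tm.Λ with hd
  -- The cost of the verifier, with each parameter replaced by its polynomial bound in `n`.
  obtain ⟨q, hq⟩ : ∃ q : Polynomial ℕ, ∀ n, q.eval n = Host.verifierCost (2 * n + 1 + a.eval n)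
      ((n + 2) ^ k) (7 * n + 4 * G.eval n + pg.eval n * (d 0 + 2) + 9)
      ((n + 2) ^ k * (2 * G.eval n + 1)) (2 * N.eval n)
      (pf.eval ((n + 2) ^ k * (2 * G.eval n + 1))) (po.eval (N.eval n)) (d 1) (d 2) := by
    refine ⟨14 * (2 * .X + 1 + a) +
      (.X + 2) ^ k * (7 * .X + 4 * G + pg * (.C (d 0) + 2) + 9 + 1) +
      4 * ((.X + 2) ^ k * (2 * G + 1)) + 8 * (2 * N) +
      pf.comp ((.X + 2) ^ k * (2 * G + 1)) * (.C (d 1) + 2) +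
      po.comp N * (.C (d 2) + 3) + 30, fun n => ?_⟩
    simp [Host.verifierCost]
  refine ⟨{u | ∃ n ≤ q.eval u.length, ∃ s,
    (Host.verifier M 0 1 2).Exec Host.Action.step n (Host.verifierInit M u) s}ᶜ, ?_,
    fun n => encodeTable (E n), a, fun n => ?_, fun x => ?_⟩
  · rw [classCoNP, Set.mem_ofPred_eq, compl_compl]
    exact Host.setOf_exec_verifier_mem_classNP q
  · simpa [ha] using hElen n
  · rw [Set.mem_compl_iff, Set.mem_ofPred_eq, ← not_iff_not, not_not]
    constructor
    · intro hxA
      obtain ⟨xs, hxs, hx, hw, hN, hnR, hans⟩ := hEcov _ x rfl hxA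
      set n := x.length with hn
      have hne : xs.map g ≠ [] := by
        rw [Ne, List.map_eq_nil_iff]
        exact List.ne_nil_of_mem hx
      have hout' : (M 2).Outputs R (F' (xs.map g)) false (qs (F' (xs.map g)))
          (τ (F' (xs.map g))) := by
        have hbf : b (F' (xs.map g)) = false := by
          rw [← Bool.not_eq_true, hb]
          exact hnR
        rw [← hbf]
        exact hout _
      have hglen : ∀ w ∈ xs, (g w).length ≤ G.eval n := by
        intro w hwx
        have := (hMg w).2.2
        rwa [id, id, hw w hwx] at this
      have hylen : (encodeTuple (xs.map g)).length ≤ (n + 2) ^ k * (2 * G.eval n + 1) := by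
        have := length_encodeTuple_le (ys := xs.map g) (B := G.eval n) (by simpa using hglen)
        rwa [List.length_map, hxs] at this
      obtain ⟨m, hm, s, hs⟩ := Host.exec_verifier (M := M) (g := 0) (f := 1) (o := 2) hcompg hcompf
        hx (B := 7 * n + 4 * G.eval n + pg.eval n * (d 0 + 2) + 9) (by
          intro w hwx
          have h₁ := hglen w hwx
          have h₂ := (hMg w).2.1
          rw [id, hw w hwx] at h₂
          have h₃ := Nat.mul_le_mul_right (d 0 + 2) h₂
          rw [hw w hwx]
          change 7 * n + 4 * (g w).length + Tg w * (d 0 + 2) + 9 ≤ _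
          omega) hout' hans
      refine ⟨m, hm.trans ?_, s, hs⟩
      -- The cost may be as large as `q` at the length of the whole input with advice, which is at
      -- least `n`.
      refine le_trans ?_ (q.eval_mono_of_nat (a := n) (by rw [length_pair]; omega))
      rw [hq, hxs]
      refine Host.verifierCost_mono ?_ hylen ?_ ?_ ?_
      · rw [length_pair]
        refine Nat.add_le_add_left ?_ _
        simpa [ha] using hElen n
      · rw [length_encodeInstance]
        unfold instSize at hN
        omega
      · rw [hTf'eq _ hne]
        exact (hMf ⟨_, hne⟩).2.1.trans (pf.eval_mono_of_nat hylen)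
      · exact (hτ _).trans (po.eval_mono_of_nat hN)
    -- Soundness does not use the cost bound: a member `x` would make the composed instance
    -- positive.
    · rintro ⟨m, -, s, hs⟩ hxA
      obtain ⟨xs, hx, hnR⟩ := Host.exists_tuple_of_exec_verifier (M := M) (g := 0) (f := 1) (o := 2)
        (R := R) hcompg hcompf
        (fun z => ⟨b z, qs z, τ z, hout z, hb z⟩) (hER _) hs
      rw [hF'R _ (by rw [Ne, List.map_eq_nil_iff]; exact List.ne_nil_of_mem hx)] at hnR
      exact hnR ⟨g x, List.mem_map_of_mem hx, (hgA x).1 hxA⟩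

end ParamComplexity

theorem theorem3 (R : Set (List Bool × ℕ))
    (hR : ∃ L : Set (List Bool), NPHard L ∧ HasLinearORComposition L R)
    (hNP : ¬ classNP ⊆ classCoNPPoly) (ε : ℝ) (hε : 0 < ε) :
    ¬ HasPolyTuringKernel R (1 - ε) := by
  obtain ⟨L, hL, hLR⟩ := hR
  exact fun hK => hNP fun A hA => mem_classCoNPPoly_of_kernel (hL A hA) hLR hε hK
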